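/- **Theorem.** There are a single streaming program (a real RAM program with unit-cost operations $+,-,\times,/,\sqrt{\cdot}$, comparisons, indirect addressing, and integer registers for counters and addresses; one program for all dimensions, which does not know the length of the stream) and absolute constants $C,k$ such that the following holds for every $d\ge 1$ and every stream of points $z_1,z_2,\dots\in\mathbb{R}^d$, without any initialization. After each timestep $t\ge 1$ the program stores an origin-centered (possibly lower-dimensional) ellipsoid $\mathcal E_t$, represented as $\{Q_tu:\|u\|_2\le 1\}$ by a $d\times d$ matrix $Q_t$, a center $c_t$ and a scale $\alpha_t\in(0,1]$ with $$c_t+\alpha_t\mathcal E_t\subseteq \mathrm{conv}\{z_1,\dots,z_t\}\subseteq c_t+\mathcal E_t .$$ *The algorithm.* It starts with $c_1=z_1$, $\mathcal E_1=\{0\}$, $\alpha_1=1$. - If $z_{t+1}$ is not in the affine span of $z_1,\dots,z_t$, it makes an irregular update: with $\alpha=\alpha_t$ and $v=z_{t+1}-c_t$, $$c_{t+1}=c_t+\tfrac{\alpha}{1+2\alpha}v,\qquad \mathcal E_{t+1}=\Big\{Q_tu+sv:\ \|u\|_2^2+(1+2\alpha)s^2\le \tfrac{(1+\alpha)^2}{1+2\alpha}\Big\},\qquad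 \frac1{\alpha_{t+1}}=\frac1{\alpha_t}+1 ,$$ so that the approximation factor $1/\alpha_t$ grows by exactly $1$. - Otherwise it makes a monotone update, that is, one with $\mathrm{conv}\big((c_t+\mathcal E_t)\cup\{z_{t+1}\}\big)\subseteq c_{t+1}+\mathcal E_{t+1}$ and $c_{t+1}+\alpha_{t+1}\mathcal E_{t+1}\subseteq\mathrm{conv}\big((c_t+\alpha_t\mathcal E_t)\cup\{z_{t+1}\}\big)$. *Approximation factor.* Let $d_t$ be the dimension of the affine span of $z_1,\dots,z_t$. Let $R_t$ be the circumradius of $\mathrm{conv}\{z_1,\dots,z_t\}$ and $r_t$ its inradius relative to its affine span ($r_t=\infty$ if $d_t=0$). Put $\kappa_t=\max_{t'\le t}R_t/r_{t'}$. Then for all $t\ge 1$ $$\frac1{\alpha_t}\le C\,d_t\log(d_t\kappa_t)\ \text{ if } d_t\ge 2,\qquad \frac1{\alpha_t}\le C(1+\log\kappa_t)\ \text{ if } d_t=1,\qquad \alpha_t=1\ \text{ if } d_t=0 .$$ *Resources.* For every $n\ge1$ the first $n$ points are processed in at most $C\,n\,d^2(1+\log(nd))^k$ steps, i.e. in time $\widetilde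 O(nd^2)$, and the program uses at most $Cd^2$ real memory cells, besides a constant number of registers. Its integer registers never exceed $Cd^2$. -/

import Mathlib

namespace StreamRounding

/-! ## A real random access machine with a step count and a memory bound

The machine has integer registers, real registers and an array of real memory cells.  A program
mentions finitely many registers by fixed names, and reaches the memory cells only through
addresses held in integer registers.  A streaming algorithm is a single program, the same for all
dimensions, that is run once for every arriving point; registers and memory persist between runs,
and the coordinates of the current point (only) can be read through `input`. -/

/-- Contents of the integer registers, of the real registers and of the real memory. -/
structure State where
  ireg : ℕ → ℕ
  rreg : ℕ → ℝ
  mem : ℕ → ℝ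

/-- Elementary instructions, each of unit cost. -/
inductive Instr where
  /-- integer register `r` := the constant `k` -/
  | iconst (r k : ℕ)
  /-- integer registers: `r := a + b` -/
  | iadd (r a b : ℕ)
  /-- integer registers: `r := a - b`, truncated at `0` -/
  | isub (r a b : ℕ)
  /-- real register `x` := the constant `k` -/
  | rconst (x : ℕ) (k : ℤ)
  /-- real registers: `x := y + w` -/
  | radd (x y w : ℕ)
  /-- real registers: `x := y - w` -/
  | rsub (x y w : ℕ)
  /-- real registers: `x := y * w` -/
  | rmul (x y w : ℕ)
  /-- real registers: `x := y / w`; not executable if `w` holds `0` -/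
  | rdiv (x y w : ℕ)
  /-- real registers: `x := √y`; not executable if `y` holds a negative number -/
  | rsqrt (x y : ℕ)
  /-- real register `x` := the memory cell whose address is held by the integer register `r` -/
  | load (x r : ℕ)
  /-- the memory cell whose address is held by the integer register `r` := real register `x` -/
  | store (r x : ℕ)
  /-- real register `x` := the coordinate of the current point whose index is held by `r` -/
  | input (x r : ℕ)

/-- Elementary tests, each of unit cost: strict comparison of two integer registers, or of two
real registers. -/
inductive Test where
  | ilt (a b : ℕ)
  | rlt (x y : ℕ)

/-- Structured programs. -/
inductive Prog where
  | skip
  | instr (i : Instr)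
  | seq (p q : Prog)
  | ite (b : Test) (p q : Prog)
  | loop (b : Test) (p : Prog)

namespace State

/-- Write to an integer register. -/
def setI (s : State) (r k : ℕ) : State := { s with ireg := Function.update s.ireg r k }

/-- Write to a real register. -/
def setR (s : State) (x : ℕ) (v : ℝ) : State := { s with rreg := Function.update s.rreg x v }

/-- Write to a memory cell. -/
def setMem (s : State) (a : ℕ) (v : ℝ) : State := { s with mem := Function.update s.mem a v }

/-- Before the first point arrives, the integer register `0` holds the dimension, and everything
else is `0`. -/
def initial (d : ℕ) : State where
  ireg := fun r => if r = 0 then d else 0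
  rreg := fun _ => 0
  mem := fun _ => 0

end State

/-- The truth value of a test. -/
def Test.Holds (s : State) : Test → Prop
  | .ilt a b => s.ireg a < s.ireg b
  | .rlt x y => s.rreg x < s.rreg y

open Classical in
/-- The effect of an instruction on a machine with `S` memory cells (addresses `0, …, S - 1`) and
integer registers of range `0, …, S`, while the current point is `z`.  The value is `none`, and the
instruction cannot be executed, if it uses an address or produces an integer out of range, asks
for a coordinate that does not exist, divides by zero or takes the root of a negative number. -/
noncomputable def Instr.exec {d : ℕ} (S : ℕ) (z : EuclideanSpace ℝ (Fin d)) (s : State) :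
    Instr → Option State
  | .iconst r k => if k ≤ S then some (s.setI r k) else none
  | .iadd r a b => if s.ireg a + s.ireg b ≤ S then some (s.setI r (s.ireg a + s.ireg b)) else none
  | .isub r a b => some (s.setI r (s.ireg a - s.ireg b))
  | .rconst x k => some (s.setR x (k : ℝ))
  | .radd x y w => some (s.setR x (s.rreg y + s.rreg w))
  | .rsub x y w => some (s.setR x (s.rreg y - s.rreg w))
  | .rmul x y w => some (s.setR x (s.rreg y * s.rreg w))
  | .rdiv x y w => if s.rreg w ≠ 0 then some (s.setR x (s.rreg y / s.rreg w)) else none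
  | .rsqrt x y => if 0 ≤ s.rreg y then some (s.setR x (Real.sqrt (s.rreg y))) else none
  | .load x r => if s.ireg r < S then some (s.setR x (s.mem (s.ireg r))) else none
  | .store r x => if s.ireg r < S then some (s.setMem (s.ireg r) (s.rreg x)) else none
  | .input x r => if h : s.ireg r < d then some (s.setR x (z ⟨s.ireg r, h⟩)) else none

/-- `Exec S z p s T s'`: on a machine with `S` memory cells, while the current point is `z`, the
program `p` started in the state `s` terminates in the state `s'` after exactly `T` elementary
instructions and tests. -/
inductive Exec {d : ℕ} (S : ℕ) (z : EuclideanSpace ℝ (Fin d)) :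
    Prog → State → ℕ → State → Prop where
  | skip (s : State) : Exec S z .skip s 0 s
  | instr {i : Instr} {s s' : State} (h : i.exec S z s = some s') : Exec S z (.instr i) s 1 s'
  | seq {p q : Prog} {s s' s'' : State} {T T' : ℕ}
      (hp : Exec S z p s T s') (hq : Exec S z q s' T' s'') : Exec S z (.seq p q) s (T + T') s''
  | ite_true {b : Test} {p q : Prog} {s s' : State} {T : ℕ}
      (hb : b.Holds s) (hp : Exec S z p s T s') : Exec S z (.ite b p q) s (T + 1) s'
  | ite_false {b : Test} {p q : Prog} {s s' : State} {T : ℕ}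
      (hb : ¬ b.Holds s) (hq : Exec S z q s T s') : Exec S z (.ite b p q) s (T + 1) s'
  | loop_true {b : Test} {p : Prog} {s s' s'' : State} {T T' : ℕ}
      (hb : b.Holds s) (hp : Exec S z p s T s') (hl : Exec S z (.loop b p) s' T' s'') :
      Exec S z (.loop b p) s (T + T' + 1) s''
  | loop_false {b : Test} {p : Prog} {s : State}
      (hb : ¬ b.Holds s) : Exec S z (.loop b p) s 1 s

/-! ## Ellipsoidal roundings -/

/-- The data maintained by the algorithm: a matrix `Q` that represents the origin-centered
ellipsoid `{Q u : ‖u‖ ≤ 1}` (possibly of lower dimension), a center `c`, and a scale `α`. -/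
structure Rounding (d : ℕ) where
  shape : Matrix (Fin d) (Fin d) ℝ
  center : EuclideanSpace ℝ (Fin d)
  scale : ℝ

namespace Rounding

variable {d : ℕ}

/-- The origin-centered ellipsoid `ℰ`. -/
def ellipsoid (ρ : Rounding d) : Set (EuclideanSpace ℝ (Fin d)) :=
  Matrix.toEuclideanLin ρ.shape '' Metric.closedBall 0 1

/-- The outer ellipsoid `c + ℰ`. -/
def outer (ρ : Rounding d) : Set (EuclideanSpace ℝ (Fin d)) :=
  (fun x => ρ.center + x) '' ρ.ellipsoid

/-- The inner ellipsoid `c + α ℰ`. -/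
def inner (ρ : Rounding d) : Set (EuclideanSpace ℝ (Fin d)) :=
  (fun x => ρ.center + ρ.scale • x) '' ρ.ellipsoid

/-- The data stored in the memory: cell `0` holds the scale, cells `1, …, d` hold the center, and
the next `d ^ 2` cells hold the matrix, row by row. -/
def ofState (d : ℕ) (s : State) : Rounding d where
  shape := Matrix.of fun i j => s.mem (1 + d + d * i + j)
  center := WithLp.toLp 2 fun i => s.mem (1 + i)
  scale := s.mem 0

/-- The update from `ρ` to `ρ'` by the point `z` is monotone. -/
def IsMonotoneUpdate (ρ : Rounding d) (z : EuclideanSpace ℝ (Fin d)) (ρ' : Rounding d) : Prop :=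
  convexHull ℝ (ρ.outer ∪ {z}) ⊆ ρ'.outer ∧ ρ'.inner ⊆ convexHull ℝ (ρ.inner ∪ {z})

/-- The irregular update from `ρ` to `ρ'` by a point `z` outside the affine span of the earlier
points: in the coordinates in which `ρ.outer` is the unit ball and `z` is the point at distance
`√(1 + 2α)` from its center in a new orthogonal direction `e`, the new outer ellipsoid is the ball
of radius `(1 + α) / √(1 + 2α)` about `(α / √(1 + 2α)) e`, and `1 / α` grows by exactly `1`. -/
def IsIrregularUpdate (ρ : Rounding d) (z : EuclideanSpace ℝ (Fin d)) (ρ' : Rounding d) : Prop :=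
  ρ'.center = ρ.center + (ρ.scale / (1 + 2 * ρ.scale)) • (z - ρ.center) ∧
  ρ'.ellipsoid = {x | ∃ (u : EuclideanSpace ℝ (Fin d)) (s : ℝ),
    x = Matrix.toEuclideanLin ρ.shape u + s • (z - ρ.center) ∧
    ‖u‖ ^ 2 + (1 + 2 * ρ.scale) * s ^ 2 ≤ (1 + ρ.scale) ^ 2 / (1 + 2 * ρ.scale)} ∧
  1 / ρ'.scale = 1 / ρ.scale + 1

/-- The sequence `ρ 1, ρ 2, …` is a run of the fully online rounding algorithm on the stream
`z 0, z 1, …`; here `ρ t` is the rounding after the first `t` points `z 0, …, z (t - 1)`. -/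
def IsFullyOnlineRun (z : ℕ → EuclideanSpace ℝ (Fin d)) (ρ : ℕ → Rounding d) : Prop :=
  ((ρ 1).center = z 0 ∧ (ρ 1).ellipsoid = {0} ∧ (ρ 1).scale = 1) ∧
  ∀ t, 1 ≤ t →
    (z t ∉ affineSpan ℝ (z '' Set.Iio t) → IsIrregularUpdate (ρ t) (z t) (ρ (t + 1))) ∧
    (z t ∈ affineSpan ℝ (z '' Set.Iio t) → IsMonotoneUpdate (ρ t) (z t) (ρ (t + 1)))

end Rounding

/-! ## Quantities of the stream -/

section Stream

variable {d : ℕ}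

/-- The inradius of `K`, relative to its affine span. -/
noncomputable def inradius (K : Set (EuclideanSpace ℝ (Fin d))) : ℝ :=
  sSup {r | 0 ≤ r ∧ ∃ c : EuclideanSpace ℝ (Fin d),
    ∀ v ∈ Submodule.span ℝ ((fun x => x - c) '' K), ‖v‖ ≤ r → c + v ∈ K}

/-- The circumradius of `K`. -/
noncomputable def circumradius (K : Set (EuclideanSpace ℝ (Fin d))) : ℝ :=
  sInf {R | 0 ≤ R ∧ ∃ c : EuclideanSpace ℝ (Fin d), K ⊆ Metric.closedBall c R}

/-- The convex hull of the first `t` points. -/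
def hull (z : ℕ → EuclideanSpace ℝ (Fin d)) (t : ℕ) : Set (EuclideanSpace ℝ (Fin d)) :=
  convexHull ℝ (z '' Set.Iio t)

/-- The dimension of the affine span of the first `t` points. -/
noncomputable def affDim (z : ℕ → EuclideanSpace ℝ (Fin d)) (t : ℕ) : ℕ :=
  Module.finrank ℝ (affineSpan ℝ (z '' Set.Iio t)).direction

/-- The maximum of `R_t / r_s` over `s ≤ t`.  As long as the first `s` points coincide, their hull
is a single point, contains relative balls of every radius (`r_s = ∞`) and contributes nothing. -/
noncomputable def aspect (z : ℕ → EuclideanSpace ℝ (Fin d)) (t : ℕ) : ℝ :=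
  ⨆ s : {s : ℕ // s ≤ t ∧ 1 ≤ affDim z s}, circumradius (hull z t) / inradius (hull z s)

end Stream

end StreamRounding

namespace StreamRounding

/-! ## The planar inequalities behind the monotone update -/

/-! The regular update is a planar problem. In coordinates where the outer ellipsoid is the unit
ball, the inner one is the ball of radius `α` and the new point is `D • e` with `‖e‖ = 1`. If `D ≤
1`, nothing changes. Otherwise the new outer ellipsoid has center `c • e`, semi-axis `a` along `e`
and `b` across it. With `A = 1 / α`, the factor is raised by `growth D`, and `a`, `b`, `c` follow
from three tangencies: the outer ellipsoid touches the new point, the new inner one shares its rear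
pole with the old inner ball, and it touches the tangent lines from the new point to that ball. What
remains is polynomial (`update_admissible`): `unit_ball_inequality` gives the outer inclusion. For
the inner one, support functions are compared in `support_inequality`, and separation
(`stretch_mem_convexHull`) turns this into membership in the hull. An irregular update satisfies the
same two inclusions, so the sandwich around the hull propagates through both kinds of update
(`runInvariant`).

The factor is controlled by volume. A regular update multiplies the relative volume by at least `a ≥
(D + 1) / 2`, and `growth D` is at most `2 * log a`, so the increase of `1 / α` is paid for by the
logarithm of the squared volume. The volume is measured by the determinant of `gram`, where each
dimension not yet reached counts as an axis of length `σ`. An irregular update adds one to `1 / α`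
and replaces one such axis. The new point has distance at least `2 * r` from the old span, where `r`
is the new relative inradius, because the hull lies in a strip whose width is this distance. Hence
the determinant loses at most a factor `(r / σ) ^ 2`, and this happens once per dimension
(`inv_scale_le_potential`).

At the end the inner inclusion bounds the axes by `R / α`, with `R` the circumradius. Taking `σ = R
/ α` and `r = R / κ` gives `1 / α ≤ 1 + k + 2 k log (κ / α)` in dimension `k` (`inv_scale_le`). The
factor occurs on both sides, and `log t ≤ t - 1` absorbs it (`bound_of_self_bound`).

For the running time, the matrix `Q` is kept together with its Moore-Penrose inverse `W`. The
coordinates of a point are `W *ᵥ v`, its distance from the span is read off from `v - Q *ᵥ (W *ᵥ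
v)`, and both updates change `Q` and `W` by a scaling and a rank-one term. Each point therefore
costs `O(d ^ 2)` operations, which is verified for an explicit program by an invariant on the
contents of the memory (`Represents`). -/

/-- The increment of `1 / α` in a monotone update. -/
noncomputable def growth (D : ℝ) : ℝ := 2 * (D - 1) / (D + 1)

/-- The quantities of a monotone update with `A = 1 / α` and `A' = 1 / α'`. -/
noncomputable def axisLong (A A' x : ℝ) : ℝ := A' * (x + 1) / (A * (A' + 1))

/-- The square of the transversal semi-axis. The value makes the new inner ellipse tangent to the
tangent lines from the new point to the old inner disk. -/
noncomputable def axisShortSq (A A' x : ℝ) : ℝ :=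
  A' ^ 2 * (A' - 1) * (x + 1) / (A ^ 2 * (A' + 1) * (x - 1))

/-- For `x = A * D`, this and `axisLong` solve the system `c + a = D`, `c = a / A' - 1 / A`: the
outer ellipse reaches the new point, and the two inner ones share the rear pole. -/
noncomputable def centerShift (A A' x : ℝ) : ℝ := (x - A') / (A * (A' + 1))

/-- The discriminant condition for the unit ball to lie in the new ellipsoid, stripped of common
positive factors; `δ = A * (D - 1)` turns the increment of `A` into `growth D`. After the
substitution `A = 1 + e`, the difference of the two sides is a polynomial with nonnegative
coefficients over a positive denominator. -/
lemma update_poly_ineq {A δ : ℝ} (hA : 1 ≤ A) (hδ : 0 < δ) :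
    let A' := A + 2 * δ / (2 * A + δ)
    let x := A + δ
    (x - A') * (A' - 1) * (x - 1) ≤
      (x + A') * (A' ^ 2 * (A' - 1) * (x + 1) - A ^ 2 * (A' + 1) * (x - 1)) := by
  obtain ⟨e, rfl⟩ : ∃ e, A = 1 + e := ⟨A - 1, by ring⟩
  have he : 0 ≤ e := by linarith
  intro A' x
  have hs : 0 < 2 * (1 + e) + δ := by positivity
  have key : (x + A') * (A' ^ 2 * (A' - 1) * (x + 1) - (1 + e) ^ 2 * (A' + 1) * (x - 1))
      - (x - A') * (A' - 1) * (x - 1) =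
      (96 * δ ^ 2 + 304 * δ ^ 3 + 312 * δ ^ 4 + 116 * δ ^ 5 + 12 * δ ^ 6 + 64 * e * δ
        + 672 * e * δ ^ 2 + 1280 * e * δ ^ 3 + 820 * e * δ ^ 4 + 184 * e * δ ^ 5 + 11 * e * δ ^ 6
        + 320 * e ^ 2 * δ + 1656 * e ^ 2 * δ ^ 2 + 1988 * e ^ 2 * δ ^ 3 + 794 * e ^ 2 * δ ^ 4
        + 99 * e ^ 2 * δ ^ 5 + 2 * e ^ 2 * δ ^ 6 + 624 * e ^ 3 * δ + 1920 * e ^ 3 * δ ^ 2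
        + 1436 * e ^ 3 * δ ^ 3 + 328 * e ^ 3 * δ ^ 4 + 16 * e ^ 3 * δ ^ 5 + 592 * e ^ 4 * δ
        + 1112 * e ^ 4 * δ ^ 2 + 488 * e ^ 4 * δ ^ 3 + 48 * e ^ 4 * δ ^ 4 + 272 * e ^ 5 * δ
        + 304 * e ^ 5 * δ ^ 2 + 64 * e ^ 5 * δ ^ 3 + 48 * e ^ 6 * δ + 32 * e ^ 6 * δ ^ 2) /
        (2 * (1 + e) + δ) ^ 4 := by
    simp only [A', x]
    field_simp
    ring
  refine sub_nonneg.1 (key.symm ▸ ?_)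
  positivity

lemma update_scalars {A D : ℝ} (hA : 1 ≤ A) (hD : 1 < D) :
    let A' := A + growth D
    let x := A * D
    A < A' ∧ A' < x ∧ 1 < x ∧ A' ≤ A + 2 := by
  intro A' x
  have h1 : 0 < growth D := by unfold growth; apply div_pos <;> linarith
  have h2 : growth D < D - 1 := by
    unfold growth; rw [div_lt_iff₀ (by linarith)]; nlinarith
  have h3 : growth D ≤ 2 := by
    unfold growth; rw [div_le_iff₀ (by linarith)]; nlinarith
  refine ⟨by simp [A', h1], ?_, ?_, by simp [A', h3]⟩
  · simp only [A', x]; nlinarith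
  · simp only [x]; nlinarith

/-- The three inequalities which say that the monotone update is admissible. -/
lemma update_admissible {A D : ℝ} (hA : 1 ≤ A) (hD : 1 < D) :
    let A' := A + growth D
    let x := A * D
    let a := axisLong A A' x
    let B := axisShortSq A A' x
    let c := centerShift A A' x
    0 < c ∧ c + a = D ∧ c = (1 / A') * a - 1 / A ∧ 1 + (D - 1) / 2 ≤ a ∧ 1 < B ∧ B < a ^ 2 ∧
    c ^ 2 * B ≤ (B - 1) * (a ^ 2 - B) ∧
    c ^ 2 ≤ (1 / A') ^ 2 * (a ^ 2 - B) ∧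
    (1 / A') ^ 2 * (B * D ^ 2 + (a ^ 2 - B) * (1 / A) ^ 2) ≤ (1 / A) ^ 2 * a ^ 2 := by
  intro A' x a B c
  obtain ⟨h1, h2, h3, h4⟩ := update_scalars hA hD
  have hpoly := update_poly_ineq hA (δ := A * (D - 1)) (by nlinarith)
  have e1 : A + 2 * (A * (D - 1)) / (2 * A + A * (D - 1)) = A' := by
    simp only [A', growth]
    have : D + 1 ≠ 0 := by linarith
    have h : 2 * A + A * (D - 1) = A * (D + 1) := by ring
    rw [h]; field_simp
  have e2 : A + A * (D - 1) = x := by simp only [x]; ring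
  rw [e1, e2] at hpoly
  change A < A' at h1
  change A' < x at h2
  change 1 < x at h3
  have hA0 : 0 < A := by linarith
  have hD' : D = x / A := by simp only [x]; field_simp
  have hc : c = (x - A') / (A * (A' + 1)) := rfl
  have ha : a = A' * (x + 1) / (A * (A' + 1)) := rfl
  have hB : B = A' ^ 2 * (A' - 1) * (x + 1) / (A ^ 2 * (A' + 1) * (x - 1)) := rfl
  have g2 : 0 < A' := by linarith
  clear_value c a B
  have hgl : 1 + (D - 1) / 2 ≤ a := by
    rw [ha, le_div_iff₀ (by positivity), hD']
    have : (1 + (x / A - 1) / 2) * (A * (A' + 1)) = (x + A) * (A' + 1) / 2 := by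
      field_simp; ring
    rw [this]; nlinarith
  -- The remaining claims are about free variables with `A < A' < x` and `1 < x`; the particular
  -- increment `growth D` matters only through `hpoly`.
  clear_value A' x
  subst hD'
  have g1 : 0 < x - 1 := by linarith
  have g3 : 0 < A' - 1 := by linarith
  have g4 : 0 < x - A' := by linarith
  have g5 : 0 < x := by linarith
  have hΔ : a ^ 2 - B = A' ^ 2 * (x + 1) * (x - A') * (x + A') /
      (A ^ 2 * (A' + 1) ^ 2 * (x - 1)) := by
    rw [ha, hB]; field_simp; ring
  have hΔ0 : 0 < a ^ 2 - B := by rw [hΔ]; positivity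
  have hB1 : B - 1 = (A' ^ 2 * (A' - 1) * (x + 1) - A ^ 2 * (A' + 1) * (x - 1)) /
      (A ^ 2 * (A' + 1) * (x - 1)) := by
    rw [hB]; field_simp
  -- The left side of `hpoly` is positive, so the bracket on its right side must be positive; this
  -- is `1 < B`.
  have hbr : 0 < A' ^ 2 * (A' - 1) * (x + 1) - A ^ 2 * (A' + 1) * (x - 1) := by
    have : 0 < (x - A') * (A' - 1) * (x - 1) := by positivity
    by_contra hcon
    have : (x + A') * (A' ^ 2 * (A' - 1) * (x + 1) - A ^ 2 * (A' + 1) * (x - 1)) ≤ 0 :=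
      mul_nonpos_of_nonneg_of_nonpos (by linarith) (by linarith)
    linarith
  have hB10 : 0 < B - 1 := by rw [hB1]; positivity
  refine ⟨by rw [hc]; positivity, ?_, ?_, hgl, by linarith, by linarith, ?_, ?_, ?_⟩
  · rw [hc, ha]; field_simp; ring
  · rw [hc, ha]; field_simp; ring
  · rw [hΔ, hB1, hc, hB]
    have l1 : ((x - A') / (A * (A' + 1))) ^ 2 *
        (A' ^ 2 * (A' - 1) * (x + 1) / (A ^ 2 * (A' + 1) * (x - 1))) =
        (A' ^ 2 * (x + 1) * (x - A') / (A ^ 4 * (A' + 1) ^ 3 * (x - 1) ^ 2)) *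
          ((x - A') * (A' - 1) * (x - 1)) := by
      field_simp
    have l2 : (A' ^ 2 * (A' - 1) * (x + 1) - A ^ 2 * (A' + 1) * (x - 1)) /
        (A ^ 2 * (A' + 1) * (x - 1)) *
        (A' ^ 2 * (x + 1) * (x - A') * (x + A') / (A ^ 2 * (A' + 1) ^ 2 * (x - 1))) =
        (A' ^ 2 * (x + 1) * (x - A') / (A ^ 4 * (A' + 1) ^ 3 * (x - 1) ^ 2)) *
        ((x + A') * (A' ^ 2 * (A' - 1) * (x + 1) - A ^ 2 * (A' + 1) * (x - 1))) := by
      field_simp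
    rw [l1, l2]
    exact mul_le_mul_of_nonneg_left hpoly (by positivity)
  · rw [hΔ, hc]
    have l1 : ((x - A') / (A * (A' + 1))) ^ 2 =
      ((x - A') / (A ^ 2 * (A' + 1) ^ 2 * (x - 1))) * ((x - A') * (x - 1)) := by
      field_simp
    have l2 : (1 / A') ^ 2 * (A' ^ 2 * (x + 1) * (x - A') * (x + A') /
      (A ^ 2 * (A' + 1) ^ 2 * (x - 1))) =
      ((x - A') / (A ^ 2 * (A' + 1) ^ 2 * (x - 1))) * ((x + A') * (x + 1)) := by
      field_simp
    rw [l1, l2]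
    apply mul_le_mul_of_nonneg_left _ (by positivity)
    nlinarith
  -- Equality holds because `axisShortSq` was chosen by tangency.
  · apply le_of_eq
    rw [hΔ, hB, ha]; field_simp; ring

/-- A point of the unit ball with component `s` along the axis has squared transversal part at most
`1 - s ^ 2`. Completing the square in `s` leaves exactly the slack in `h`. -/
lemma unit_ball_inequality {a B c s : ℝ} (hB : 1 < B) (hBa : B < a ^ 2)
    (h : c ^ 2 * B ≤ (B - 1) * (a ^ 2 - B)) :
    (s - c) ^ 2 / a ^ 2 + (1 - s ^ 2) / B ≤ 1 := by
  have ha : 0 < a ^ 2 := by linarith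
  have hΔ : 0 < a ^ 2 - B := by linarith
  rw [div_add_div _ _ ha.ne' (by linarith), div_le_one (by positivity)]
  have key : (a ^ 2 - B) * (a ^ 2 * B - ((s - c) ^ 2 * B + a ^ 2 * (1 - s ^ 2))) =
    ((a ^ 2 - B) * s + B * c) ^ 2 + a ^ 2 * ((B - 1) * (a ^ 2 - B) - c ^ 2 * B) := by ring
  have : 0 ≤ (a ^ 2 - B) * (a ^ 2 * B - ((s - c) ^ 2 * B + a ^ 2 * (1 - s ^ 2))) := by
    rw [key]
    have := mul_nonneg ha.le (sub_nonneg.2 h)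
    positivity
  have := nonneg_of_mul_nonneg_right this hΔ
  linarith

/-- The support function of the new inner ellipse is at most that of the old inner disk together
with the new point. -/
lemma support_inequality {a B c α α' D G p : ℝ} (ha : 0 < a) (hB : 0 < B) (hα : 0 < α)
    (hα' : 0 < α') (hD : 0 < D) (hc : 0 ≤ c)
    (hcD : c + a = D) (hcα : c = α' * a - α)
    (h2 : c ^ 2 ≤ α' ^ 2 * (a ^ 2 - B))
    (h3 : α' ^ 2 * (B * D ^ 2 + (a ^ 2 - B) * α ^ 2) ≤ α ^ 2 * a ^ 2)
    (hG : 0 ≤ G) (hp : |p| ≤ G) :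
    c * p + α' * Real.sqrt (B * (G ^ 2 - p ^ 2) + a ^ 2 * p ^ 2) ≤ max (α * G) (D * p) := by
  obtain ⟨hp1, hp2⟩ := abs_le.1 hp
  have hsq : ∀ y : ℝ, 0 ≤ y → α' ^ 2 * (B * (G ^ 2 - p ^ 2) + a ^ 2 * p ^ 2) ≤ y ^ 2 →
      α' * Real.sqrt (B * (G ^ 2 - p ^ 2) + a ^ 2 * p ^ 2) ≤ y := by
    intro y hy h
    have : α' * Real.sqrt (B * (G ^ 2 - p ^ 2) + a ^ 2 * p ^ 2) =
        Real.sqrt (α' ^ 2 * (B * (G ^ 2 - p ^ 2) + a ^ 2 * p ^ 2)) := by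
      rw [Real.sqrt_mul (by positivity), Real.sqrt_sq hα'.le]
    rw [this]
    exact Real.sqrt_le_iff.2 ⟨hy, h⟩
  rcases le_total (D * p) (α * G) with hle | hle
  · apply le_max_of_le_left
    have hnn : 0 ≤ α * G - c * p := by
      rcases le_total p 0 with h | h
      · have := mul_nonpos_of_nonneg_of_nonpos hc h
        have := mul_nonneg hα.le hG
        linarith
      · have : c * p ≤ D * p := mul_le_mul_of_nonneg_right (by linarith) h
        linarith
    have := hsq (α * G - c * p) hnn ?_
    · linarith
    set m := c ^ 2 - α' ^ 2 * (a ^ 2 - B) with hm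
    set n := (α ^ 2 - α' ^ 2 * B) * G with hn
    -- The common rear pole makes `p = -G` a root of this quadratic, so the factor `p + G` splits
    -- off.
    have hfac : (α * G - c * p) ^ 2 - α' ^ 2 * (B * (G ^ 2 - p ^ 2) + a ^ 2 * p ^ 2) =
        (p + G) * (m * p + n) := by
      have : α' * a = c + α := by linarith
      have h' : m = c ^ 2 - (c + α) ^ 2 + α' ^ 2 * B := by rw [← this, hm]; ring
      have h'' : α' ^ 2 * (B * (G ^ 2 - p ^ 2) + a ^ 2 * p ^ 2) =
        α' ^ 2 * B * (G ^ 2 - p ^ 2) + (c + α) ^ 2 * p ^ 2 := by rw [← this]; ring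
      rw [h', h'', hn]; ring
    have hlin : 0 ≤ m * p + n := by
      have hmle : m ≤ 0 := by linarith
      -- Since `m ≤ 0`, the linear factor is smallest at the end `p = α * G / D` of the range. There
      -- the normal is that of the tangent line from the new point, and the claim is `h3`.
      have h0 : 0 ≤ m * (α * G) + n * D := by
        have h4 : (α + D) * (m * α + (α ^ 2 - α' ^ 2 * B) * D) =
            (α * D - c * α) ^ 2 - α' ^ 2 * (B * (D ^ 2 - α ^ 2) + a ^ 2 * α ^ 2) := by
          have : α' * a = c + α := by linarith
          have h' : m = c ^ 2 - (c + α) ^ 2 + α' ^ 2 * B := by rw [← this, hm]; ring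
          have h'' : α' ^ 2 * (B * (D ^ 2 - α ^ 2) + a ^ 2 * α ^ 2) =
            α' ^ 2 * B * (D ^ 2 - α ^ 2) + (c + α) ^ 2 * α ^ 2 := by rw [← this]; ring
          rw [h', h'']; ring
        have h5 : 0 ≤ (α + D) * (m * α + (α ^ 2 - α' ^ 2 * B) * D) := by
          rw [h4]
          have : α * D - c * α = α * a := by rw [← hcD]; ring
          rw [this]; nlinarith
        have h6 := nonneg_of_mul_nonneg_right h5 (by linarith)
        have := mul_nonneg h6 hG
        rw [hn]; linarith
      have : 0 ≤ D * (m * p + n) := by nlinarith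
      exact nonneg_of_mul_nonneg_right this hD
    have := mul_nonneg (by linarith : 0 ≤ p + G) hlin
    linarith
  · apply le_max_of_le_right
    have hp0 : 0 ≤ p := by
      by_contra hcon
      have := mul_nonneg hα.le hG
      nlinarith
    have := hsq (a * p) (by positivity) ?_
    · rw [← hcD]; linarith
    -- The new point now dominates, and the claim reduces to `α' * √(…) ≤ a * p`. The worst case is
    -- again `α * G = D * p`, covered by `h3`.
    have hG2 : α ^ 2 * G ^ 2 ≤ D ^ 2 * p ^ 2 := by
      have := pow_le_pow_left₀ (mul_nonneg hα.le hG) hle 2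
      nlinarith
    have h5 : α ^ 2 * (α' ^ 2 * (B * (G ^ 2 - p ^ 2) + a ^ 2 * p ^ 2)) ≤ α ^ 2 * (a * p) ^ 2 := by
      have e1 : α ^ 2 * (α' ^ 2 * (B * (G ^ 2 - p ^ 2) + a ^ 2 * p ^ 2)) =
        α' ^ 2 * B * (α ^ 2 * G ^ 2) + α' ^ 2 * (a ^ 2 - B) * α ^ 2 * p ^ 2 := by ring
      have e2 := mul_le_mul_of_nonneg_left hG2 (by positivity : 0 ≤ α' ^ 2 * B)
      have e3 := mul_le_mul_of_nonneg_right h3 (sq_nonneg p)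
      rw [e1]; nlinarith
    exact le_of_mul_le_mul_left h5 (by positivity)

/-! ## Monotone updates in the coordinates of the current ellipsoid -/

section Stretch

variable {E : Type*} [NormedAddCommGroup E] [InnerProductSpace ℝ E]

open scoped RealInnerProductSpace

/-- The symmetric map with eigenvalue `a` in the direction of the unit vector `e` and eigenvalue
`b` on its orthogonal complement. -/
noncomputable def stretch (e : E) (a b : ℝ) (x : E) : E := b • x + ((a - b) * ⟪e, x⟫) • e

lemma inner_stretch_left (e : E) (a b : ℝ) (x y : E) :
    ⟪x, stretch e a b y⟫ = ⟪stretch e a b x, y⟫ := by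
  simp only [stretch, inner_add_left, inner_add_right, inner_smul_left, inner_smul_right,
    RCLike.conj_to_real, real_inner_comm e x]
  ring

lemma norm_stretch_sq {e : E} (he : ‖e‖ = 1) (a b : ℝ) (x : E) :
    ‖stretch e a b x‖ ^ 2 = b ^ 2 * (‖x‖ ^ 2 - ⟪e, x⟫ ^ 2) + a ^ 2 * ⟪e, x⟫ ^ 2 := by
  have hee : ⟪e, e⟫ = 1 := by rw [real_inner_self_eq_norm_sq, he]; norm_num
  rw [← real_inner_self_eq_norm_sq, ← real_inner_self_eq_norm_sq]
  simp only [stretch, inner_add_left, inner_add_right, inner_smul_left, inner_smul_right,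
    RCLike.conj_to_real, real_inner_comm e x, hee]
  ring

lemma stretch_stretch_inv {e : E} (he : ‖e‖ = 1) {a b : ℝ} (ha : a ≠ 0) (hb : b ≠ 0) (x : E) :
    stretch e a b (stretch e a⁻¹ b⁻¹ x) = x := by
  have hee : ⟪e, e⟫ = 1 := by rw [real_inner_self_eq_norm_sq, he]; norm_num
  simp only [stretch, inner_add_right, inner_smul_right, hee, smul_add, smul_smul, add_assoc,
    ← add_smul]
  rw [mul_inv_cancel₀ hb, one_smul]
  convert add_zero x
  convert zero_smul ℝ e
  field_simp
  ring

lemma stretch_self {e : E} (he : ‖e‖ = 1) (a b : ℝ) : stretch e a b e = a • e := by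
  have hee : ⟪e, e⟫ = 1 := by rw [real_inner_self_eq_norm_sq, he]; norm_num
  simp only [stretch, hee, ← add_smul]
  congr 1; ring

lemma abs_inner_unit_le {e : E} (he : ‖e‖ = 1) (x : E) : |⟪e, x⟫| ≤ ‖x‖ := by
  simpa [he] using abs_real_inner_le_norm e x

/-- The preimage under the inverse stretch has norm at most `1` by `unit_ball_inequality`, because
subtracting `c • e` only alters the component along `e`. -/
lemma exists_stretch_of_mem_unitBall {e : E} (he : ‖e‖ = 1) {a b c : ℝ} (hb : 1 < b)
    (hba : b ^ 2 < a ^ 2) (ha : 0 < a) (h : c ^ 2 * b ^ 2 ≤ (b ^ 2 - 1) * (a ^ 2 - b ^ 2)) {x : E}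
    (hx : ‖x‖ ≤ 1) : ∃ y : E, ‖y‖ ≤ 1 ∧ x = c • e + stretch e a b y := by
  have hee : ⟪e, e⟫ = 1 := by rw [real_inner_self_eq_norm_sq, he]; norm_num
  refine ⟨stretch e a⁻¹ b⁻¹ (x - c • e), ?_, ?_⟩
  · rw [← sq_le_one_iff₀ (norm_nonneg _), norm_stretch_sq he]
    have h1 : ⟪e, x - c • e⟫ = ⟪e, x⟫ - c := by
      rw [inner_sub_right, inner_smul_right, hee, mul_one]
    have h2 : ‖x - c • e‖ ^ 2 - (⟪e, x⟫ - c) ^ 2 = ‖x‖ ^ 2 - ⟪e, x⟫ ^ 2 := by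
      rw [norm_sub_sq_real, inner_smul_right, norm_smul, he, real_inner_comm, mul_one,
        Real.norm_eq_abs, sq_abs]
      ring
    rw [h1, h2]
    have h3 := unit_ball_inequality (s := ⟪e, x⟫) (by nlinarith) hba h
    have h4 : ‖x‖ ^ 2 ≤ 1 := (sq_le_one_iff₀ (norm_nonneg _)).2 hx
    have h5 : b⁻¹ ^ 2 * (‖x‖ ^ 2 - ⟪e, x⟫ ^ 2) ≤ (1 - ⟪e, x⟫ ^ 2) / b ^ 2 := by
      rw [inv_pow, div_eq_inv_mul]
      gcongr
    have h6 : a⁻¹ ^ 2 * (⟪e, x⟫ - c) ^ 2 = (⟪e, x⟫ - c) ^ 2 / a ^ 2 := by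
      rw [inv_pow, div_eq_inv_mul]
    linarith
  · rw [stretch_stretch_inv he ha.ne' (by linarith)]
    abel

/-- The hull is the union of the segments from `s` to `p`, hence a continuous image of the compact
set `[0, 1] × s`. Closedness is what strict separation needs. -/
lemma isClosed_convexHull_union_singleton [FiniteDimensional ℝ E] {s : Set E} (hs : IsCompact s)
    (hc : Convex ℝ s) (hne : s.Nonempty) (p : E) : IsClosed (convexHull ℝ (s ∪ {p})) := by
  rw [hc.convexHull_union (convex_singleton p) hne (Set.singleton_nonempty p),
    convexJoin_singleton_right]
  have : (⋃ x ∈ s, segment ℝ x p) =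
      (fun q : ℝ × E => (1 - q.1) • q.2 + q.1 • p) '' (Set.Icc (0 : ℝ) 1 ×ˢ s) := by
    ext y
    simp only [Set.mem_iUnion, segment_eq_image, Set.mem_image, Set.mem_prod, Prod.exists]
    constructor
    · rintro ⟨x, hx, θ, hθ, rfl⟩
      exact ⟨θ, x, ⟨hθ, hx⟩, rfl⟩
    · rintro ⟨θ, x, ⟨hθ, hx⟩, rfl⟩
      exact ⟨x, hx, θ, hθ, rfl⟩
  rw [this]
  refine ((isCompact_Icc.prod hs).image ?_).isClosed
  fun_prop

/-- Otherwise a functional `⟪g, ·⟫` separates the point strictly from the hull. It is then larger at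
the point than `α * ‖g‖` and `D * ⟪g, e⟫`, which contradicts `support_inequality` with `G = ‖g‖` and
`p = ⟪e, g⟫`. -/
lemma stretch_mem_convexHull [FiniteDimensional ℝ E] {e : E} (he : ‖e‖ = 1) {a b c α α' D : ℝ}
    (ha : 0 < a) (hb : 0 < b) (hα : 0 < α) (hα' : 0 < α') (hD : 0 < D) (hc : 0 ≤ c)
    (hcD : c + a = D) (hcα : c = α' * a - α)
    (h2 : c ^ 2 ≤ α' ^ 2 * (a ^ 2 - b ^ 2))
    (h3 : α' ^ 2 * (b ^ 2 * D ^ 2 + (a ^ 2 - b ^ 2) * α ^ 2) ≤ α ^ 2 * a ^ 2)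
    {y : E} (hy : ‖y‖ ≤ 1) :
    c • e + α' • stretch e a b y ∈
      convexHull ℝ ((fun x => α • x) '' Metric.closedBall (0 : E) 1 ∪ {D • e}) := by
  by_contra hcon
  have hcl : IsClosed (convexHull ℝ ((fun x => α • x) '' Metric.closedBall (0 : E) 1 ∪ {D • e})) :=
    isClosed_convexHull_union_singleton
      ((isCompact_closedBall (0 : E) 1).image (continuous_const_smul α))
      ((convex_closedBall (0 : E) 1).smul α) ⟨α • 0, 0, by simp, rfl⟩ _
  obtain ⟨f, u, hf, hu⟩ := geometric_hahn_banach_closed_point (convex_convexHull ℝ _) hcl hcon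
  obtain ⟨g, rfl⟩ := (InnerProductSpace.toDual ℝ E).surjective f
  simp only [InnerProductSpace.toDual_apply_apply] at hf hu
  have hp : ⟪g, D • e⟫ < u := hf _ (subset_convexHull ℝ _ (Or.inr rfl))
  have hG : α * ‖g‖ < u := by
    rcases eq_or_ne g 0 with rfl | hg
    · have := hf (α • 0) (subset_convexHull ℝ _ (Or.inl ⟨0, by simp, rfl⟩))
      simpa using this
    · have hg' : ‖g‖ ≠ 0 := norm_ne_zero_iff.2 hg
      have := hf (α • (‖g‖⁻¹ • g))
        (subset_convexHull ℝ _ (Or.inl ⟨‖g‖⁻¹ • g, by simp [norm_smul, hg'], rfl⟩))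
      rw [inner_smul_right, inner_smul_right, real_inner_self_eq_norm_sq] at this
      convert this using 2
      field_simp
  rw [inner_smul_right] at hp
  have hmax := support_inequality ha (by positivity : 0 < b ^ 2) hα hα' hD hc hcD hcα h2 h3
    (norm_nonneg g) (abs_inner_unit_le he g)
  rw [inner_add_right, inner_smul_right, inner_smul_right, inner_stretch_left] at hu
  have h4 : ⟪stretch e a b g, y⟫ ≤
      Real.sqrt (b ^ 2 * (‖g‖ ^ 2 - ⟪e, g⟫ ^ 2) + a ^ 2 * ⟪e, g⟫ ^ 2) := by
    rw [← norm_stretch_sq he, Real.sqrt_sq (norm_nonneg _)]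
    calc ⟪stretch e a b g, y⟫ ≤ ‖stretch e a b g‖ * ‖y‖ := real_inner_le_norm _ _
      _ ≤ ‖stretch e a b g‖ * 1 := by gcongr
      _ = _ := mul_one _
  have h5 := mul_le_mul_of_nonneg_left h4 hα'.le
  rw [real_inner_comm] at hp
  rw [real_inner_comm g e] at hmax h5
  rw [real_inner_comm] at hu
  have h6 := max_lt hG hp
  simp only [real_inner_comm] at *
  linarith

end Stretch

/-! ## The data maintained by the algorithm -/

section PseudoInverse

open Matrix

variable {d : ℕ}

/-- The projection on the first `k` coordinates. -/
def coordProj (d k : ℕ) : Matrix (Fin d) (Fin d) ℝ :=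
  diagonal fun i => if (i : ℕ) < k then 1 else 0

/-- The basis vector with index `k`. -/
def basisVec (d k : ℕ) : Fin d → ℝ := fun i => if (i : ℕ) = k then 1 else 0

/-- `W` is the Moore-Penrose inverse of `Q`, a matrix whose first `k` columns are linearly
independent and whose other columns vanish. -/
structure IsPseudoInverse (Q W : Matrix (Fin d) (Fin d) ℝ) (k : ℕ) : Prop where
  mul_eq : W * Q = coordProj d k
  mul_proj : Q * coordProj d k = Q
  proj_mul : coordProj d k * W = W
  symm : (Q * W)ᵀ = Q * W

lemma coordProj_mulVec (k : ℕ) (x : Fin d → ℝ) (i : Fin d) :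
    (coordProj d k *ᵥ x) i = if (i : ℕ) < k then x i else 0 := by
  rw [coordProj, mulVec_diagonal]; split_ifs <;> simp

lemma basisVec_dotProduct {k : ℕ} (hk : k < d) (x : Fin d → ℝ) :
    basisVec d k ⬝ᵥ x = x ⟨k, hk⟩ := by
  rw [dotProduct, Finset.sum_eq_single ⟨k, hk⟩]
  · simp [basisVec]
  · intro b _ hb
    have : (b : ℕ) ≠ k := fun h => hb (Fin.ext h)
    simp [basisVec, this]
  · simp

lemma coordProj_succ {k : ℕ} :
    coordProj d (k + 1) = coordProj d k + vecMulVec (basisVec d k) (basisVec d k) := by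
  ext i j
  simp only [coordProj, diagonal_apply, Matrix.add_apply, vecMulVec_apply, basisVec, Fin.ext_iff]
  split_ifs <;> first | omega | simp

lemma coordProj_mul_of_le {k l : ℕ} (h : k ≤ l) :
    coordProj d l * coordProj d k = coordProj d k ∧
      coordProj d k * coordProj d l = coordProj d k := by
  constructor <;>
  · rw [coordProj, coordProj, diagonal_mul_diagonal]
    congr 1; ext i
    split_ifs <;> first | omega | simp

lemma coordProj_mulVec_basisVec (k : ℕ) : coordProj d k *ᵥ basisVec d k = 0 := by
  ext i
  rw [coordProj_mulVec]
  simp only [basisVec, Pi.zero_apply]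
  split_ifs <;> first | omega | rfl

lemma basisVec_vecMul_coordProj (k : ℕ) : basisVec d k ᵥ* coordProj d k = 0 := by
  ext i
  rw [coordProj, vecMul_diagonal]
  simp only [basisVec, Pi.zero_apply]
  split_ifs <;> first | omega | simp

lemma coordProj_succ_mulVec_basisVec (k : ℕ) :
    coordProj d (k + 1) *ᵥ basisVec d k = basisVec d k := by
  ext i
  rw [coordProj_mulVec]
  simp only [basisVec]
  split_ifs <;> first | omega | rfl

lemma basisVec_vecMul_coordProj_succ (k : ℕ) :
    basisVec d k ᵥ* coordProj d (k + 1) = basisVec d k := by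
  ext i
  rw [coordProj, vecMul_diagonal]
  simp only [basisVec]
  split_ifs <;> first | omega | simp

lemma vecMul_coordProj (k : ℕ) (x : Fin d → ℝ) : x ᵥ* coordProj d k = coordProj d k *ᵥ x := by
  ext i
  rw [coordProj, vecMul_diagonal, mulVec_diagonal, mul_comm]

namespace IsPseudoInverse

variable {Q W : Matrix (Fin d) (Fin d) ℝ} {k : ℕ}

lemma zero : IsPseudoInverse (0 : Matrix (Fin d) (Fin d) ℝ) 0 0 := by
  constructor <;> simp [coordProj]

lemma mulVec_basisVec (h : IsPseudoInverse Q W k) : Q *ᵥ basisVec d k = 0 := by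
  rw [← h.mul_proj, ← mulVec_mulVec, coordProj_mulVec_basisVec, mulVec_zero]

lemma basisVec_vecMul (h : IsPseudoInverse Q W k) : basisVec d k ᵥ* W = 0 := by
  rw [← h.proj_mul, ← vecMul_vecMul, basisVec_vecMul_coordProj, zero_vecMul]

lemma mul_mul (h : IsPseudoInverse Q W k) : Q * W * Q = Q := by
  rw [Matrix.mul_assoc, h.mul_eq, h.mul_proj]

lemma proj_coord (h : IsPseudoInverse Q W k) (v : Fin d → ℝ) :
    coordProj d k *ᵥ (W *ᵥ v) = W *ᵥ v := by
  rw [mulVec_mulVec, h.proj_mul]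

lemma coord_mulVec (h : IsPseudoInverse Q W k) (x : Fin d → ℝ) :
    W *ᵥ (Q *ᵥ x) = coordProj d k *ᵥ x := by
  rw [mulVec_mulVec, h.mul_eq]

/-- `Q * W` is symmetric and fixes `Q`, so it is the orthogonal projection on the column space; the
residual is orthogonal to every column. -/
lemma residual_vecMul (h : IsPseudoInverse Q W k) (v : Fin d → ℝ) :
    (v - Q *ᵥ (W *ᵥ v)) ᵥ* Q = 0 := by
  have h1 : Q *ᵥ (W *ᵥ v) = v ᵥ* (Q * W) := by
    rw [mulVec_mulVec, ← h.symm, mulVec_transpose, h.symm]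
  rw [h1, sub_vecMul, vecMul_vecMul, h.mul_mul, sub_self]

lemma residual_dotProduct_mulVec (h : IsPseudoInverse Q W k) (v x : Fin d → ℝ) :
    (v - Q *ᵥ (W *ᵥ v)) ⬝ᵥ (Q *ᵥ x) = 0 := by
  rw [dotProduct_mulVec, h.residual_vecMul, zero_dotProduct]

lemma residual_dotProduct (h : IsPseudoInverse Q W k) (v : Fin d → ℝ) :
    (v - Q *ᵥ (W *ᵥ v)) ⬝ᵥ v =
      (v - Q *ᵥ (W *ᵥ v)) ⬝ᵥ (v - Q *ᵥ (W *ᵥ v)) := by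
  rw [dotProduct_sub, h.residual_dotProduct_mulVec, sub_zero]

lemma coord_apply_of_le (h : IsPseudoInverse Q W k) (v : Fin d → ℝ) {i : Fin d}
    (hi : k ≤ i) : (W *ᵥ v) i = 0 := by
  rw [← h.proj_coord, coordProj_mulVec, if_neg (by omega)]

/-- The projection on the column space gains the projection on the line of the residual `w`. This
yields both the symmetry of the new product and the new column space. -/
lemma extend_mul (hp : IsPseudoInverse Q W k) (hk : k < d) {ρ h : ℝ} (hρ : ρ ≠ 0) (hh : h ≠ 0)
    {v u w : Fin d → ℝ} (hu : u = W *ᵥ v) (hw : w = v - Q *ᵥ u) (hν : w ⬝ᵥ w ≠ 0) :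
    (ρ • Q + (ρ / h) • vecMulVec v (basisVec d k)) *
      ((1 / ρ) • W + (1 / (ρ * (w ⬝ᵥ w))) • vecMulVec (h • basisVec d k - u) w) =
      Q * W + (1 / (w ⬝ᵥ w)) • vecMulVec w w := by
  have hee : basisVec d k ⬝ᵥ basisVec d k = 1 := by
    rw [basisVec_dotProduct hk]; simp [basisVec]
  have heu : basisVec d k ⬝ᵥ u = 0 := by
    rw [basisVec_dotProduct hk, hu]; exact hp.coord_apply_of_le v le_rfl
  simp only [Matrix.add_mul, Matrix.mul_add, Matrix.smul_mul, Matrix.mul_smul,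
    Matrix.mul_vecMulVec, Matrix.vecMulVec_mul, hp.basisVec_vecMul, mulVec_sub, mulVec_smul,
    hp.mulVec_basisVec, vecMulVec_mulVec, hee, heu, add_mulVec, smul_mulVec]
  have hwi : ∀ i, w i = v i - (Q *ᵥ u) i := fun i => by rw [hw]; rfl
  ext i j
  generalize w ⬝ᵥ w = ν at hν
  simp only [Matrix.add_apply, Matrix.smul_apply, vecMulVec_apply, Pi.smul_apply, Pi.sub_apply,
    Pi.add_apply, Pi.zero_apply, smul_eq_mul, MulOpposite.smul_eq_mul_unop, MulOpposite.unop_op,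
    hwi i]
  field_simp
  ring

/-- A new direction is appended. -/
lemma extend (hp : IsPseudoInverse Q W k) (hk : k < d) {ρ h : ℝ} (hρ : ρ ≠ 0) (hh : h ≠ 0)
    {v u w : Fin d → ℝ} (hu : u = W *ᵥ v) (hw : w = v - Q *ᵥ u) (hν : w ⬝ᵥ w ≠ 0) :
    IsPseudoInverse (ρ • Q + (ρ / h) • vecMulVec v (basisVec d k))
      ((1 / ρ) • W + (1 / (ρ * (w ⬝ᵥ w))) • vecMulVec (h • basisVec d k - u) w) (k + 1) := by
  have hwQ : w ᵥ* Q = 0 := by rw [hw, hu]; exact hp.residual_vecMul v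
  have hwv : w ⬝ᵥ v = w ⬝ᵥ w := by rw [hw, hu]; exact hp.residual_dotProduct v
  have hPu : coordProj d k *ᵥ u = u := by rw [hu, hp.proj_coord]
  have hPu' : coordProj d (k + 1) *ᵥ u = u := by
    rw [← hPu, mulVec_mulVec, (coordProj_mul_of_le (Nat.le_succ k)).1]
  have hQP : Q * coordProj d (k + 1) = Q := by
    rw [← hp.mul_proj, Matrix.mul_assoc, (coordProj_mul_of_le (Nat.le_succ k)).2]
  have hPW : coordProj d (k + 1) * W = W := by
    rw [← hp.proj_mul, ← Matrix.mul_assoc, (coordProj_mul_of_le (Nat.le_succ k)).1]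
  refine ⟨?_, ?_, ?_, ?_⟩
  · rw [coordProj_succ]
    simp only [Matrix.add_mul, Matrix.mul_add, Matrix.smul_mul, Matrix.mul_smul, hp.mul_eq,
      Matrix.mul_vecMulVec, Matrix.vecMulVec_mul, hwQ, ← hu, hwv, add_mulVec,
      smul_mulVec, vecMulVec_mulVec]
    ext i j
    simp only [Matrix.add_apply, Matrix.smul_apply, vecMulVec_apply, Pi.smul_apply, Pi.sub_apply,
      Pi.add_apply, smul_eq_mul, Pi.zero_apply, MulOpposite.smul_eq_mul_unop,
      MulOpposite.unop_op]
    field_simp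
    ring
  · simp only [Matrix.add_mul, Matrix.smul_mul, hQP, vecMulVec_mul, basisVec_vecMul_coordProj_succ]
  · simp only [Matrix.mul_add, Matrix.mul_smul, hPW, mul_vecMulVec, mulVec_sub, mulVec_smul,
      coordProj_succ_mulVec_basisVec, hPu']
  · rw [hp.extend_mul hk hρ hh hu hw hν, transpose_add, hp.symm, transpose_smul,
      transpose_vecMulVec]

/-- As `v = Q *ᵥ u`, the new `Q` is the old one times the stretch along `u`, and the new `W` is the
inverse stretch times the old one. The stretches cancel, so the column space does not change. -/
lemma stretch_mul {a b : ℝ} (ha : a ≠ 0) (hb : b ≠ 0)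
    {v u : Fin d → ℝ} (hv : v = Q *ᵥ u) (hν : u ⬝ᵥ u ≠ 0) :
    (b • Q + ((a - b) / (u ⬝ᵥ u)) • vecMulVec v u) *
      ((1 / b) • W + ((1 / a - 1 / b) / (u ⬝ᵥ u)) • vecMulVec u (u ᵥ* W)) = Q * W := by
  simp only [Matrix.add_mul, Matrix.mul_add, Matrix.smul_mul, Matrix.mul_smul,
    Matrix.mul_vecMulVec, Matrix.vecMulVec_mul, ← hv, vecMulVec_mulVec, add_mulVec, smul_mulVec]
  ext i j
  generalize u ⬝ᵥ u = ν at hν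
  simp only [Matrix.add_apply, Matrix.smul_apply, vecMulVec_apply, Pi.smul_apply,
    Pi.add_apply, smul_eq_mul, MulOpposite.smul_eq_mul_unop, MulOpposite.unop_op]
  field_simp
  ring

/-- The ellipsoid is stretched in the direction of `u`. -/
lemma stretch (hp : IsPseudoInverse Q W k) {a b : ℝ} (ha : a ≠ 0) (hb : b ≠ 0)
    {v u : Fin d → ℝ} (hu : u = W *ᵥ v) (hv : v = Q *ᵥ u) (hν : u ⬝ᵥ u ≠ 0) :
    IsPseudoInverse (b • Q + ((a - b) / (u ⬝ᵥ u)) • vecMulVec v u)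
      ((1 / b) • W + ((1 / a - 1 / b) / (u ⬝ᵥ u)) • vecMulVec u (u ᵥ* W)) k := by
  have hPu : coordProj d k *ᵥ u = u := by rw [hu, hp.proj_coord]
  have huP : u ᵥ* coordProj d k = u := by rw [vecMul_coordProj, hPu]
  have huWv : (u ᵥ* W) ⬝ᵥ v = u ⬝ᵥ u := by rw [← dotProduct_mulVec, ← hu]
  refine ⟨?_, ?_, ?_, ?_⟩
  · simp only [Matrix.add_mul, Matrix.mul_add, Matrix.smul_mul, Matrix.mul_smul, hp.mul_eq,
      Matrix.mul_vecMulVec, Matrix.vecMulVec_mul, ← hu, huWv, vecMul_vecMul, huP,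
      add_mulVec, smul_mulVec, vecMulVec_mulVec]
    ext i j
    generalize u ⬝ᵥ u = ν at hν
    simp only [Matrix.add_apply, Matrix.smul_apply, vecMulVec_apply, Pi.smul_apply, Pi.add_apply,
      smul_eq_mul, MulOpposite.smul_eq_mul_unop, MulOpposite.unop_op]
    field_simp
    ring
  · simp only [Matrix.add_mul, Matrix.smul_mul, hp.mul_proj, vecMulVec_mul, huP]
  · simp only [Matrix.mul_add, Matrix.mul_smul, hp.proj_mul, mul_vecMulVec, hPu]
  · rw [stretch_mul ha hb hv hν, hp.symm]

end IsPseudoInverse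

end PseudoInverse

/-! ### Both kinds of update satisfy the monotone inclusions -/

section Rounding

variable {d : ℕ}

namespace Rounding

lemma mem_outer {ρ : Rounding d} {x : EuclideanSpace ℝ (Fin d)} :
    x ∈ ρ.outer ↔ ∃ u : EuclideanSpace ℝ (Fin d), ‖u‖ ≤ 1 ∧
      x = ρ.center + Matrix.toEuclideanLin ρ.shape u := by
  constructor
  · rintro ⟨_, ⟨u, hu, rfl⟩, rfl⟩
    exact ⟨u, by simpa using hu, rfl⟩
  · rintro ⟨u, hu, rfl⟩
    exact ⟨_, ⟨u, by simpa using hu, rfl⟩, rfl⟩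

lemma mem_inner {ρ : Rounding d} {x : EuclideanSpace ℝ (Fin d)} :
    x ∈ ρ.inner ↔ ∃ u : EuclideanSpace ℝ (Fin d), ‖u‖ ≤ 1 ∧
      x = ρ.center + ρ.scale • Matrix.toEuclideanLin ρ.shape u := by
  constructor
  · rintro ⟨_, ⟨u, hu, rfl⟩, rfl⟩
    exact ⟨u, by simpa using hu, rfl⟩
  · rintro ⟨u, hu, rfl⟩
    exact ⟨_, ⟨u, by simpa using hu, rfl⟩, rfl⟩

lemma mem_ellipsoid {ρ : Rounding d} {x : EuclideanSpace ℝ (Fin d)} :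
    x ∈ ρ.ellipsoid ↔ ∃ u : EuclideanSpace ℝ (Fin d), ‖u‖ ≤ 1 ∧
      x = Matrix.toEuclideanLin ρ.shape u := by
  simp [ellipsoid, eq_comm]

lemma center_mem_inner (ρ : Rounding d) : ρ.center ∈ ρ.inner :=
  mem_inner.2 ⟨0, by simp, by simp⟩

lemma convex_ellipsoid (ρ : Rounding d) : Convex ℝ ρ.ellipsoid :=
  (convex_closedBall 0 1).linear_image _

lemma convex_outer (ρ : Rounding d) : Convex ℝ ρ.outer :=
  ρ.convex_ellipsoid.translate ρ.center

lemma IsMonotoneUpdate.of_mem {ρ ρ' : Rounding d} {z : EuclideanSpace ℝ (Fin d)}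
    (h1 : ρ.outer ⊆ ρ'.outer) (h2 : z ∈ ρ'.outer)
    (h3 : ρ'.inner ⊆ convexHull ℝ (ρ.inner ∪ {z})) : ρ.IsMonotoneUpdate z ρ' :=
  ⟨convexHull_min (Set.union_subset h1 (Set.singleton_subset_iff.2 h2)) ρ'.convex_outer, h3⟩

lemma IsMonotoneUpdate.refl {ρ : Rounding d} {z : EuclideanSpace ℝ (Fin d)} (h : z ∈ ρ.outer) :
    ρ.IsMonotoneUpdate z ρ :=
  .of_mem subset_rfl h (Set.subset_union_left.trans (subset_convexHull ℝ _))

/-- An irregular update preserves the two inclusions that define monotone updates. -/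
lemma IsIrregularUpdate.isMonotoneUpdate {ρ ρ' : Rounding d} {z : EuclideanSpace ℝ (Fin d)}
    (h : ρ.IsIrregularUpdate z ρ') (hα : 0 < ρ.scale) : ρ.IsMonotoneUpdate z ρ' := by
  obtain ⟨hc, hE, hs⟩ := h
  set α := ρ.scale with hαdef
  set L := Matrix.toEuclideanLin ρ.shape with hL
  have hα' : ρ'.scale = α / (1 + α) := by
    have : 1 / ρ'.scale = (1 + α) / α := by rw [hs]; field_simp
    rw [← one_div_one_div ρ'.scale, this, one_div_div]
  have hout : ∀ (u : EuclideanSpace ℝ (Fin d)) (s : ℝ),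
      ‖u‖ ^ 2 + (1 + 2 * α) * s ^ 2 ≤ (1 + α) ^ 2 / (1 + 2 * α) →
      ρ'.center + (L u + s • (z - ρ.center)) ∈ ρ'.outer := by
    intro u s h
    refine ⟨_, ?_, rfl⟩
    rw [hE]
    exact ⟨u, s, rfl, h⟩
  refine .of_mem ?_ ?_ ?_
  · intro x hx
    obtain ⟨u, hu, rfl⟩ := mem_outer.1 hx
    -- Old points have component `0` along `z - ρ.center` from the old center, hence `-(α / (1 + 2 *
    -- α))` from the new one.
    have := hout u (-(α / (1 + 2 * α))) ?_
    · convert this using 1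
      rw [hc]; module
    · have h1 : ‖u‖ ^ 2 ≤ 1 := (sq_le_one_iff₀ (norm_nonneg _)).2 hu
      have h2 : (1 + α) ^ 2 / (1 + 2 * α) =
          1 + (1 + 2 * α) * (-(α / (1 + 2 * α))) ^ 2 := by field_simp; ring
      rw [h2]; linarith
  · have := hout 0 ((1 + α) / (1 + 2 * α)) ?_
    · convert this using 1
      rw [hc, map_zero]
      have : ((1 + α) / (1 + 2 * α)) = 1 - α / (1 + 2 * α) := by field_simp; ring
      rw [this]; module
    · apply le_of_eq
      simp only [norm_zero]
      field_simp
      ring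
  · intro x hx
    have hx' : ∃ y ∈ ρ'.ellipsoid, x = ρ'.center + ρ'.scale • y := by
      obtain ⟨y, hy, rfl⟩ := hx
      exact ⟨y, hy, rfl⟩
    obtain ⟨y, hy, rfl⟩ := hx'
    rw [hE] at hy
    obtain ⟨u, s, rfl, hus⟩ := hy
    rw [hc, hα']
    -- The component along `z - ρ.center` measured from the old center. It lies in `[0, 1)` and
    -- becomes the weight of `z` in the convex combination.
    set s' := α / (1 + 2 * α) + α / (1 + α) * s with hs'
    have e1 : (1 + 2 * α) * (s' - α / (1 + 2 * α)) ^ 2 + (α / (1 + α) * ‖u‖) ^ 2 ≤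
        α ^ 2 / (1 + 2 * α) := by
      have : (1 + 2 * α) * (s' - α / (1 + 2 * α)) ^ 2 + (α / (1 + α) * ‖u‖) ^ 2 =
        (α / (1 + α)) ^ 2 * (‖u‖ ^ 2 + (1 + 2 * α) * s ^ 2) := by rw [hs']; ring
      rw [this]
      refine (mul_le_mul_of_nonneg_left hus (by positivity)).trans_eq ?_
      field_simp
    have e2 : (s' - α / (1 + 2 * α)) ^ 2 ≤ (α / (1 + 2 * α)) ^ 2 := by
      have h1 : (1 + 2 * α) * (s' - α / (1 + 2 * α)) ^ 2 ≤ α ^ 2 / (1 + 2 * α) := by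
        nlinarith [sq_nonneg (α / (1 + α) * ‖u‖)]
      have h2 : α ^ 2 / (1 + 2 * α) = (1 + 2 * α) * (α / (1 + 2 * α)) ^ 2 := by field_simp
      rw [h2] at h1
      exact le_of_mul_le_mul_left h1 (by positivity)
    have e3 := abs_le_of_sq_le_sq' e2 (by positivity)
    have hs0 : 0 ≤ s' := by linarith [e3.1]
    have hq : 2 * (α / (1 + 2 * α)) < 1 := by
      have : 2 * (α / (1 + 2 * α)) = 1 - 1 / (1 + 2 * α) := by field_simp; ring
      have : 0 < 1 / (1 + 2 * α) := by positivity
      linarith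
    have hs1 : 0 < 1 - s' := by linarith [e3.2]
    -- At height `s'` the cone with apex `z` over the old inner ball has radius `α * (1 - s')` in
    -- normalized coordinates. The excess over the new inner ball is the square of `α - s' * (1 +
    -- α)`, so the two are tangent.
    have e4 : α / (1 + α) * ‖u‖ ≤ α * (1 - s') := by
      apply le_of_sq_le_sq _ (by positivity)
      have : (α * (1 - s')) ^ 2 = (α - s' * (1 + α)) ^ 2 +
          (α ^ 2 / (1 + 2 * α) - (1 + 2 * α) * (s' - α / (1 + 2 * α)) ^ 2) := by
        field_simp; ring
      nlinarith [sq_nonneg (α - s' * (1 + α))]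
    have hmem : ρ.center + α • L ((1 / ((1 + α) * (1 - s'))) • u) ∈ ρ.inner := by
      refine mem_inner.2 ⟨_, ?_, rfl⟩
      rw [norm_smul, Real.norm_of_nonneg (by positivity)]
      have : 1 / ((1 + α) * (1 - s')) * ‖u‖ = (α / (1 + α) * ‖u‖) / (α * (1 - s')) := by
        field_simp
      rw [this]
      exact div_le_one_of_le₀ e4 (by positivity)
    have hcomb := (convex_convexHull ℝ (ρ.inner ∪ {z})) (subset_convexHull ℝ _ (Or.inl hmem))
      (subset_convexHull ℝ _ (Or.inr rfl)) hs1.le hs0 (by ring)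
    convert hcomb using 1
    rw [map_smul]
    have : ((1 - s') • (ρ.center + α • (1 / ((1 + α) * (1 - s'))) • L u) + s' • z) =
        ρ.center + ((1 - s') * (α * (1 / ((1 + α) * (1 - s'))))) • L u + s' • (z - ρ.center) := by
      module
    rw [this]
    have : (1 - s') * (α * (1 / ((1 + α) * (1 - s')))) = α / (1 + α) := by field_simp
    rw [this, hs']
    module

/-- An update by stretching the ellipsoid in the direction of the new point. -/
lemma isMonotoneUpdate_of_stretch {ρ ρ' : Rounding d} {z e : EuclideanSpace ℝ (Fin d)}
    {a b c D : ℝ} (he : ‖e‖ = 1)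
    (hz : z = ρ.center + D • Matrix.toEuclideanLin ρ.shape e)
    (hcenter : ρ'.center = ρ.center + c • Matrix.toEuclideanLin ρ.shape e)
    (hshape : ∀ x, Matrix.toEuclideanLin ρ'.shape x =
      Matrix.toEuclideanLin ρ.shape (stretch e a b x))
    (hα : 0 < ρ.scale) (hα' : 0 < ρ'.scale) (hD : 0 < D) (hc : 0 ≤ c) (hcD : c + a = D)
    (hcα : c = ρ'.scale * a - ρ.scale) (ha : 0 < a) (hb : 1 < b) (hba : b ^ 2 < a ^ 2)
    (h1 : c ^ 2 * b ^ 2 ≤ (b ^ 2 - 1) * (a ^ 2 - b ^ 2))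
    (h2 : c ^ 2 ≤ ρ'.scale ^ 2 * (a ^ 2 - b ^ 2))
    (h3 : ρ'.scale ^ 2 * (b ^ 2 * D ^ 2 + (a ^ 2 - b ^ 2) * ρ.scale ^ 2) ≤
      ρ.scale ^ 2 * a ^ 2) : ρ.IsMonotoneUpdate z ρ' := by
  refine .of_mem ?_ ?_ ?_
  · intro x hx
    obtain ⟨u, hu, rfl⟩ := mem_outer.1 hx
    obtain ⟨y, hy, rfl⟩ := exists_stretch_of_mem_unitBall he hb hba ha h1 hu
    refine mem_outer.2 ⟨y, hy, ?_⟩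
    rw [hcenter, hshape, map_add, map_smul, add_assoc]
  · refine mem_outer.2 ⟨e, he.le, ?_⟩
    rw [hcenter, hshape, stretch_self he, map_smul, hz, ← hcD, add_smul, add_assoc]
  · intro x hx
    obtain ⟨y, hy, rfl⟩ := mem_inner.1 hx
    have hmem := stretch_mem_convexHull he ha (by linarith) hα hα' hD hc hcD hcα h2 h3 hy
    -- The map from normalized to actual coordinates. Affine maps commute with convex hulls, so the
    -- shape matrix need not be invertible.
    let f : EuclideanSpace ℝ (Fin d) →ᵃ[ℝ] EuclideanSpace ℝ (Fin d) :=
      (Matrix.toEuclideanLin ρ.shape).toAffineMap + AffineMap.const ℝ _ ρ.center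
    have hf : ∀ x, f x = Matrix.toEuclideanLin ρ.shape x + ρ.center := fun x => rfl
    have h4 := Set.mem_image_of_mem f hmem
    rw [AffineMap.image_convexHull, Set.image_union, Set.image_singleton] at h4
    have h5 : f '' ((fun x => ρ.scale • x) '' Metric.closedBall 0 1) ⊆ ρ.inner := by
      rintro _ ⟨_, ⟨x, hx, rfl⟩, rfl⟩
      refine mem_inner.2 ⟨x, by simpa using hx, ?_⟩
      rw [hf, map_smul, add_comm]
    have h6 : f (D • e) = z := by rw [hf, map_smul, hz, add_comm]
    rw [h6] at h4
    have h7 := convexHull_mono (Set.union_subset_union_left {z} h5) h4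
    convert h7 using 1
    rw [hf, hcenter, hshape, map_add, map_smul, map_smul]
    abel

end Rounding

end Rounding

/-! ### The algorithm on exact data, and correctness of a single step -/

section Tracker

open Matrix

variable {d : ℕ}

/-- The data maintained by the algorithm: the matrix of the ellipsoid, its Moore-Penrose inverse,
the center, the scale and the dimension. -/
structure Tracker (d : ℕ) where
  Q : Matrix (Fin d) (Fin d) ℝ
  W : Matrix (Fin d) (Fin d) ℝ
  c : Fin d → ℝ
  α : ℝ
  k : ℕ

namespace Tracker

/-- The rounding given by the data. -/
def rounding (τ : Tracker d) : Rounding d where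
  shape := τ.Q
  center := WithLp.toLp 2 τ.c
  scale := τ.α

/-- The data after the first point. -/
def start (z : EuclideanSpace ℝ (Fin d)) : Tracker d := ⟨0, 0, z.ofLp, 1, 0⟩

/-- The vector from the center to a point. -/
def offset (τ : Tracker d) (z : EuclideanSpace ℝ (Fin d)) : Fin d → ℝ := z.ofLp - τ.c

/-- The coordinates of a point with respect to the ellipsoid. -/
def coord (τ : Tracker d) (z : EuclideanSpace ℝ (Fin d)) : Fin d → ℝ := τ.W *ᵥ τ.offset z

/-- The component of a point orthogonal to the span of the ellipsoid. -/
def residual (τ : Tracker d) (z : EuclideanSpace ℝ (Fin d)) : Fin d → ℝ :=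
  τ.offset z - τ.Q *ᵥ τ.coord z

/-- The irregular update by `z`. -/
noncomputable def irregular (τ : Tracker d) (z : EuclideanSpace ℝ (Fin d)) : Tracker d :=
  let h := Real.sqrt (1 + 2 * τ.α)
  let ρ := (1 + τ.α) / h
  { Q := ρ • τ.Q + (ρ / h) • vecMulVec (τ.offset z) (basisVec d τ.k)
    W := (1 / ρ) • τ.W + (1 / (ρ * (τ.residual z ⬝ᵥ τ.residual z))) •
      vecMulVec (h • basisVec d τ.k - τ.coord z) (τ.residual z)
    c := τ.c + (τ.α / (1 + 2 * τ.α)) • τ.offset z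
    α := τ.α / (1 + τ.α)
    k := τ.k + 1 }

/-- The update by a point `z` in the span of the earlier points, outside the ellipsoid. -/
noncomputable def regular (τ : Tracker d) (z : EuclideanSpace ℝ (Fin d)) : Tracker d :=
  let ν := τ.coord z ⬝ᵥ τ.coord z
  let D := Real.sqrt ν
  let A := 1 / τ.α
  let A' := A + growth D
  let x := A * D
  let a := axisLong A A' x
  let b := Real.sqrt (axisShortSq A A' x)
  { Q := b • τ.Q + ((a - b) / ν) • vecMulVec (τ.offset z) (τ.coord z)
    W := (1 / b) • τ.W + ((1 / a - 1 / b) / ν) • vecMulVec (τ.coord z) (τ.coord z ᵥ* τ.W)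
    c := τ.c + (centerShift A A' x / D) • τ.offset z
    α := 1 / A'
    k := τ.k }

open Classical in
/-- One step of the algorithm. -/
noncomputable def step (τ : Tracker d) (z : EuclideanSpace ℝ (Fin d)) : Tracker d :=
  if 0 < τ.residual z ⬝ᵥ τ.residual z then τ.irregular z
  else if 1 < τ.coord z ⬝ᵥ τ.coord z then τ.regular z else τ

/-- The algebraic invariants. -/
structure Valid (τ : Tracker d) : Prop where
  inv : IsPseudoInverse τ.Q τ.W τ.k
  scale_pos : 0 < τ.α
  scale_le : τ.α ≤ 1

variable {τ : Tracker d} {z : EuclideanSpace ℝ (Fin d)}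

lemma valid_start (z : EuclideanSpace ℝ (Fin d)) : (start z).Valid :=
  ⟨.zero, one_pos, le_rfl⟩

end Tracker

lemma norm_sq_eq_dotProduct (x : EuclideanSpace ℝ (Fin d)) : ‖x‖ ^ 2 = x.ofLp ⬝ᵥ x.ofLp := by
  rw [EuclideanSpace.real_norm_sq_eq, dotProduct]
  simp [sq]

lemma toEuclideanLin_eq (M : Matrix (Fin d) (Fin d) ℝ) (x : EuclideanSpace ℝ (Fin d)) :
    toEuclideanLin M x = WithLp.toLp 2 (M *ᵥ x.ofLp) := rfl

lemma toEuclideanLin_rankOne (s f : ℝ) (M : Matrix (Fin d) (Fin d) ℝ) (v u : Fin d → ℝ)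
    (x : EuclideanSpace ℝ (Fin d)) :
    toEuclideanLin (s • M + f • vecMulVec v u) x =
      s • toEuclideanLin M x + (f * (u ⬝ᵥ x.ofLp)) • WithLp.toLp 2 v := by
  simp only [toEuclideanLin_eq, add_mulVec, smul_mulVec, vecMulVec_mulVec, WithLp.toLp_add,
    WithLp.toLp_smul, op_smul_eq_smul, smul_smul]

/-- The ellipsoid after a new direction has been appended. -/
lemma ellipsoid_extend {Q W : Matrix (Fin d) (Fin d) ℝ} {k : ℕ} (hp : IsPseudoInverse Q W k)
    (hk : k < d) {ρ h : ℝ} (hρ : 0 < ρ) (hh : 0 < h) (v : Fin d → ℝ)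
    (x : EuclideanSpace ℝ (Fin d)) :
    (∃ y : EuclideanSpace ℝ (Fin d), ‖y‖ ≤ 1 ∧
      x = toEuclideanLin (ρ • Q + (ρ / h) • vecMulVec v (basisVec d k)) y) ↔
    ∃ (u : EuclideanSpace ℝ (Fin d)) (s : ℝ),
      x = toEuclideanLin Q u + s • WithLp.toLp 2 v ∧ ‖u‖ ^ 2 + h ^ 2 * s ^ 2 ≤ ρ ^ 2 := by
  set e : EuclideanSpace ℝ (Fin d) := WithLp.toLp 2 (basisVec d k) with he
  have hQe : toEuclideanLin Q e = 0 := by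
    rw [toEuclideanLin_eq, he]
    simp [hp.mulVec_basisVec]
  have hdot : ∀ y : EuclideanSpace ℝ (Fin d), basisVec d k ⬝ᵥ y.ofLp = y ⟨k, hk⟩ :=
    fun y => basisVec_dotProduct hk _
  have hek : e ⟨k, hk⟩ = 1 := by simp [he, basisVec]
  have hnorm : ∀ (y : EuclideanSpace ℝ (Fin d)) (r : ℝ),
      ‖y + r • e‖ ^ 2 = ‖y‖ ^ 2 + 2 * r * y ⟨k, hk⟩ + r ^ 2 := by
    intro y r
    rw [norm_sq_eq_dotProduct, norm_sq_eq_dotProduct]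
    simp only [WithLp.ofLp_add, WithLp.ofLp_smul, dotProduct_add, add_dotProduct, smul_dotProduct,
      dotProduct_smul, he, smul_eq_mul]
    rw [dotProduct_comm y.ofLp (basisVec d k), basisVec_dotProduct hk, basisVec_dotProduct hk]
    simp only [basisVec]
    ring_nf
    simp
  constructor
  · rintro ⟨y, hy, rfl⟩
    -- `Q` ignores the coordinate `k`, so it is removed from `y` and reused as the coefficient of
    -- `v`.
    refine ⟨ρ • (y + (-y ⟨k, hk⟩) • e), ρ * y ⟨k, hk⟩ / h, ?_, ?_⟩
    · rw [toEuclideanLin_rankOne, hdot, map_smul, map_add, map_smul, hQe]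
      simp only [smul_zero, add_zero]
      congr 2; ring
    · rw [norm_smul, mul_pow, hnorm, Real.norm_of_nonneg hρ.le]
      have h1 : ‖y‖ ^ 2 ≤ 1 := (sq_le_one_iff₀ (norm_nonneg _)).2 hy
      have h2 : h ^ 2 * (ρ * y ⟨k, hk⟩ / h) ^ 2 = ρ ^ 2 * y ⟨k, hk⟩ ^ 2 := by field_simp
      rw [h2]
      nlinarith [sq_nonneg ρ]
  · rintro ⟨u, s, rfl, hus⟩
    -- The coordinate `k` of `u` does not affect `Q u` and is overwritten by `h * s`; discarding it
    -- can only decrease the norm.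
    refine ⟨(1 / ρ) • (u + (h * s - u ⟨k, hk⟩) • e), ?_, ?_⟩
    · rw [← sq_le_one_iff₀ (norm_nonneg _), norm_smul, mul_pow, hnorm,
        Real.norm_of_nonneg (by positivity), one_div, inv_pow, inv_mul_le_iff₀ (by positivity)]
      nlinarith [sq_nonneg (u ⟨k, hk⟩)]
    · rw [toEuclideanLin_rankOne, hdot, map_smul, map_add, map_smul, hQe]
      simp only [PiLp.smul_apply, PiLp.add_apply, hek, smul_eq_mul]
      rw [smul_zero, add_zero, smul_smul]
      congr 1
      · rw [mul_one_div_cancel hρ.ne', one_smul]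
      · congr 1; field_simp; ring

namespace Tracker

variable {τ : Tracker d} {z : EuclideanSpace ℝ (Fin d)}

lemma offset_eq : WithLp.toLp 2 (τ.offset z) = z - τ.rounding.center := rfl

lemma residual_eq_zero (h : ¬ 0 < τ.residual z ⬝ᵥ τ.residual z) : τ.residual z = 0 := by
  have h1 : 0 ≤ τ.residual z ⬝ᵥ τ.residual z := by
    rw [← WithLp.ofLp_toLp 2 (τ.residual z), ← norm_sq_eq_dotProduct]; positivity
  exact dotProduct_self_eq_zero.1 (le_antisymm (not_lt.1 h) h1)

lemma offset_eq_mulVec_coord (h : τ.residual z = 0) : τ.offset z = τ.Q *ᵥ τ.coord z :=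
  sub_eq_zero.1 h

/-- The scalars of an irregular update. -/
lemma irregular_scalars {α : ℝ} (hα : 0 < α) :
    0 < Real.sqrt (1 + 2 * α) ∧ Real.sqrt (1 + 2 * α) ^ 2 = 1 + 2 * α ∧
      0 < (1 + α) / Real.sqrt (1 + 2 * α) ∧
      ((1 + α) / Real.sqrt (1 + 2 * α)) ^ 2 = (1 + α) ^ 2 / (1 + 2 * α) := by
  have h1 : Real.sqrt (1 + 2 * α) ^ 2 = 1 + 2 * α := Real.sq_sqrt (by positivity)
  have h2 : 0 < Real.sqrt (1 + 2 * α) := Real.sqrt_pos.2 (by positivity)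
  refine ⟨h2, h1, by positivity, by rw [div_pow, h1]⟩

lemma Valid.irregular (hτ : τ.Valid) (hk : τ.k < d)
    (h : 0 < τ.residual z ⬝ᵥ τ.residual z) : (τ.irregular z).Valid := by
  obtain ⟨h1, h2, h3, h4⟩ := irregular_scalars hτ.scale_pos
  have := hτ.scale_pos
  exact ⟨hτ.inv.extend hk h3.ne' h1.ne' rfl rfl h.ne', by simp only [Tracker.irregular]; positivity,
    by simp only [Tracker.irregular]; rw [div_le_one (by positivity)]; linarith⟩

lemma isIrregularUpdate_irregular (hτ : τ.Valid) (hk : τ.k < d) :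
    τ.rounding.IsIrregularUpdate z (τ.irregular z).rounding := by
  obtain ⟨h1, h2, h3, h4⟩ := irregular_scalars hτ.scale_pos
  have hα := hτ.scale_pos
  refine ⟨?_, ?_, ?_⟩
  · rfl
  · ext x
    rw [Rounding.mem_ellipsoid]
    have := ellipsoid_extend hτ.inv hk h3 h1 (τ.offset z) x
    rw [h2, h4] at this
    exact this
  · simp only [rounding, Tracker.irregular]
    field_simp

/-- The scalars of a regular update. -/
lemma regular_scalars (hτ : τ.Valid) (h : 1 < τ.coord z ⬝ᵥ τ.coord z) :
    1 ≤ 1 / τ.α ∧ 1 < Real.sqrt (τ.coord z ⬝ᵥ τ.coord z) :=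
  ⟨by rw [one_le_div hτ.scale_pos]; exact hτ.scale_le, by rw [Real.lt_sqrt] <;> simp [h]⟩

lemma Valid.regular (hτ : τ.Valid) (hr : τ.residual z = 0)
    (h : 1 < τ.coord z ⬝ᵥ τ.coord z) : (τ.regular z).Valid := by
  obtain ⟨hA, hD⟩ := regular_scalars hτ h
  obtain ⟨h1, h2, h3, h4⟩ := update_scalars hA hD
  obtain ⟨g0, g1, g2, g3, g4, g5, g6, g7, g8⟩ := update_admissible hA hD
  refine ⟨hτ.inv.stretch ?_ ?_ rfl (offset_eq_mulVec_coord hr) (by linarith), ?_, ?_⟩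
  · refine (lt_of_lt_of_le ?_ g3).ne'
    linarith
  · exact (Real.sqrt_pos.2 (by linarith)).ne'
  · simp only [Tracker.regular]
    have : 0 < 1 / τ.α + growth √(τ.coord z ⬝ᵥ τ.coord z) := by linarith
    positivity
  · simp only [Tracker.regular]
    rw [div_le_one (by linarith)]
    linarith

lemma isMonotoneUpdate_regular (hτ : τ.Valid) (hr : τ.residual z = 0)
    (h : 1 < τ.coord z ⬝ᵥ τ.coord z) :
    τ.rounding.IsMonotoneUpdate z (τ.regular z).rounding := by
  obtain ⟨hA, hD⟩ := regular_scalars hτ h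
  obtain ⟨h1, h2, h3, h4⟩ := update_scalars hA hD
  obtain ⟨g0, g1, g2, g3, g4, g5, g6, g7, g8⟩ := update_admissible hA hD
  have hval := hτ.regular hr h
  set ν := τ.coord z ⬝ᵥ τ.coord z with hν
  set D := √ν with hDdef
  have hDν : D ^ 2 = ν := Real.sq_sqrt (by linarith)
  have hD0 : 0 < D := by linarith
  set A := 1 / τ.α with hAdef
  set a := axisLong A (A + growth D) (A * D) with hadef
  set b := √(axisShortSq A (A + growth D) (A * D)) with hbdef
  have hb2 : b ^ 2 = axisShortSq A (A + growth D) (A * D) := Real.sq_sqrt (by linarith)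
  rw [← hb2] at g4 g5 g6 g7 g8
  have hAα : τ.α = 1 / A := by rw [hAdef, one_div_one_div]
  have hb1 : 1 < b := by
    have : 0 ≤ b := Real.sqrt_nonneg _
    nlinarith
  set u : EuclideanSpace ℝ (Fin d) := WithLp.toLp 2 (τ.coord z) with hu
  have hnu : ‖u‖ = D := by
    rw [hDdef, hν, ← WithLp.ofLp_toLp 2 (τ.coord z), ← norm_sq_eq_dotProduct,
      Real.sqrt_sq (norm_nonneg _)]
  have hQu : toEuclideanLin τ.Q u = WithLp.toLp 2 (τ.offset z) := by
    rw [toEuclideanLin_eq, offset_eq_mulVec_coord hr]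
  refine Rounding.isMonotoneUpdate_of_stretch (e := D⁻¹ • u) (a := a) (b := b) (D := D)
    (c := centerShift A (A + growth D) (A * D)) ?_ ?_ ?_ ?_ hτ.scale_pos hval.scale_pos hD0
    g0.le g1 ?_ (by linarith) hb1 g5 g6 ?_ ?_
  · rw [norm_smul, hnu, Real.norm_of_nonneg (by positivity), inv_mul_cancel₀ hD0.ne']
  · rw [map_smul, smul_smul, mul_inv_cancel₀ hD0.ne', one_smul]
    change z = _ + toEuclideanLin τ.Q u
    rw [hQu, offset_eq]; abel
  · rw [map_smul, smul_smul, ← div_eq_mul_inv]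
    change _ = _ + _ • toEuclideanLin τ.Q u
    rw [hQu]; rfl
  · intro x
    change toEuclideanLin (b • τ.Q + ((a - b) / ν) • vecMulVec (τ.offset z) (τ.coord z)) x =
      toEuclideanLin τ.Q _
    rw [toEuclideanLin_rankOne, StreamRounding.stretch, map_add, map_smul, map_smul, map_smul,
      hQu, smul_smul]
    congr 2
    have : inner ℝ (D⁻¹ • u) x = D⁻¹ * (τ.coord z ⬝ᵥ x.ofLp) := by
      rw [real_inner_smul_left, EuclideanSpace.inner_eq_star_dotProduct]
      simp [hu, dotProduct_comm]
    rw [this, ← hDν]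
    field_simp
  · change _ = 1 / (A + growth D) * a - τ.α
    rw [hAα]; exact g2
  · exact g7
  · change (1 / (A + growth D)) ^ 2 * (b ^ 2 * D ^ 2 + (a ^ 2 - b ^ 2) * τ.α ^ 2) ≤
      τ.α ^ 2 * a ^ 2
    rw [hAα]; exact g8

lemma mem_outer_of_coord_le (hr : τ.residual z = 0) (h : ¬ 1 < τ.coord z ⬝ᵥ τ.coord z) :
    z ∈ τ.rounding.outer := by
  refine Rounding.mem_outer.2 ⟨WithLp.toLp 2 (τ.coord z), ?_, ?_⟩
  · rw [← sq_le_one_iff₀ (norm_nonneg _), norm_sq_eq_dotProduct]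
    exact not_lt.1 h
  · change z = _ + toEuclideanLin τ.Q _
    rw [toEuclideanLin_eq, ← offset_eq_mulVec_coord hr, offset_eq]
    abel

lemma Valid.step (hτ : τ.Valid) (hk : 0 < τ.residual z ⬝ᵥ τ.residual z → τ.k < d) :
    (τ.step z).Valid := by
  unfold Tracker.step
  split_ifs with h1 h2
  · exact hτ.irregular (hk h1) h1
  · exact hτ.regular (residual_eq_zero h1) h2
  · exact hτ

lemma isMonotoneUpdate_step (hτ : τ.Valid) (hk : 0 < τ.residual z ⬝ᵥ τ.residual z → τ.k < d) :
    τ.rounding.IsMonotoneUpdate z (τ.step z).rounding := by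
  unfold Tracker.step
  split_ifs with h1 h2
  · exact (isIrregularUpdate_irregular hτ (hk h1)).isMonotoneUpdate hτ.scale_pos
  · exact isMonotoneUpdate_regular hτ (residual_eq_zero h1) h2
  · exact .refl (mem_outer_of_coord_le (residual_eq_zero h1) h2)

end Tracker

end Tracker

/-! ### Column spaces, affine spans and the invariants of the run -/

section Span

open Matrix

variable {d : ℕ}

/-- The column space of a matrix. -/
noncomputable def columnSpan (Q : Matrix (Fin d) (Fin d) ℝ) :
    Submodule ℝ (EuclideanSpace ℝ (Fin d)) :=
  LinearMap.range (toEuclideanLin Q)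

lemma mem_columnSpan {Q : Matrix (Fin d) (Fin d) ℝ} {x : EuclideanSpace ℝ (Fin d)} :
    x ∈ columnSpan Q ↔ ∃ y : Fin d → ℝ, Q *ᵥ y = x.ofLp := by
  constructor
  · rintro ⟨y, rfl⟩; exact ⟨y.ofLp, rfl⟩
  · rintro ⟨y, hy⟩
    exact ⟨WithLp.toLp 2 y, by rw [toEuclideanLin_eq, hy]⟩

lemma IsPseudoInverse.mem_columnSpan {Q W : Matrix (Fin d) (Fin d) ℝ} {k : ℕ}
    (hp : IsPseudoInverse Q W k) {x : EuclideanSpace ℝ (Fin d)} :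
    x ∈ columnSpan Q ↔ Q *ᵥ (W *ᵥ x.ofLp) = x.ofLp := by
  rw [StreamRounding.mem_columnSpan]
  constructor
  · rintro ⟨y, hy⟩
    rw [← hy, mulVec_mulVec, mulVec_mulVec, hp.mul_mul]
  · intro h; exact ⟨_, h⟩

namespace Tracker

variable {τ : Tracker d} {z : EuclideanSpace ℝ (Fin d)}

/-- A vector lies in the column space exactly when `Q * W` fixes it, and `Q * W` is unchanged by
`stretch_mul`. -/
lemma columnSpan_regular (hτ : τ.Valid) (hr : τ.residual z = 0)
    (h : 1 < τ.coord z ⬝ᵥ τ.coord z) : columnSpan (τ.regular z).Q = columnSpan τ.Q := by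
  have hval := hτ.regular hr h
  obtain ⟨hA, hD⟩ := regular_scalars hτ h
  obtain ⟨g0, g1, g2, g3, g4, g5, g6, g7, g8⟩ := update_admissible hA hD
  ext x
  rw [hval.inv.mem_columnSpan, hτ.inv.mem_columnSpan, mulVec_mulVec, mulVec_mulVec]
  have : (τ.regular z).Q * (τ.regular z).W = τ.Q * τ.W :=
    IsPseudoInverse.stretch_mul (lt_of_lt_of_le (by linarith) g3).ne'
      (Real.sqrt_pos.2 (by linarith)).ne' (offset_eq_mulVec_coord hr) (by linarith)
  rw [this]

/-- By `extend_mul` the new space is the old one plus the line of the residual, and the residual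
differs from `z - τ.rounding.center` by a vector of the old space. -/
lemma columnSpan_irregular (hτ : τ.Valid) (hk : τ.k < d)
    (h : 0 < τ.residual z ⬝ᵥ τ.residual z) :
    columnSpan (τ.irregular z).Q = ℝ ∙ (z - τ.rounding.center) ⊔ columnSpan τ.Q := by
  obtain ⟨h1, h2, h3, h4⟩ := irregular_scalars hτ.scale_pos
  have hval := hτ.irregular hk h
  have hmul : (τ.irregular z).Q * (τ.irregular z).W = τ.Q * τ.W +
      (1 / (τ.residual z ⬝ᵥ τ.residual z)) • vecMulVec (τ.residual z) (τ.residual z) :=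
    hτ.inv.extend_mul hk h3.ne' h1.ne' rfl rfl h.ne'
  have hmem : ∀ x : EuclideanSpace ℝ (Fin d), x ∈ columnSpan (τ.irregular z).Q ↔
      τ.Q *ᵥ (τ.W *ᵥ x.ofLp) + ((τ.residual z ⬝ᵥ x.ofLp) / (τ.residual z ⬝ᵥ τ.residual z)) •
        τ.residual z = x.ofLp := by
    intro x
    rw [hval.inv.mem_columnSpan, mulVec_mulVec, hmul, add_mulVec, smul_mulVec, vecMulVec_mulVec,
      mulVec_mulVec, op_smul_eq_smul, smul_smul, one_div, div_eq_inv_mul]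
  have hQmem : WithLp.toLp 2 (τ.Q *ᵥ τ.coord z) ∈ columnSpan τ.Q :=
    StreamRounding.mem_columnSpan.2 ⟨_, rfl⟩
  have hoff : z - τ.rounding.center =
      WithLp.toLp 2 (τ.residual z) + WithLp.toLp 2 (τ.Q *ᵥ τ.coord z) := by
    rw [← offset_eq, ← WithLp.toLp_add]
    simp [residual]
  apply le_antisymm
  · intro x hx
    rw [hmem] at hx
    have hx' : x = ((τ.residual z ⬝ᵥ x.ofLp) / (τ.residual z ⬝ᵥ τ.residual z)) •
        (z - τ.rounding.center) + (WithLp.toLp 2 (τ.Q *ᵥ (τ.W *ᵥ x.ofLp)) -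
        ((τ.residual z ⬝ᵥ x.ofLp) / (τ.residual z ⬝ᵥ τ.residual z)) •
          WithLp.toLp 2 (τ.Q *ᵥ τ.coord z)) := by
      conv_lhs => rw [← WithLp.toLp_ofLp 2 x, ← hx, WithLp.toLp_add, WithLp.toLp_smul]
      rw [hoff, smul_add]
      abel
    rw [hx']
    exact Submodule.add_mem_sup (Submodule.smul_mem _ _ (Submodule.mem_span_singleton_self _))
      (Submodule.sub_mem _ (StreamRounding.mem_columnSpan.2 ⟨_, rfl⟩)
        (Submodule.smul_mem _ _ hQmem))
  · have hle : columnSpan τ.Q ≤ columnSpan (τ.irregular z).Q := by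
      intro x hx
      rw [hmem]
      rw [hτ.inv.mem_columnSpan] at hx
      have : τ.residual z ⬝ᵥ x.ofLp = 0 := by
        rw [← hx]; exact hτ.inv.residual_dotProduct_mulVec _ _
      rw [hx, this]; simp
    refine sup_le ?_ hle
    rw [Submodule.span_singleton_le_iff_mem, hoff]
    refine Submodule.add_mem _ ?_ (hle hQmem)
    rw [hmem]
    have : τ.W *ᵥ τ.residual z = 0 := by
      rw [residual, mulVec_sub, hτ.inv.coord_mulVec, coord, hτ.inv.proj_coord, sub_self]
    simp only [this, mulVec_zero, zero_add, div_self h.ne', one_smul]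

lemma residual_eq_zero_iff (hτ : τ.Valid) :
    τ.residual z = 0 ↔ z - τ.rounding.center ∈ columnSpan τ.Q := by
  rw [hτ.inv.mem_columnSpan, ← offset_eq, residual, sub_eq_zero, eq_comm]
  rfl

lemma residual_pos_iff (hτ : τ.Valid) :
    0 < τ.residual z ⬝ᵥ τ.residual z ↔ z - τ.rounding.center ∉ columnSpan τ.Q := by
  rw [← residual_eq_zero_iff hτ]
  constructor
  · intro h h0
    rw [h0] at h; simp at h
  · intro h
    by_contra hcon
    exact h (residual_eq_zero hcon)

end Tracker

/-- The data after the points `z 0, …, z n`. -/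
noncomputable def run (z : ℕ → EuclideanSpace ℝ (Fin d)) : ℕ → Tracker d
  | 0 => .start (z 0)
  | n + 1 => (run z n).step (z (n + 1))

/-- The invariants of the run. -/
structure RunInvariant (z : ℕ → EuclideanSpace ℝ (Fin d)) (n : ℕ) : Prop where
  valid : (run z n).Valid
  span_eq : columnSpan (run z n).Q = (affineSpan ℝ (z '' Set.Iio (n + 1))).direction
  affDim_eq : affDim z (n + 1) = (run z n).k
  inner_subset : (run z n).rounding.inner ⊆ hull z (n + 1)
  subset_outer : hull z (n + 1) ⊆ (run z n).rounding.outer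

namespace RunInvariant

variable {z : ℕ → EuclideanSpace ℝ (Fin d)} {n : ℕ}

lemma center_mem_hull (h : RunInvariant z n) : (run z n).rounding.center ∈ hull z (n + 1) :=
  h.inner_subset (Rounding.center_mem_inner _)

lemma center_mem (h : RunInvariant z n) :
    (run z n).rounding.center ∈ affineSpan ℝ (z '' Set.Iio (n + 1)) :=
  convexHull_subset_affineSpan _ h.center_mem_hull

lemma residual_pos_iff (h : RunInvariant z n) (x : EuclideanSpace ℝ (Fin d)) :
    0 < (run z n).residual x ⬝ᵥ (run z n).residual x ↔
      x ∉ affineSpan ℝ (z '' Set.Iio (n + 1)) := by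
  rw [Tracker.residual_pos_iff h.valid, h.span_eq]
  rw [← vsub_eq_sub, AffineSubspace.vsub_right_mem_direction_iff_mem h.center_mem]

/-- A nonzero residual means that the column space is proper. So column `k` is still free when an
irregular update needs it. -/
lemma dim_lt (h : RunInvariant z n) {x : EuclideanSpace ℝ (Fin d)}
    (hx : 0 < (run z n).residual x ⬝ᵥ (run z n).residual x) : (run z n).k < d := by
  rw [← h.affDim_eq, affDim]
  conv_rhs => rw [← finrank_euclideanSpace_fin (𝕜 := ℝ) (n := d)]
  apply Submodule.finrank_lt
  rw [← h.span_eq]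
  intro htop
  rw [Tracker.residual_pos_iff h.valid, htop] at hx
  exact hx trivial

end RunInvariant

lemma image_Iio_succ (z : ℕ → EuclideanSpace ℝ (Fin d)) (n : ℕ) :
    z '' Set.Iio (n + 1) = insert (z n) (z '' Set.Iio n) := by
  rw [← Set.image_insert_eq]
  congr 1
  ext i
  simp only [Set.mem_Iio, Set.mem_insert_iff]
  omega

lemma hull_succ (z : ℕ → EuclideanSpace ℝ (Fin d)) (n : ℕ) :
    hull z (n + 1) = convexHull ℝ (hull z n ∪ {z n}) := by
  rw [hull, image_Iio_succ, hull, convexHull_convexHull_union_left, Set.union_singleton]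

/-- The center stays in the hull, so the direction of the span grows by `z (n + 1)` minus the
center, matching the column space. The sandwich is inherited because every step satisfies the two
monotone inclusions. -/
lemma runInvariant (z : ℕ → EuclideanSpace ℝ (Fin d)) (n : ℕ) : RunInvariant z n := by
  induction n with
  | zero =>
    have h0 : z '' Set.Iio (0 + 1) = {z 0} := by
      rw [image_Iio_succ]; simp
    have hspan : columnSpan (0 : Matrix (Fin d) (Fin d) ℝ) = ⊥ := by
      rw [columnSpan, map_zero, LinearMap.range_zero]
    have hdir : (affineSpan ℝ {z 0}).direction = ⊥ := by
      rw [direction_affineSpan, vectorSpan_singleton]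
    refine ⟨Tracker.valid_start _, ?_, ?_, ?_, ?_⟩
    · rw [h0, hdir]; exact hspan
    · rw [affDim, h0, hdir, finrank_bot]; rfl
    · intro x hx
      obtain ⟨u, -, rfl⟩ := Rounding.mem_inner.1 hx
      rw [hull, h0, convexHull_singleton]
      simp [run, Tracker.start, Tracker.rounding]
    · rw [hull, h0, convexHull_singleton, Set.singleton_subset_iff]
      exact Rounding.mem_outer.2 ⟨0, by simp, by simp [run, Tracker.start, Tracker.rounding]⟩
  | succ n ih =>
    have hmono := Tracker.isMonotoneUpdate_step ih.valid (z := z (n + 1)) (fun h => ih.dim_lt h)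
    have hstep : run z (n + 1) = (run z n).step (z (n + 1)) := rfl
    have hdir : (affineSpan ℝ (z '' Set.Iio (n + 1 + 1))).direction =
        ℝ ∙ (z (n + 1) - (run z n).rounding.center) ⊔ columnSpan (run z n).Q := by
      rw [image_Iio_succ z (n + 1), ← affineSpan_insert_affineSpan,
        AffineSubspace.direction_affineSpan_insert ih.center_mem, ih.span_eq]
      rfl
    have hspan : columnSpan (run z (n + 1)).Q =
        (affineSpan ℝ (z '' Set.Iio (n + 1 + 1))).direction ∧
        affDim z (n + 1 + 1) = (run z (n + 1)).k := by
      rw [affDim, hdir, hstep]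
      by_cases h1 : 0 < (run z n).residual (z (n + 1)) ⬝ᵥ (run z n).residual (z (n + 1))
      · rw [Tracker.step, if_pos h1]
        refine ⟨Tracker.columnSpan_irregular ih.valid (ih.dim_lt h1) h1, ?_⟩
        rw [sup_comm, Submodule.finrank_sup_span_singleton
          ((Tracker.residual_pos_iff ih.valid).1 h1),
          ih.span_eq]
        exact congrArg (· + 1) ih.affDim_eq
      · have hr := Tracker.residual_eq_zero h1
        have hsup : ℝ ∙ (z (n + 1) - (run z n).rounding.center) ⊔ columnSpan (run z n).Q =
            columnSpan (run z n).Q := by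
          rw [sup_eq_right, Submodule.span_singleton_le_iff_mem]
          exact (Tracker.residual_eq_zero_iff ih.valid).1 hr
        rw [hsup]
        have hk : Module.finrank ℝ (columnSpan (run z n).Q) = (run z n).k := by
          rw [ih.span_eq]; exact ih.affDim_eq
        rw [Tracker.step, if_neg h1]
        split_ifs with h2
        · exact ⟨Tracker.columnSpan_regular ih.valid hr h2, hk⟩
        · exact ⟨rfl, hk⟩
    refine ⟨ih.valid.step fun h => ih.dim_lt h, hspan.1, hspan.2, ?_, ?_⟩
    · refine hmono.2.trans ?_
      rw [hull_succ z (n + 1)]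
      exact convexHull_mono (Set.union_subset_union_left _ ih.inner_subset)
    · rw [hull_succ z (n + 1)]
      exact (convexHull_mono (Set.union_subset_union_left _ ih.subset_outer)).trans hmono.1

/-- The run of the tracker is a run of the fully online algorithm. -/
lemma isFullyOnlineRun_of_run (z : ℕ → EuclideanSpace ℝ (Fin d)) {ρ : ℕ → Rounding d}
    (hρ : ∀ n, ρ (n + 1) = (run z n).rounding) : Rounding.IsFullyOnlineRun z ρ := by
  refine ⟨?_, ?_⟩
  · rw [show ρ 1 = (run z 0).rounding from hρ 0]
    refine ⟨rfl, ?_, rfl⟩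
    ext x
    rw [Rounding.mem_ellipsoid]
    simp only [run, Tracker.start, Tracker.rounding, map_zero, LinearMap.zero_apply,
      Set.mem_singleton_iff]
    exact ⟨fun ⟨_, _, h⟩ => h, fun h => ⟨0, by simp, h⟩⟩
  · intro t ht
    obtain ⟨n, rfl⟩ : ∃ n, t = n + 1 := ⟨t - 1, by omega⟩
    have hinv := runInvariant z n
    rw [hρ, hρ]
    refine ⟨fun h => ?_, fun _ => ?_⟩
    · rw [← hinv.residual_pos_iff] at h
      have : run z (n + 1) = (run z n).irregular (z (n + 1)) := by
        rw [run, Tracker.step, if_pos h]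
      rw [this]
      exact Tracker.isIrregularUpdate_irregular hinv.valid (hinv.dim_lt h)
    · exact Tracker.isMonotoneUpdate_step hinv.valid fun h => hinv.dim_lt h

end Span

/-! ## The volume potential -/

section Potential

open Matrix

variable {d : ℕ}

/-- The Gram matrix of the first `k` columns of `Q`, completed by `σ ^ 2` times the identity. -/
noncomputable def gram (Q : Matrix (Fin d) (Fin d) ℝ) (k : ℕ) (σ : ℝ) : Matrix (Fin d) (Fin d) ℝ :=
  Qᵀ * Q + σ ^ 2 • (1 - coordProj d k)

lemma coordProj_transpose (k : ℕ) : (coordProj d k)ᵀ = coordProj d k := diagonal_transpose _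

lemma coordProj_mul_self (k : ℕ) : coordProj d k * coordProj d k = coordProj d k :=
  (coordProj_mul_of_le le_rfl).1

lemma single_le_prod {ι : Type*} [DecidableEq ι] (s : Finset ι) (f : ι → ℝ) {i : ι} (hi : i ∈ s)
    (h0 : 0 ≤ f i) (h1 : ∀ j ∈ s, j ≠ i → 1 ≤ f j) : f i ≤ ∏ j ∈ s, f j := by
  rw [← Finset.mul_prod_erase s f hi]
  have : ∏ j ∈ s.erase i, (1 : ℝ) ≤ ∏ j ∈ s.erase i, f j :=
    Finset.prod_le_prod (fun _ _ => zero_le_one) fun j hj =>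
      h1 j (Finset.mem_of_mem_erase hj) (Finset.ne_of_mem_erase hj)
  rw [Finset.prod_const_one] at this
  exact le_mul_of_one_le_right h0 this

lemma det_one_add_vecMulVec (u v : Fin d → ℝ) : (1 + vecMulVec u v).det = 1 + v ⬝ᵥ u := by
  rw [← det_one_add_replicateCol_mul_replicateRow (ι := Unit)]
  congr 2
  ext i j
  simp [vecMulVec_apply, Matrix.mul_apply]

/-- The Gram matrix is conjugated by a symmetric `X` that stretches the first `k` coordinates and
fixes the others. Its determinant is `b ^ k * (a / b)`, which is at least `a` since `b ≥ 1` and `u ≠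
0` forces `k ≥ 1`. -/
lemma det_gram_stretch {Q W : Matrix (Fin d) (Fin d) ℝ} {k : ℕ} (hp : IsPseudoInverse Q W k)
    {a b σ : ℝ} (ha : 0 < a) (hb : 1 ≤ b) {u : Fin d → ℝ} (hu : coordProj d k *ᵥ u = u)
    (hν : u ⬝ᵥ u ≠ 0) :
    ∃ x, a ≤ x ∧ (gram (b • Q + ((a - b) / (u ⬝ᵥ u)) • vecMulVec (Q *ᵥ u) u) k σ).det =
      x ^ 2 * (gram Q k σ).det := by
  set P := coordProj d k with hP
  have hPP : P * P = P := coordProj_mul_self k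
  have hPT : Pᵀ = P := coordProj_transpose k
  set D : Matrix (Fin d) (Fin d) ℝ := diagonal fun i => if (i : ℕ) < k then b else 1 with hD
  have hDP : D = b • P + (1 - P) := by
    ext i j
    simp only [hD, hP, coordProj, Matrix.add_apply, Matrix.sub_apply, Matrix.smul_apply,
      diagonal_apply, Matrix.one_apply, smul_eq_mul]
    split_ifs <;> simp
  set f := (a - b) / (u ⬝ᵥ u) with hf
  set X := D * (1 + (f / b) • vecMulVec u u) with hX
  have hb0 : b ≠ 0 := by linarith
  have hDu : D *ᵥ u = b • u := by
    rw [hDP, add_mulVec, sub_mulVec, smul_mulVec, hu, one_mulVec, sub_self, add_zero]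
  have hXeq : X = D + f • vecMulVec u u := by
    rw [hX, Matrix.mul_add, Matrix.mul_one, Matrix.mul_smul, mul_vecMulVec, hDu, smul_vecMulVec,
      smul_smul, div_mul_cancel₀ _ hb0]
  have hXT : Xᵀ = X := by
    rw [hXeq, transpose_add, transpose_smul, transpose_vecMulVec, hD, diagonal_transpose]
  have hQD : Q * D = b • Q := by
    rw [hDP, Matrix.mul_add, Matrix.mul_sub, Matrix.mul_smul, hp.mul_proj, Matrix.mul_one,
      sub_self, add_zero]
  have hQX : Q * X = b • Q + f • vecMulVec (Q *ᵥ u) u := by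
    rw [hXeq, Matrix.mul_add, hQD, Matrix.mul_smul, mul_vecMulVec]
  have hPX : (1 - P) * X = 1 - P := by
    have h1 : (1 - P) * P = 0 := by rw [Matrix.sub_mul, hPP, Matrix.one_mul, sub_self]
    have h2 : (1 - P) *ᵥ u = 0 := by rw [sub_mulVec, hu, one_mulVec, sub_self]
    have h3 : (1 - P) * (1 - P) = 1 - P := by rw [Matrix.mul_sub, h1, Matrix.mul_one, sub_zero]
    rw [hXeq, hDP, Matrix.mul_add, Matrix.mul_add, Matrix.mul_smul, Matrix.mul_smul, h1, h3,
      mul_vecMulVec, h2]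
    simp
  have hXP : X * (1 - P) = 1 - P := by
    have := congrArg transpose hPX
    rwa [transpose_mul, hXT, transpose_sub, transpose_one, hPT] at this
  have hG : gram (b • Q + f • vecMulVec (Q *ᵥ u) u) k σ = X * gram Q k σ * X := by
    rw [gram, gram, ← hQX, Matrix.mul_add, Matrix.add_mul, Matrix.mul_smul, Matrix.smul_mul, hXP,
      hPX, transpose_mul, hXT]
    simp only [Matrix.mul_assoc, hP]
  refine ⟨X.det, ?_, by rw [hG, det_mul, det_mul]; ring⟩
  have hex : ∃ i, u i ≠ 0 := by
    by_contra hcon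
    push Not at hcon
    exact hν (by simp [dotProduct, hcon])
  obtain ⟨i, hi⟩ := hex
  have hik : (i : ℕ) < k := by
    by_contra hcon
    apply hi
    rw [← hu, hP, coordProj_mulVec, if_neg hcon]
  have hdet : X.det = (∏ j : Fin d, if (j : ℕ) < k then b else 1) * (a / b) := by
    rw [hX, det_mul, hD, det_diagonal, ← smul_vecMulVec, det_one_add_vecMulVec, dotProduct_smul,
      hf, smul_eq_mul]
    congr 1
    field_simp
    ring
  rw [hdet]
  have := single_le_prod Finset.univ (fun j : Fin d => if (j : ℕ) < k then b else 1)
    (Finset.mem_univ i) (by simp only [hik, if_true]; linarith)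
    (fun j _ _ => by split_ifs <;> linarith)
  simp only [hik, if_true] at this
  calc a = b * (a / b) := by field_simp
    _ ≤ _ := by gcongr

/-- The part `Q *ᵥ u` of `v` is a shear by old columns and does not affect the determinant. What
remains is a diagonal factor: `ρ ≥ 1` on the old columns, and the ratio of the new orthogonal column
to the placeholder `σ`. -/
lemma det_gram_extend {Q W : Matrix (Fin d) (Fin d) ℝ} {k : ℕ} (hp : IsPseudoInverse Q W k)
    (hk : k < d) {ρ h σ : ℝ} (hρ : 1 ≤ ρ) (hh : 0 < h) (hσ : 0 < σ) {v u w : Fin d → ℝ}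
    (hu : u = W *ᵥ v) (hw : w = v - Q *ᵥ u) :
    ∃ x, ρ * √(w ⬝ᵥ w) / (h * σ) ≤ x ∧
      (gram (ρ • Q + (ρ / h) • vecMulVec v (basisVec d k)) (k + 1) σ).det =
        x ^ 2 * (gram Q k σ).det := by
  set e := basisVec d k with he
  set φ := ρ * √(w ⬝ᵥ w) / (h * σ) with hφ
  have hww : 0 ≤ w ⬝ᵥ w := by
    rw [← WithLp.ofLp_toLp 2 w, ← norm_sq_eq_dotProduct]; positivity
  have hφ2 : σ ^ 2 * φ ^ 2 = (ρ / h) ^ 2 * (w ⬝ᵥ w) := by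
    rw [hφ, div_pow, mul_pow, Real.sq_sqrt hww]; field_simp
  -- `F` holds the diagonal factors and `N` the unipotent shear. `φ` is such that `σ * φ` is the
  -- length of `(ρ / h) • w`.
  set F : Matrix (Fin d) (Fin d) ℝ :=
    diagonal fun i => if (i : ℕ) < k then ρ else if (i : ℕ) = k then φ else 1 with hF
  set N : Matrix (Fin d) (Fin d) ℝ := 1 + (1 / h) • vecMulVec u e with hN
  clear_value N
  have heu : e ⬝ᵥ u = 0 := by
    rw [basisVec_dotProduct hk, hu]; exact hp.coord_apply_of_le v le_rfl
  have hwQ : w ᵥ* Q = 0 := by rw [hw, hu]; exact hp.residual_vecMul v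
  have hPu : coordProj d (k + 1) *ᵥ u = u := by
    rw [hu, ← hp.proj_coord, mulVec_mulVec, (coordProj_mul_of_le (Nat.le_succ k)).1]
  have hFT : Fᵀ = F := by rw [hF, diagonal_transpose]
  have hQF : Q * F = ρ • Q := by
    have hPF : coordProj d k * F = ρ • coordProj d k := by
      rw [hF, coordProj, diagonal_mul_diagonal]
      ext i j
      simp only [diagonal_apply, Matrix.smul_apply, smul_eq_mul]
      split_ifs <;> simp
    rw [← hp.mul_proj, Matrix.mul_assoc, hPF, Matrix.mul_smul]
  have hFPF : F * (1 - coordProj d k) * F =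
      φ ^ 2 • vecMulVec e e + (1 - coordProj d (k + 1)) := by
    have h1 : (1 - coordProj d k : Matrix (Fin d) (Fin d) ℝ) =
        diagonal fun i : Fin d => if (i : ℕ) < k then 0 else 1 := by
      ext i j
      simp only [coordProj, Matrix.sub_apply, diagonal_apply, Matrix.one_apply]
      split_ifs <;> simp
    rw [h1, hF, diagonal_mul_diagonal, diagonal_mul_diagonal]
    ext i j
    simp only [coordProj, Matrix.sub_apply, diagonal_apply, Matrix.one_apply, Matrix.add_apply,
      Matrix.smul_apply, vecMulVec_apply, he, basisVec, smul_eq_mul, Fin.ext_iff]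
    split_ifs <;> first | omega | (simp; try ring)
  have hNe : Nᵀ * vecMulVec e e * N = vecMulVec e e := by
    have : e ᵥ* N = e := by
      rw [hN, vecMul_add, vecMul_one, vecMul_smul, vecMul_vecMulVec, heu]; simp
    rw [mul_vecMulVec, vecMulVec_mul, mulVec_transpose, this]
  have hPN : (1 - coordProj d (k + 1)) * N = 1 - coordProj d (k + 1) := by
    rw [hN, Matrix.mul_add, Matrix.mul_one, Matrix.mul_smul, mul_vecMulVec, sub_mulVec, hPu,
      one_mulVec, sub_self]
    simp
  have hNP : Nᵀ * (1 - coordProj d (k + 1)) = 1 - coordProj d (k + 1) := by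
    have := congrArg transpose hPN
    rwa [transpose_mul, transpose_sub, transpose_one, coordProj_transpose] at this
  have hQ' : ρ • Q + (ρ / h) • vecMulVec v e = ρ • (Q * N) + (ρ / h) • vecMulVec w e := by
    rw [hN, Matrix.mul_add, Matrix.mul_one, Matrix.mul_smul, mul_vecMulVec, hw]
    ext i j
    simp only [Matrix.add_apply, Matrix.smul_apply, vecMulVec_apply, Pi.sub_apply, smul_eq_mul]
    ring
  have hcross : vecMulVec e w * (Q * N) = 0 := by
    rw [vecMulVec_mul, ← vecMul_vecMul, hwQ, zero_vecMul, vecMulVec_zero]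
  have hcross' : (Q * N)ᵀ * vecMulVec w e = 0 := by
    have := congrArg transpose hcross
    rwa [transpose_mul, transpose_vecMulVec, transpose_zero] at this
  have hG : gram (ρ • Q + (ρ / h) • vecMulVec v e) (k + 1) σ = (F * N)ᵀ * gram Q k σ * (F * N) := by
    have h1 : (F * N)ᵀ * (Qᵀ * Q) * (F * N) = ρ ^ 2 • ((Q * N)ᵀ * (Q * N)) := by
      have : Q * (F * N) = ρ • (Q * N) := by
        rw [← Matrix.mul_assoc, hQF, Matrix.smul_mul]
      calc (F * N)ᵀ * (Qᵀ * Q) * (F * N) = (Q * (F * N))ᵀ * (Q * (F * N)) := by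
            rw [transpose_mul Q]; simp only [Matrix.mul_assoc]
        _ = _ := by
          rw [this, transpose_smul, Matrix.smul_mul, Matrix.mul_smul, smul_smul, sq]
    have h2 : (F * N)ᵀ * (1 - coordProj d k) * (F * N) =
        φ ^ 2 • vecMulVec e e + (1 - coordProj d (k + 1)) := by
      calc (F * N)ᵀ * (1 - coordProj d k) * (F * N) =
          Nᵀ * (F * (1 - coordProj d k) * F) * N := by
            rw [transpose_mul, hFT]; simp only [Matrix.mul_assoc]
        _ = _ := by
          rw [hFPF, Matrix.mul_add, Matrix.add_mul, Matrix.mul_smul, Matrix.smul_mul, hNe, hNP,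
            hPN]
    have h3 : (F * N)ᵀ * gram Q k σ * (F * N) = (F * N)ᵀ * (Qᵀ * Q) * (F * N) +
        σ ^ 2 • ((F * N)ᵀ * (1 - coordProj d k) * (F * N)) := by
      rw [gram, Matrix.mul_add, Matrix.add_mul, Matrix.mul_smul, Matrix.smul_mul]
    rw [h3, h1, h2, gram, hQ', transpose_add, transpose_smul, transpose_smul, transpose_vecMulVec]
    simp only [Matrix.add_mul, Matrix.mul_add, Matrix.smul_mul, Matrix.mul_smul, hcross, hcross',
      vecMulVec_mul_vecMulVec, smul_add, smul_smul, smul_zero, add_zero, zero_add, hφ2]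
    ext i j
    simp only [Matrix.add_apply, Matrix.smul_apply, vecMulVec_apply, smul_eq_mul, Pi.smul_apply]
    ring
  refine ⟨(F * N).det, ?_, by rw [hG, det_mul, det_mul, det_transpose]; ring⟩
  have hdetN : N.det = 1 := by
    rw [hN, ← smul_vecMulVec, det_one_add_vecMulVec, dotProduct_smul, heu]; simp
  rw [det_mul, hdetN, mul_one, hF, det_diagonal]
  have := single_le_prod Finset.univ
    (fun i : Fin d => if (i : ℕ) < k then ρ else if (i : ℕ) = k then φ else 1)
    (Finset.mem_univ ⟨k, hk⟩) (by simp; positivity)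
    (fun j _ hj => by
      have : (j : ℕ) ≠ k := fun h => hj (Fin.ext h)
      simp only [this, if_false]
      split_ifs <;> linarith)
  simpa using this

/-- The quadratic form at `x` is `‖Q x‖ ^ 2 + σ ^ 2 * (‖x‖ ^ 2 - ‖P x‖ ^ 2)` with `P` the coordinate
projection. As `Q x = Q (P x)`, all eigenvalues lie in `[0, σ ^ 2]`. -/
lemma det_gram_le {Q W : Matrix (Fin d) (Fin d) ℝ} {k : ℕ} (hp : IsPseudoInverse Q W k) {σ : ℝ}
    (h : ∀ x : EuclideanSpace ℝ (Fin d), ‖toEuclideanLin Q x‖ ≤ σ * ‖x‖) :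
    (gram Q k σ).det ≤ (σ ^ 2) ^ d := by
  have hH : (gram Q k σ).IsHermitian := by
    rw [IsHermitian, conjTranspose_eq_transpose_of_trivial, gram, transpose_add, transpose_mul,
      transpose_transpose, transpose_smul, transpose_sub, transpose_one, coordProj_transpose]
  rw [hH.det_eq_prod_eigenvalues]
  have hquad : ∀ x : EuclideanSpace ℝ (Fin d), x.ofLp ⬝ᵥ (gram Q k σ *ᵥ x.ofLp) =
      ‖toEuclideanLin Q x‖ ^ 2 + σ ^ 2 * (‖x‖ ^ 2 - ‖toEuclideanLin (coordProj d k) x‖ ^ 2) := by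
    intro x
    have h1 : ‖toEuclideanLin (coordProj d k) x‖ ^ 2 = x.ofLp ⬝ᵥ (coordProj d k *ᵥ x.ofLp) := by
      rw [norm_sq_eq_dotProduct]
      change (coordProj d k *ᵥ x.ofLp) ⬝ᵥ (coordProj d k *ᵥ x.ofLp) = _
      rw [dotProduct_mulVec, ← mulVec_transpose, coordProj_transpose, mulVec_mulVec,
        coordProj_mul_self, dotProduct_comm]
    have h2 : ‖toEuclideanLin Q x‖ ^ 2 = x.ofLp ⬝ᵥ ((Qᵀ * Q) *ᵥ x.ofLp) := by
      rw [norm_sq_eq_dotProduct]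
      change (Q *ᵥ x.ofLp) ⬝ᵥ (Q *ᵥ x.ofLp) = _
      rw [dotProduct_mulVec, ← mulVec_transpose, mulVec_mulVec, dotProduct_comm]
    rw [h1, h2, norm_sq_eq_dotProduct, gram, add_mulVec, smul_mulVec, sub_mulVec, one_mulVec,
      dotProduct_add, dotProduct_smul, dotProduct_sub, smul_eq_mul]
  have hQP : ∀ x, toEuclideanLin Q x = toEuclideanLin Q (toEuclideanLin (coordProj d k) x) := by
    intro x
    rw [toEuclideanLin_eq, toEuclideanLin_eq, toEuclideanLin_eq]
    simp only [mulVec_mulVec, hp.mul_proj]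
  have hPle : ∀ x : EuclideanSpace ℝ (Fin d),
      ‖toEuclideanLin (coordProj d k) x‖ ^ 2 ≤ ‖x‖ ^ 2 := by
    intro x
    rw [EuclideanSpace.real_norm_sq_eq, EuclideanSpace.real_norm_sq_eq]
    refine Finset.sum_le_sum fun i _ => ?_
    change (coordProj d k *ᵥ x.ofLp) i ^ 2 ≤ _
    rw [coordProj_mulVec]
    split_ifs
    · exact le_rfl
    · rw [zero_pow two_ne_zero]; positivity
  have heig : ∀ i, 0 ≤ hH.eigenvalues i ∧ hH.eigenvalues i ≤ σ ^ 2 := by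
    intro i
    have h1 := hH.eigenvalues_eq i
    have hn : ‖hH.eigenvectorBasis i‖ = 1 := hH.eigenvectorBasis.orthonormal.1 i
    simp only [star_trivial, RCLike.re_to_real] at h1
    rw [h1, hquad, hn]
    have h2 := hPle (hH.eigenvectorBasis i)
    rw [hn] at h2
    refine ⟨by nlinarith [sq_nonneg σ, sq_nonneg ‖toEuclideanLin Q (hH.eigenvectorBasis i)‖], ?_⟩
    have h3 := h (toEuclideanLin (coordProj d k) (hH.eigenvectorBasis i))
    rw [← hQP] at h3
    have h4 := pow_le_pow_left₀ (norm_nonneg _) h3 2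
    nlinarith
  calc ∏ i, ((hH.eigenvalues i : ℝ)) ≤ ∏ i : Fin d, σ ^ 2 :=
        Finset.prod_le_prod (fun i _ => (heig i).1) fun i _ => (heig i).2
    _ = _ := by simp

/-- With `y = (D + 1) / 2`, `growth D` equals `2 * (1 - 1 / y)`, and `1 - 1 / y ≤ log y`. -/
lemma growth_le_log {D a : ℝ} (hD : 1 < D) (ha : 1 + (D - 1) / 2 ≤ a) :
    growth D ≤ 2 * Real.log a := by
  have h1 : 0 < 1 + (D - 1) / 2 := by linarith
  have h2 := Real.one_sub_inv_le_log_of_pos h1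
  have h3 := Real.log_le_log h1 ha
  have h4 : growth D = 2 * (1 - (1 + (D - 1) / 2)⁻¹) := by
    unfold growth
    have : D + 1 ≠ 0 := by linarith
    have h5 : 1 + (D - 1) / 2 = (D + 1) / 2 := by ring
    rw [h5, inv_div]; field_simp; ring
  linarith

/-- The approximation factor is bounded in terms of the volume potential. -/
lemma inv_scale_le_potential (z : ℕ → EuclideanSpace ℝ (Fin d)) {σ r : ℝ} (hσ : 0 < σ)
    (hr : 0 < r) (n : ℕ)
    (hres : ∀ m < n, 0 < (run z m).residual (z (m + 1)) ⬝ᵥ (run z m).residual (z (m + 1)) →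
      2 * r ≤ √((run z m).residual (z (m + 1)) ⬝ᵥ (run z m).residual (z (m + 1)))) :
    0 < (gram (run z n).Q (run z n).k σ).det ∧
    1 / (run z n).α ≤ 1 + (run z n).k + Real.log (gram (run z n).Q (run z n).k σ).det -
      2 * d * Real.log σ + 2 * (run z n).k * Real.log (σ / r) := by
  induction n with
  | zero =>
    have hG : gram (run z 0).Q (run z 0).k σ = σ ^ 2 • 1 := by
      simp [run, Tracker.start, gram, coordProj]
    have hdet : (gram (run z 0).Q (run z 0).k σ).det = (σ ^ 2) ^ d := by
      rw [hG, det_smul, det_one]; simp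
    rw [hdet]
    refine ⟨by positivity, ?_⟩
    rw [← pow_mul, Real.log_pow]
    simp [run, Tracker.start]
  | succ n ih =>
    obtain ⟨hpos, hle⟩ := ih fun m hm => hres m (by omega)
    have hinv := runInvariant z n
    have hτ := hinv.valid
    have hαpos := hτ.scale_pos
    rw [run]
    unfold Tracker.step
    split_ifs with h1 h2
    · obtain ⟨g1, g2, g3, g4⟩ := Tracker.irregular_scalars hτ.scale_pos
      have hw := hres n (by omega) h1
      have hkd := hinv.dim_lt h1
      generalize run z n = τ at *
      have hρ1 : 1 ≤ (1 + τ.α) / √(1 + 2 * τ.α) := by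
        rw [← one_le_sq_iff₀ g3.le, g4, one_le_div (by positivity)]
        nlinarith
      obtain ⟨x, hx, hdet⟩ := det_gram_extend hτ.inv hkd hρ1 g1 hσ
        (v := τ.offset (z (n + 1))) rfl rfl
      have hdet' : (gram (τ.irregular (z (n + 1))).Q (τ.irregular (z (n + 1))).k σ).det =
        x ^ 2 * (gram τ.Q τ.k σ).det := hdet
      -- The ratio of the two scalars is `(1 + α) / (1 + 2 * α) ≥ 1 / 2`, which uses up the factor
      -- `2` in `2 * r ≤ ‖w‖`.
      have hxr : r / σ ≤ x := by
        refine le_trans ?_ hx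
        have e1 : (1 + τ.α) / √(1 + 2 * τ.α) * √(τ.residual (z (n + 1)) ⬝ᵥ
            τ.residual (z (n + 1))) / (√(1 + 2 * τ.α) * σ) = ((1 + τ.α) / (1 + 2 * τ.α) *
            √(τ.residual (z (n + 1)) ⬝ᵥ τ.residual (z (n + 1)))) / σ := by
          conv_rhs => rw [← g2]
          field_simp
        refine le_trans ?_ e1.ge
        gcongr
        have e2 : 1 / 2 ≤ (1 + τ.α) / (1 + 2 * τ.α) := by
          rw [div_le_div_iff₀ (by norm_num) (by positivity)]; linarith
        nlinarith
      have hx0 : 0 < r / σ := by positivity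
      -- The unit increase of `1 / α` is paid by `k`, and the possible loss `2 * log (σ / r)` in the
      -- determinant by the last term of the bound.
      rw [hdet']
      have hx1 : 0 < x := by linarith
      refine ⟨by positivity, ?_⟩
      rw [Real.log_mul (by positivity) hpos.ne', Real.log_pow]
      have e3 := Real.log_le_log hx0 hxr
      have e4 : Real.log (r / σ) = - Real.log (σ / r) := by rw [← Real.log_inv, inv_div]
      have e5 : 1 / (τ.irregular (z (n + 1))).α = 1 / τ.α + 1 := by
        simp only [Tracker.irregular]; field_simp
      have e6 : ((τ.irregular (z (n + 1))).k : ℝ) = τ.k + 1 := by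
        simp only [Tracker.irregular]; push_cast; ring
      rw [e5, e6]
      push_cast
      nlinarith
    · have hr0 := Tracker.residual_eq_zero h1
      generalize run z n = τ at *
      obtain ⟨hA, hD⟩ := Tracker.regular_scalars hτ h2
      obtain ⟨g0, g1, g2, g3, g4, g5, g6, g7, g8⟩ := update_admissible hA hD
      set D := √(τ.coord (z (n + 1)) ⬝ᵥ τ.coord (z (n + 1))) with hDdef
      set a := axisLong (1 / τ.α) (1 / τ.α + growth D) (1 / τ.α * D) with hadef
      have ha1 : 1 < a := by linarith
      obtain ⟨x, hx, hdet⟩ := det_gram_stretch (σ := σ) hτ.inv (a := a)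
        (b := √(axisShortSq (1 / τ.α) (1 / τ.α + growth D) (1 / τ.α * D))) (by linarith)
        (by rw [Real.one_le_sqrt]; exact g4.le) (u := τ.coord (z (n + 1)))
        (hτ.inv.proj_coord _) (by linarith)
      rw [← Tracker.offset_eq_mulVec_coord hr0] at hdet
      have hdet' : (gram (τ.regular (z (n + 1))).Q (τ.regular (z (n + 1))).k σ).det =
        x ^ 2 * (gram τ.Q τ.k σ).det := hdet
      rw [hdet']
      have hx1 : 0 < x := by linarith
      refine ⟨by positivity, ?_⟩
      rw [Real.log_mul (by positivity) hpos.ne', Real.log_pow]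
      have e3 := Real.log_le_log (by linarith) hx
      have e4 := growth_le_log hD g3
      have e5 : 1 / (τ.regular (z (n + 1))).α = 1 / τ.α + growth D := by
        simp only [Tracker.regular, one_div_one_div]; rfl
      have e6 : (τ.regular (z (n + 1))).k = τ.k := rfl
      rw [e5, e6]
      push_cast
      linarith
    · exact ⟨hpos, hle⟩

end Potential

/-! ## The approximation factor in terms of the stream -/

section Approximation

open Matrix
open scoped RealInnerProductSpace

variable {d : ℕ}

lemma isBounded_hull (z : ℕ → EuclideanSpace ℝ (Fin d)) (t : ℕ) :
    Bornology.IsBounded (hull z t) :=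
  (((Set.finite_Iio t).image z).isCompact_convexHull ℝ).isBounded

lemma hull_mono (z : ℕ → EuclideanSpace ℝ (Fin d)) {s t : ℕ} (h : s ≤ t) : hull z s ⊆ hull z t :=
  convexHull_mono (Set.image_mono (Set.Iio_subset_Iio h))

lemma le_circumradius (z : ℕ → EuclideanSpace ℝ (Fin d)) (t : ℕ) {r : ℝ}
    (h : ∀ (c : EuclideanSpace ℝ (Fin d)) (R : ℝ), 0 ≤ R → hull z t ⊆ Metric.closedBall c R →
      r ≤ R) : r ≤ circumradius (hull z t) := by
  -- A bounded hull makes the set of radii nonempty; the infimum of the empty set would default to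
  -- `0`.
  refine le_csInf ?_ fun R hR => ?_
  · obtain ⟨R, hR⟩ := (isBounded_hull z t).subset_closedBall 0
    exact ⟨max R 0, le_max_right _ _, 0,
      hR.trans (Metric.closedBall_subset_closedBall (le_max_left _ _))⟩
  · obtain ⟨hR0, c, hc⟩ := hR
    exact h c R hR0 hc

lemma norm_le_of_add_sub_mem_closedBall {E : Type*} [NormedAddCommGroup E] [NormedSpace ℝ E]
    {c x v : E} {R : ℝ} (h1 : x + v ∈ Metric.closedBall c R) (h2 : x - v ∈ Metric.closedBall c R) :
    ‖v‖ ≤ R := by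
  rw [mem_closedBall_iff_norm] at h1 h2
  have h3 : (2 : ℝ) • v = (x + v - c) - (x - v - c) := by module
  have h4 : ‖(2 : ℝ) • v‖ ≤ R + R := by
    rw [h3]; exact (norm_sub_le _ _).trans (add_le_add h1 h2)
  rw [norm_smul, Real.norm_of_nonneg (by norm_num)] at h4
  linarith

lemma norm_smul_shape_le_circumradius {z : ℕ → EuclideanSpace ℝ (Fin d)} {n : ℕ}
    (h : RunInvariant z n) (u : EuclideanSpace ℝ (Fin d)) :
    (run z n).α * ‖toEuclideanLin (run z n).Q u‖ ≤ circumradius (hull z (n + 1)) * ‖u‖ := by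
  rcases eq_or_ne u 0 with rfl | hu
  · simp
  have hu0 : 0 < ‖u‖ := norm_pos_iff.2 hu
  rw [← div_le_iff₀ hu0]
  refine le_circumradius z _ fun c R _ hR => ?_
  have hmem : ∀ e : EuclideanSpace ℝ (Fin d), ‖e‖ ≤ 1 →
      (run z n).rounding.center + (run z n).α • toEuclideanLin (run z n).Q e ∈
        Metric.closedBall c R :=
    fun e he => hR (h.inner_subset (Rounding.mem_inner.2 ⟨e, he, rfl⟩))
  have hn : ‖‖u‖⁻¹ • u‖ ≤ 1 := by
    rw [norm_smul, norm_inv, norm_norm, inv_mul_cancel₀ hu0.ne']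
  have h1 := hmem _ hn
  have h2 := hmem (-(‖u‖⁻¹ • u)) (by rwa [norm_neg])
  rw [map_neg, smul_neg, ← sub_eq_add_neg] at h2
  have h3 := norm_le_of_add_sub_mem_closedBall h1 h2
  rw [map_smul, norm_smul, norm_smul, norm_inv, norm_norm,
    Real.norm_of_nonneg h.valid.scale_pos.le] at h3
  refine le_trans (le_of_eq ?_) h3
  field_simp

/-- The radii of the relative balls in a set. -/
def inradii (K : Set (EuclideanSpace ℝ (Fin d))) : Set ℝ :=
  {r | 0 ≤ r ∧ ∃ c : EuclideanSpace ℝ (Fin d),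
    ∀ v ∈ Submodule.span ℝ ((fun x => x - c) '' K), ‖v‖ ≤ r → c + v ∈ K}

/-- The centers of relative balls lie in the hull, so the space of admissible directions does not
depend on the center. -/
lemma span_sub_hull (z : ℕ → EuclideanSpace ℝ (Fin d)) (t : ℕ) {c : EuclideanSpace ℝ (Fin d)}
    (hc : c ∈ hull z t) : Submodule.span ℝ ((fun x => x - c) '' hull z t) =
      (affineSpan ℝ (z '' Set.Iio t)).direction := by
  rw [← affineSpan_convexHull, direction_affineSpan]
  exact (vectorSpan_eq_span_vsub_set_right ℝ hc).symm

/-- A relative ball in the hull contains antipodal points in each direction of the span. -/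
lemma add_sub_mem_hull_of_mem_inradii {z : ℕ → EuclideanSpace ℝ (Fin d)} {t : ℕ} {r : ℝ}
    (hr : r ∈ inradii (hull z t)) {w : EuclideanSpace ℝ (Fin d)}
    (hw : w ∈ (affineSpan ℝ (z '' Set.Iio t)).direction) (hw0 : w ≠ 0) :
    ∃ c, c + (r / ‖w‖) • w ∈ hull z t ∧ c - (r / ‖w‖) • w ∈ hull z t := by
  obtain ⟨hr0, c, hc⟩ := hr
  have hcK : c ∈ hull z t := by simpa using hc 0 (Submodule.zero_mem _) (by simpa using hr0)
  rw [span_sub_hull z t hcK] at hc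
  have hn : ‖(r / ‖w‖) • w‖ ≤ r := by
    rw [norm_smul, norm_div, norm_norm, Real.norm_of_nonneg hr0,
      div_mul_cancel₀ _ (norm_ne_zero_iff.2 hw0)]
  refine ⟨c, hc _ (Submodule.smul_mem _ _ hw) hn, ?_⟩
  rw [sub_eq_add_neg]
  exact hc _ (Submodule.neg_mem _ (Submodule.smul_mem _ _ hw)) (by rwa [norm_neg])

lemma inradius_le {z : ℕ → EuclideanSpace ℝ (Fin d)} {t : ℕ} (ht : 1 ≤ t) {M : ℝ}
    (h : ∀ r ∈ inradii (hull z t), r ≤ M) : inradius (hull z t) ≤ M := by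
  refine csSup_le ⟨0, le_rfl, z 0, fun v _ hv => ?_⟩ h
  rw [norm_le_zero_iff.1 hv, add_zero]
  exact subset_convexHull ℝ _ ⟨0, by simp; omega, rfl⟩

section IrregularStep

variable {z : ℕ → EuclideanSpace ℝ (Fin d)} {m : ℕ}

lemma residual_mem_direction
    (hm : 0 < (run z m).residual (z (m + 1)) ⬝ᵥ (run z m).residual (z (m + 1))) :
    WithLp.toLp 2 ((run z m).residual (z (m + 1))) ∈
      (affineSpan ℝ (z '' Set.Iio (m + 2))).direction := by
  have h1 := runInvariant z m
  have h2 := runInvariant z (m + 1)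
  rw [show m + 2 = m + 1 + 1 from rfl, ← h2.span_eq, run, Tracker.step, if_pos hm,
    Tracker.columnSpan_irregular h1.valid (h1.dim_lt hm) hm]
  have : WithLp.toLp 2 ((run z m).residual (z (m + 1))) =
      (z (m + 1) - (run z m).rounding.center) -
        WithLp.toLp 2 ((run z m).Q *ᵥ (run z m).coord (z (m + 1))) := by
    rw [← Tracker.offset_eq, ← WithLp.toLp_sub]; rfl
  rw [this]
  exact Submodule.sub_mem _ (Submodule.mem_sup_left (Submodule.mem_span_singleton_self _))
    (Submodule.mem_sup_right (mem_columnSpan.2 ⟨_, rfl⟩))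

lemma residual_ne_zero
    (hm : 0 < (run z m).residual (z (m + 1)) ⬝ᵥ (run z m).residual (z (m + 1))) :
    WithLp.toLp 2 ((run z m).residual (z (m + 1))) ≠ 0 := by
  intro h
  rw [← WithLp.ofLp_toLp 2 ((run z m).residual (z (m + 1))), h] at hm
  simp at hm

/-- The old points lie in a hyperplane orthogonal to the residual `w`, and the new point has
distance `‖w‖` from it. The hull is thus confined to a strip of width `‖w‖`, which must contain a
diameter of the relative ball in the direction `w`. -/
lemma two_mul_le_norm_residual
    (hm : 0 < (run z m).residual (z (m + 1)) ⬝ᵥ (run z m).residual (z (m + 1)))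
    {r : ℝ} (hr : r ∈ inradii (hull z (m + 2))) :
    2 * r ≤ √((run z m).residual (z (m + 1)) ⬝ᵥ (run z m).residual (z (m + 1))) := by
  have hinv := runInvariant z m
  set w : EuclideanSpace ℝ (Fin d) := WithLp.toLp 2 ((run z m).residual (z (m + 1))) with hw
  have hw0 : w ≠ 0 := residual_ne_zero hm
  have hww : (run z m).residual (z (m + 1)) ⬝ᵥ (run z m).residual (z (m + 1)) = ‖w‖ ^ 2 :=
    (norm_sq_eq_dotProduct w).symm
  rw [hww, Real.sqrt_sq (norm_nonneg _)]
  have hinner : ∀ x : EuclideanSpace ℝ (Fin d),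
      ⟪w, x⟫ = (run z m).residual (z (m + 1)) ⬝ᵥ x.ofLp := by
    intro x
    rw [EuclideanSpace.inner_eq_star_dotProduct, star_trivial, dotProduct_comm]
  set p := (run z m).rounding.center with hp
  have hstrip : hull z (m + 2) ⊆ {x | ⟪w, p⟫ ≤ ⟪w, x⟫} ∩ {x | ⟪w, x⟫ ≤ ⟪w, p⟫ + ‖w‖ ^ 2} := by
    refine convexHull_min ?_ ((convex_halfSpace_ge (innerₛₗ ℝ w).isLinear _).inter
      (convex_halfSpace_le (innerₛₗ ℝ w).isLinear _))
    rintro _ ⟨i, hi, rfl⟩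
    have hsub : ⟪w, z i⟫ = ⟪w, p⟫ + ⟪w, z i - p⟫ := by rw [inner_sub_right]; ring
    simp only [Set.mem_inter_iff, Set.mem_ofPred_eq, hsub]
    rcases Nat.lt_succ_iff_lt_or_eq.1 (show i < m + 1 + 1 from hi) with h | rfl
    · have hcol : z i - p ∈ columnSpan (run z m).Q := by
        rw [hinv.span_eq]
        exact AffineSubspace.vsub_mem_direction
          (subset_affineSpan ℝ _ ⟨i, h, rfl⟩) hinv.center_mem
      obtain ⟨y, hy⟩ := mem_columnSpan.1 hcol
      have : ⟪w, z i - p⟫ = 0 := by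
        rw [hinner, ← hy]
        exact hinv.valid.inv.residual_dotProduct_mulVec _ _
      rw [this]
      constructor <;> nlinarith [sq_nonneg ‖w‖]
    · have : ⟪w, z (m + 1) - p⟫ = ‖w‖ ^ 2 := by
        rw [hinner, ← hww]
        exact hinv.valid.inv.residual_dotProduct _
      rw [this]
      constructor <;> nlinarith [sq_nonneg ‖w‖]
  obtain ⟨c, h1, h2⟩ := add_sub_mem_hull_of_mem_inradii hr (residual_mem_direction hm) hw0
  have h3 := (hstrip h1).2
  have h4 := (hstrip h2).1
  have hwpos : 0 < ‖w‖ := norm_pos_iff.2 hw0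
  simp only [Set.mem_ofPred_eq, inner_add_right, inner_sub_right] at h3 h4
  have h5 : ⟪w, (r / ‖w‖) • w⟫ = r * ‖w‖ := by
    rw [inner_smul_right, real_inner_self_eq_norm_sq]; field_simp
  change ⟪w, c⟫ + ⟪w, (r / ‖w‖) • w⟫ ≤ _ at h3
  change _ ≤ ⟪w, c⟫ - ⟪w, (r / ‖w‖) • w⟫ at h4
  rw [h5] at h3 h4
  have h6 : 2 * r * ‖w‖ ≤ ‖w‖ * ‖w‖ := by nlinarith
  exact le_of_mul_le_mul_right h6 hwpos

lemma inradius_le_circumradius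
    (hm : 0 < (run z m).residual (z (m + 1)) ⬝ᵥ (run z m).residual (z (m + 1)))
    {t : ℕ} (ht : m + 2 ≤ t) : inradius (hull z (m + 2)) ≤ circumradius (hull z t) := by
  refine inradius_le (by omega) fun r hr => le_circumradius z t fun c' R _ hR => ?_
  have hw0 := residual_ne_zero hm
  obtain ⟨c, h1, h2⟩ := add_sub_mem_hull_of_mem_inradii hr (residual_mem_direction hm) hw0
  have h3 := norm_le_of_add_sub_mem_closedBall (hR (hull_mono z ht h1)) (hR (hull_mono z ht h2))
  rwa [norm_smul, norm_div, norm_norm, Real.norm_of_nonneg hr.1,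
    div_mul_cancel₀ _ (norm_ne_zero_iff.2 hw0)] at h3

/-- The inner ellipsoid contains a relative ball about the center: on the column space `v = Q (W
v)`, and `‖W v‖ ≤ α` once `‖v‖ ≤ α / (M + 1)`. The `+ 1` avoids a separate discussion of `M = 0`. -/
lemma inradius_pos
    (hm : 0 < (run z m).residual (z (m + 1)) ⬝ᵥ (run z m).residual (z (m + 1))) :
    0 < inradius (hull z (m + 2)) := by
  have h := runInvariant z (m + 1)
  set τ := run z (m + 1) with hτ
  have hα := h.valid.scale_pos
  set M := ‖LinearMap.toContinuousLinearMap (toEuclideanLin τ.W)‖ with hM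
  have hMx : ∀ x, ‖toEuclideanLin τ.W x‖ ≤ M * ‖x‖ :=
    (LinearMap.toContinuousLinearMap (toEuclideanLin τ.W)).le_opNorm
  have hM0 : 0 ≤ M := norm_nonneg _
  have hpos : 0 < τ.α / (M + 1) := by positivity
  -- The strip bound shows that the radii are bounded above; the supremum of an unbounded set would
  -- default to `0`.
  refine hpos.trans_le (le_csSup ⟨√((run z m).residual (z (m + 1)) ⬝ᵥ
    (run z m).residual (z (m + 1))) / 2, fun r hr => ?_⟩ ?_)
  · have := two_mul_le_norm_residual hm hr
    linarith
  · refine ⟨hpos.le, τ.rounding.center, fun v hv hvr => ?_⟩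
    rw [span_sub_hull z (m + 1 + 1) h.center_mem_hull, ← h.span_eq, ← hτ,
      h.valid.inv.mem_columnSpan] at hv
    refine h.inner_subset (Rounding.mem_inner.2 ⟨τ.α⁻¹ • toEuclideanLin τ.W v, ?_, ?_⟩)
    · rw [norm_smul, norm_inv, Real.norm_of_nonneg hα.le, inv_mul_le_iff₀ hα, mul_one]
      calc ‖toEuclideanLin τ.W v‖ ≤ M * ‖v‖ := hMx v
        _ ≤ M * (τ.α / (M + 1)) := by gcongr
        _ ≤ (M + 1) * (τ.α / (M + 1)) := by gcongr; linarith
        _ = τ.α := by field_simp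
    · change _ = τ.rounding.center + τ.α • toEuclideanLin τ.Q _
      rw [map_smul, smul_smul, mul_inv_cancel₀ hα.ne', one_smul]
      congr 1
      exact (congrArg (WithLp.toLp 2) hv).symm

lemma one_le_affDim
    (hm : 0 < (run z m).residual (z (m + 1)) ⬝ᵥ (run z m).residual (z (m + 1))) :
    1 ≤ affDim z (m + 2) := by
  rw [(runInvariant z (m + 1)).affDim_eq, run, Tracker.step, if_pos hm]
  exact Nat.le_add_left _ _

lemma div_inradius_le_aspect
    (hm : 0 < (run z m).residual (z (m + 1)) ⬝ᵥ (run z m).residual (z (m + 1)))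
    {t : ℕ} (ht : m + 2 ≤ t) :
    circumradius (hull z t) / inradius (hull z (m + 2)) ≤ aspect z t := by
  have : Finite {s : ℕ // s ≤ t ∧ 1 ≤ affDim z s} :=
    ((Set.finite_Iic t).subset fun s hs => hs.1 : {s | s ≤ t ∧ 1 ≤ affDim z s}.Finite)
  exact le_ciSup (f := fun s : {s : ℕ // s ≤ t ∧ 1 ≤ affDim z s} =>
    circumradius (hull z t) / inradius (hull z s)) (Set.finite_range _).bddAbove
    ⟨m + 2, ht, one_le_affDim hm⟩

end IrregularStep

lemma exists_irregular_step (z : ℕ → EuclideanSpace ℝ (Fin d)) (n : ℕ) (h : 1 ≤ (run z n).k) :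
    ∃ m < n, 0 < (run z m).residual (z (m + 1)) ⬝ᵥ (run z m).residual (z (m + 1)) := by
  induction n with
  | zero => simp [run, Tracker.start] at h
  | succ n ih =>
    by_cases hn : 0 < (run z n).residual (z (n + 1)) ⬝ᵥ (run z n).residual (z (n + 1))
    · exact ⟨n, by omega, hn⟩
    · have hk : (run z (n + 1)).k = (run z n).k := by
        rw [run, Tracker.step, if_neg hn]
        split_ifs <;> rfl
      rw [hk] at h
      obtain ⟨m, hm, hm'⟩ := ih h
      exact ⟨m, by omega, hm'⟩

/-- In rank `0` all coordinates `W *ᵥ v` vanish, so no regular update can have occurred. -/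
lemma scale_eq_one (z : ℕ → EuclideanSpace ℝ (Fin d)) (n : ℕ) (h : (run z n).k = 0) :
    (run z n).α = 1 := by
  induction n with
  | zero => rfl
  | succ n ih =>
    have hinv := runInvariant z n
    rw [run, Tracker.step] at h ⊢
    split_ifs at h ⊢ with h1 h2
    · simp [Tracker.irregular] at h
    · exfalso
      have hk : (run z n).k = 0 := h
      have h3 : ∀ i, (run z n).coord (z (n + 1)) i = 0 := fun i =>
        hinv.valid.inv.coord_apply_of_le _ (by omega)
      simp [dotProduct, h3] at h2
      linarith
    · exact ih h

/-- The volume potential for `σ = R / α` and `r = R / κ`. The first bounds the axes of the final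
ellipsoid, since the inner one lies in a ball of radius `R`; the second is at most the inradius
after each irregular step. The terms `2 * d * log σ` cancel. -/
lemma inv_scale_le (z : ℕ → EuclideanSpace ℝ (Fin d)) (n : ℕ) (h : 1 ≤ affDim z (n + 1)) :
    1 ≤ aspect z (n + 1) ∧ 1 / (run z n).α ≤ 1 + affDim z (n + 1) +
      2 * affDim z (n + 1) * Real.log (aspect z (n + 1) * (1 / (run z n).α)) := by
  have hinv := runInvariant z n
  rw [hinv.affDim_eq] at h ⊢
  have hα := hinv.valid.scale_pos
  set R := circumradius (hull z (n + 1)) with hR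
  set κ := aspect z (n + 1) with hκ
  obtain ⟨m, hmn, hm⟩ := exists_irregular_step z n h
  have hr0 := inradius_pos hm
  have hrR : inradius (hull z (m + 2)) ≤ R := inradius_le_circumradius hm (by omega)
  have hκ1 : 1 ≤ κ := by
    have := div_inradius_le_aspect hm (show m + 2 ≤ n + 1 by omega)
    exact le_trans ((one_le_div hr0).2 hrR) this
  have hR0 : 0 < R := by linarith
  refine ⟨hκ1, ?_⟩
  have hσ : 0 < R / (run z n).α := by positivity
  have hr : 0 < R / κ := by positivity
  obtain ⟨hdet, hle⟩ := inv_scale_le_potential z hσ hr n fun m hmn hm => by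
    have h1 := div_inradius_le_aspect hm (show m + 2 ≤ n + 1 by omega)
    have h2 := inradius_pos hm
    rw [div_le_iff₀ h2] at h1
    have h3 : R / κ ≤ inradius (hull z (m + 2)) := by
      rw [div_le_iff₀ (by positivity), mul_comm]; exact h1
    have h4 : inradius (hull z (m + 2)) ≤
        √((run z m).residual (z (m + 1)) ⬝ᵥ (run z m).residual (z (m + 1))) / 2 :=
      inradius_le (by omega) fun r hr => by
        have := two_mul_le_norm_residual hm hr
        linarith
    linarith
  have hdet_le := det_gram_le (σ := R / (run z n).α) hinv.valid.inv fun x => by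
    rw [div_mul_eq_mul_div, le_div_iff₀ hα, mul_comm]
    exact norm_smul_shape_le_circumradius hinv x
  have hlog := Real.log_le_log hdet hdet_le
  rw [← pow_mul, Real.log_pow] at hlog
  have hratio : R / (run z n).α / (R / κ) = κ * (1 / (run z n).α) := by field_simp
  rw [hratio] at hle
  push_cast at hlog
  linarith

/-- Splitting off `log (A / (4 * k)) ≤ A / (4 * k) - 1` leaves `A / 2` on the right, which is
absorbed by the left side. -/
lemma bound_of_self_bound {A κ : ℝ} {k : ℕ} (hA : 1 ≤ A) (hκ : 1 ≤ κ) (hk : 1 ≤ k)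
    (h : A ≤ 1 + k + 2 * k * Real.log (κ * A)) :
    A ≤ 2 + 4 * k * Real.log κ + 4 * k * Real.log (4 * k) := by
  have hk0 : (1 : ℝ) ≤ k := by exact_mod_cast hk
  have h1 : Real.log (κ * A) = Real.log κ + Real.log (4 * k) + Real.log (A / (4 * k)) := by
    rw [← Real.log_mul (by positivity) (by positivity),
      ← Real.log_mul (by positivity) (by positivity)]
    congr 1; field_simp
  have h2 : Real.log (A / (4 * k)) ≤ A / (4 * k) - 1 := Real.log_le_sub_one_of_pos (by positivity)
  have h3 : 2 * (k : ℝ) * (A / (4 * k) - 1) = A / 2 - 2 * k := by field_simp; ring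
  have h4 : 2 * (k : ℝ) * Real.log (A / (4 * k)) ≤ A / 2 - 2 * k := by
    rw [← h3]; gcongr
  rw [h1] at h
  nlinarith

lemma inv_scale_le_of_two_le (z : ℕ → EuclideanSpace ℝ (Fin d)) (n : ℕ)
    (h : 2 ≤ affDim z (n + 1)) : 1 / (run z n).α ≤
      14 * (affDim z (n + 1) * Real.log (affDim z (n + 1) * aspect z (n + 1))) := by
  have hval := (runInvariant z n).valid
  obtain ⟨h1, h2⟩ := inv_scale_le z n (by omega)
  have hA : 1 ≤ 1 / (run z n).α := by rw [one_le_div hval.scale_pos]; exact hval.scale_le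
  have h3 := bound_of_self_bound hA h1 (by omega) h2
  set k := affDim z (n + 1)
  have hk : (2 : ℝ) ≤ k := by exact_mod_cast h
  have h4 : Real.log 2 ≤ Real.log k := Real.log_le_log (by norm_num) hk
  have h5 : 0 ≤ Real.log (aspect z (n + 1)) := Real.log_nonneg h1
  have h6 := Real.log_two_gt_d9
  rw [Real.log_mul (by positivity) (by positivity), show (4 : ℝ) = 2 * 2 by norm_num,
    Real.log_mul (by norm_num) (by norm_num)] at h3
  rw [Real.log_mul (by positivity) (by positivity)]
  -- As `log 2 ≤ log k`, the term `4 * k * log (4 * k)` is at most `12 * k * log k`, and `k * log k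
  -- ≥ 2 * log 2 > 1` absorbs the summand `2`. This gives the constant `14`.
  nlinarith [mul_nonneg (by linarith : (0 : ℝ) ≤ k) h5]

lemma inv_scale_le_of_eq_one (z : ℕ → EuclideanSpace ℝ (Fin d)) (n : ℕ)
    (h : affDim z (n + 1) = 1) : 1 / (run z n).α ≤ 8 * (1 + Real.log (aspect z (n + 1))) := by
  have hval := (runInvariant z n).valid
  obtain ⟨h1, h2⟩ := inv_scale_le z n (by omega)
  have hA : 1 ≤ 1 / (run z n).α := by rw [one_le_div hval.scale_pos]; exact hval.scale_le
  have h3 := bound_of_self_bound hA h1 (by omega) h2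
  rw [h] at h3
  have h5 : 0 ≤ Real.log (aspect z (n + 1)) := Real.log_nonneg h1
  have h6 := Real.log_two_lt_d9
  rw [show (4 : ℝ) * ((1 : ℕ) : ℝ) = 2 * 2 by norm_num,
    Real.log_mul (by norm_num) (by norm_num)] at h3
  linarith

end Approximation

/-! ## Reasoning about programs -/

section Programs

variable {d : ℕ} {S : ℕ} {z : EuclideanSpace ℝ (Fin d)}

namespace State

variable {s : State} {r a k : ℕ} {v : ℝ}

lemma ireg_setI : (s.setI r k).ireg r = k := Function.update_self ..
lemma ireg_setI_ne (h : a ≠ r) : (s.setI r k).ireg a = s.ireg a := Function.update_of_ne h ..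
lemma rreg_setI : (s.setI r k).rreg = s.rreg := rfl
lemma mem_setI : (s.setI r k).mem = s.mem := rfl
lemma rreg_setR : (s.setR r v).rreg r = v := Function.update_self ..
lemma rreg_setR_ne (h : a ≠ r) : (s.setR r v).rreg a = s.rreg a := Function.update_of_ne h ..
lemma ireg_setR : (s.setR r v).ireg = s.ireg := rfl
lemma mem_setR : (s.setR r v).mem = s.mem := rfl
lemma mem_setMem : (s.setMem r v).mem r = v := Function.update_self ..
lemma mem_setMem_ne (h : a ≠ r) : (s.setMem r v).mem a = s.mem a := Function.update_of_ne h ..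
lemma ireg_setMem : (s.setMem r v).ireg = s.ireg := rfl

end State

/-- The program `p`, started in `s`, terminates within `c` steps in a state with the property
`Φ`. -/
def Runs (S : ℕ) (z : EuclideanSpace ℝ (Fin d)) (p : Prog) (s : State) (c : ℕ)
    (Φ : State → Prop) : Prop :=
  ∃ T s', Exec S z p s T s' ∧ T ≤ c ∧ Φ s'

namespace Runs

variable {p q : Prog} {s : State} {c c' : ℕ} {Φ Ψ : State → Prop}

lemma mono (h : Runs S z p s c Φ) (hc : c ≤ c') (hΦ : ∀ s', Φ s' → Ψ s') : Runs S z p s c' Ψ := by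
  obtain ⟨T, s', h1, h2, h3⟩ := h
  exact ⟨T, s', h1, h2.trans hc, hΦ _ h3⟩

lemma seq (h : Runs S z p s c (fun s' => Runs S z q s' c' Φ)) :
    Runs S z (.seq p q) s (c + c') Φ := by
  obtain ⟨T, s', h1, h2, T', s'', h3, h4, h5⟩ := h
  exact ⟨_, _, .seq h1 h3, add_le_add h2 h4, h5⟩

lemma ite {b : Test} (h1 : b.Holds s → Runs S z p s c Φ) (h2 : ¬ b.Holds s → Runs S z q s c Φ) :
    Runs S z (.ite b p q) s (c + 1) Φ := by
  by_cases hb : b.Holds s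
  · obtain ⟨T, s', h3, h4, h5⟩ := h1 hb
    exact ⟨_, _, .ite_true hb h3, by omega, h5⟩
  · obtain ⟨T, s', h3, h4, h5⟩ := h2 hb
    exact ⟨_, _, .ite_false hb h3, by omega, h5⟩

lemma skip (h : Φ s) : Runs S z .skip s 0 Φ := ⟨0, s, .skip s, le_rfl, h⟩

end Runs

/-- A sequence of instructions. -/
def Prog.block : List Instr → Prog
  | [] => .skip
  | i :: l => .seq (.instr i) (block l)

/-- The sequence of instructions `l`, started in `s`, can be executed and leads to a state with the
property `Φ`. -/
def BlockRuns (S : ℕ) (z : EuclideanSpace ℝ (Fin d)) :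
    List Instr → State → (State → Prop) → Prop
  | [], s, Φ => Φ s
  | i :: l, s, Φ => ∃ s', i.exec S z s = some s' ∧ BlockRuns S z l s' Φ

lemma BlockRuns.runs {l : List Instr} {s : State} {Φ : State → Prop} (h : BlockRuns S z l s Φ) :
    Runs S z (.block l) s l.length Φ := by
  induction l generalizing s with
  | nil => exact .skip h
  | cons i l ih =>
    obtain ⟨s', h1, h2⟩ := h
    obtain ⟨T, s'', h3, h4, h5⟩ := ih h2
    exact ⟨_, _, .seq (.instr h1) h3, by simp only [List.length_cons]; omega, h5⟩

section BlockLemmas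

variable {l : List Instr} {s : State} {Φ : State → Prop} {r a b x y w : ℕ}

lemma BlockRuns.iconst {k : ℕ} (h : k ≤ S) (h' : BlockRuns S z l (s.setI r k) Φ) :
    BlockRuns S z (.iconst r k :: l) s Φ := ⟨_, if_pos h, h'⟩
lemma BlockRuns.iadd (h : s.ireg a + s.ireg b ≤ S)
    (h' : BlockRuns S z l (s.setI r (s.ireg a + s.ireg b)) Φ) :
    BlockRuns S z (.iadd r a b :: l) s Φ := ⟨_, if_pos h, h'⟩
lemma BlockRuns.isub (h' : BlockRuns S z l (s.setI r (s.ireg a - s.ireg b)) Φ) :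
    BlockRuns S z (.isub r a b :: l) s Φ := ⟨_, rfl, h'⟩
lemma BlockRuns.rconst {k : ℤ} (h' : BlockRuns S z l (s.setR x k) Φ) :
    BlockRuns S z (.rconst x k :: l) s Φ := ⟨_, rfl, h'⟩
lemma BlockRuns.radd (h' : BlockRuns S z l (s.setR x (s.rreg y + s.rreg w)) Φ) :
    BlockRuns S z (.radd x y w :: l) s Φ := ⟨_, rfl, h'⟩
lemma BlockRuns.rmul (h' : BlockRuns S z l (s.setR x (s.rreg y * s.rreg w)) Φ) :
    BlockRuns S z (.rmul x y w :: l) s Φ := ⟨_, rfl, h'⟩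
lemma BlockRuns.load (h : s.ireg r < S) (h' : BlockRuns S z l (s.setR x (s.mem (s.ireg r))) Φ) :
    BlockRuns S z (.load x r :: l) s Φ := ⟨_, if_pos h, h'⟩
lemma BlockRuns.store (h : s.ireg r < S) (h' : BlockRuns S z l (s.setMem (s.ireg r) (s.rreg x)) Φ) :
    BlockRuns S z (.store r x :: l) s Φ := ⟨_, if_pos h, h'⟩
lemma BlockRuns.input (h : s.ireg r < d) (h' : BlockRuns S z l (s.setR x (z ⟨s.ireg r, h⟩)) Φ) :
    BlockRuns S z (.input x r :: l) s Φ := ⟨_, dif_pos h, h'⟩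

end BlockLemmas

/-- `for i := 0, …, n - 1 do p`, where the integer register `3` holds `1`. -/
def Prog.forLoop (i n : ℕ) (p : Prog) : Prog :=
  .seq (.instr (.iconst i 0)) (.loop (.ilt i n) (.seq p (.instr (.iadd i i 3))))

/-- Each round costs a test and an increment besides the body; the final `+ 2` is the initialization
and the failing test. The invariant is asserted after the increment, so the body must preserve the
counter and the register holding `1`. -/
lemma Runs.forLoop {i n c N : ℕ} {p : Prog} {s : State} (I : ℕ → State → Prop) (hN : N ≤ S)
    (h0 : I 0 (s.setI i 0))
    (hI : ∀ j s, I j s → s.ireg i = j ∧ s.ireg n = N ∧ s.ireg 3 = 1)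
    (hp : ∀ j < N, ∀ s, I j s →
      Runs S z p s c fun s' => s'.ireg i = j ∧ s'.ireg 3 = 1 ∧ I (j + 1) (s'.setI i (j + 1))) :
    Runs S z (.forLoop i n p) s (N * (c + 2) + 2) (I N) := by
  have key : ∀ m j s, j + m = N → I j s →
      Runs S z (.loop (.ilt i n) (.seq p (.instr (.iadd i i 3)))) s (m * (c + 2) + 1) (I N) := by
    intro m
    induction m with
    | zero =>
      intro j s hj hs
      obtain ⟨h1, h2, h3⟩ := hI j s hs
      refine ⟨1, s, .loop_false ?_, by omega, ?_⟩
      · simp only [Test.Holds]; omega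
      · rwa [← hj]
    | succ m ih =>
      intro j s hj hs
      obtain ⟨h1, h2, h3⟩ := hI j s hs
      obtain ⟨T, s', h4, h5, h6, h7, h8⟩ := hp j (by omega) s hs
      obtain ⟨T', s'', h9, h10, h11⟩ := ih (j + 1) _ (by omega) h8
      refine ⟨(T + 1) + T' + 1, s'', .loop_true ?_ (.seq h4 (.instr ?_)) h9, ?_, h11⟩
      · simp only [Test.Holds]; omega
      · simp only [Instr.exec, h6, h7]
        rw [if_pos (by omega)]
      · have : (m + 1) * (c + 2) = m * (c + 2) + (c + 2) := by ring
        omega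
  obtain ⟨T, s', h1, h2, h3⟩ := key N 0 (s.setI i 0) (by omega) h0
  refine ⟨1 + T, s', .seq (.instr ?_) h1, by omega, h3⟩
  simp [Instr.exec]

/-- The registers below `l` agree. -/
def Agree (l : ℕ) (s s' : State) : Prop :=
  ∀ r < l, s'.ireg r = s.ireg r ∧ s'.rreg r = s.rreg r

lemma Agree.refl (l : ℕ) (s : State) : Agree l s s := fun _ _ => ⟨rfl, rfl⟩

lemma Agree.trans {l l' : ℕ} {s s' s'' : State} (h : Agree l s s') (h' : Agree l' s' s'')
    (hl : l ≤ l') : Agree l s s'' := fun r hr =>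
  ⟨(h' r (by omega)).1.trans (h r hr).1, (h' r (by omega)).2.trans (h r hr).2⟩

lemma Agree.setI {l r k : ℕ} {s s' : State} (h : Agree l s s') (hr : l ≤ r) :
    Agree l s (s'.setI r k) := fun a ha => by
  rw [State.ireg_setI_ne (by omega), State.rreg_setI]; exact h a ha

lemma Agree.setR {l r : ℕ} {v : ℝ} {s s' : State} (h : Agree l s s') (hr : l ≤ r) :
    Agree l s (s'.setR r v) := fun a ha => by
  rw [State.rreg_setR_ne (by omega), State.ireg_setR]; exact h a ha

lemma Agree.setMem {l r : ℕ} {v : ℝ} {s s' : State} (h : Agree l s s') :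
    Agree l s (s'.setMem r v) := h

/-! ## Subroutines for vectors and matrices -/

/-- `mem[X + j] := mem[X + j] * rreg[p] + mem[Y + j] * rreg[q]` for `j < d`. -/
def axpby (X Y p q : ℕ) : Prog :=
  .forLoop 30 0 (.block [.iadd 31 X 30, .load 30 31, .rmul 30 p 30, .iadd 32 Y 30, .load 31 32,
    .rmul 31 q 31, .radd 30 30 31, .store 31 30])

lemma runs_axpby {s : State} {X Y p q x y : ℕ} (hX : X < 30) (hY : Y < 30) (hp : p < 30)
    (hq : q < 30) (h0 : s.ireg 0 = d) (h3 : s.ireg 3 = 1) (hx : s.ireg X = x) (hy : s.ireg Y = y)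
    (hxS : x + d ≤ S) (hyS : y + d ≤ S) (hxy : x + d ≤ y ∨ y + d ≤ x) :
    Runs S z (axpby X Y p q) s (d * 10 + 2) fun s' => Agree 30 s s' ∧
      (∀ j < d, s'.mem (x + j) = s.rreg p * s.mem (x + j) + s.rreg q * s.mem (y + j)) ∧
      ∀ a, a < x ∨ x + d ≤ a → s'.mem a = s.mem a := by
  let I : ℕ → State → Prop := fun j s' => s'.ireg 30 = j ∧ Agree 30 s s' ∧
    (∀ i < j, s'.mem (x + i) = s.rreg p * s.mem (x + i) + s.rreg q * s.mem (y + i)) ∧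
      ∀ a, a < x ∨ x + j ≤ a → s'.mem a = s.mem a
  refine (Runs.forLoop (c := 8) (N := d) I (by omega) ?_ ?_ ?_).mono le_rfl fun s' h => h.2
  · refine ⟨State.ireg_setI, (Agree.refl 30 s).setI le_rfl, fun i hi => by omega, fun a _ => rfl⟩
  · intro j s' h
    exact ⟨h.1, by rw [(h.2.1 0 (by norm_num)).1, h0], by rw [(h.2.1 3 (by norm_num)).1, h3]⟩
  · rintro j hj s' ⟨h1, h2, h4, h5⟩
    have eX : s'.ireg X = x := by rw [(h2 X hX).1, hx]
    have eY : s'.ireg Y = y := by rw [(h2 Y hY).1, hy]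
    have ep : s'.rreg p = s.rreg p := (h2 p hp).2
    have eq : s'.rreg q = s.rreg q := (h2 q hq).2
    have e3 : s'.ireg 3 = 1 := by rw [(h2 3 (by norm_num)).1, h3]
    refine BlockRuns.runs (l := [_, _, _, _, _, _, _, _]) ?_
    refine .iadd (by rw [eX, h1]; omega) (.load ?_ (.rmul (.iadd ?_ (.load ?_ (.rmul (.radd
      (.store ?_ ?_)))))))
    all_goals simp (disch := omega) only [State.ireg_setI, State.ireg_setI_ne, State.ireg_setR,
      State.mem_setI, State.mem_setR, State.rreg_setR, State.rreg_setR_ne, State.rreg_setI, eX, eY,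
      h1, ep, eq]
    · omega
    · omega
    · omega
    · omega
    · refine ⟨?_, ?_, ?_, ?_, ?_, ?_⟩
      · simp (disch := omega) only [State.ireg_setI_ne, State.ireg_setR, State.ireg_setMem, h1]
      · simp (disch := omega) only [State.ireg_setI_ne, State.ireg_setR, State.ireg_setMem, e3]
      · exact State.ireg_setI
      · refine Agree.setI (Agree.setMem ?_) le_rfl
        repeat'
          first
          | exact h2
          | refine Agree.setI ?_ (by norm_num)
          | refine Agree.setR ?_ (by norm_num)
      · intro i hi
        rw [State.mem_setI]
        rcases Nat.lt_succ_iff_lt_or_eq.1 hi with h | rfl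
        · rw [State.mem_setMem_ne (by omega)]
          exact h4 i h
        · rw [State.mem_setMem]
          rw [h5 (x + i) (by omega), h5 (y + i) (by omega)]
      · intro a ha
        rw [State.mem_setI, State.mem_setMem_ne (by omega)]
        exact h5 a (by omega)

/-- `rreg[30] := ∑ j < d, mem[X + j * t] * mem[Y + j]`, where `t` is the content of the integer
register `R`. -/
def stridedDot (X R Y : ℕ) : Prog :=
  .seq (.block [.iconst 33 0, .iadd 33 X 33, .rconst 30 0])
    (.forLoop 31 0 (.block [.load 31 33, .iadd 32 Y 31, .load 32 32, .rmul 31 31 32,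
      .radd 30 30 31, .iadd 33 33 R]))

/-- The pointer is advanced once more after the last term. Hence `x + d * t`, which is never read,
must still be within the integer range `S`. -/
lemma runs_stridedDot {s : State} {X R Y x t y : ℕ} (hX : X < 30) (hR : R < 30) (hY : Y < 30)
    (h0 : s.ireg 0 = d) (h3 : s.ireg 3 = 1) (hx : s.ireg X = x) (ht : s.ireg R = t)
    (hy : s.ireg Y = y) (ht0 : 0 < t) (hxS : x + d * t ≤ S) (hyS : y + d ≤ S) :
    Runs S z (stridedDot X R Y) s (d * 8 + 5) fun s' => Agree 30 s s' ∧ s'.mem = s.mem ∧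
      s'.rreg 30 = ∑ j ∈ Finset.range d, s.mem (x + j * t) * s.mem (y + j) := by
  let I : ℕ → State → Prop := fun j s' => s'.ireg 31 = j ∧ s'.ireg 33 = x + j * t ∧
    Agree 30 s s' ∧ s'.mem = s.mem ∧
      s'.rreg 30 = ∑ i ∈ Finset.range j, s.mem (x + i * t) * s.mem (y + i)
  refine (Runs.seq (c := 3) (c' := d * (6 + 2) + 2) ?_).mono (by omega) fun s' h => h
  refine BlockRuns.runs (l := [_, _, _]) (.iconst (by omega) (.iadd ?_ (.rconst ?_)))
  · rw [State.ireg_setI, State.ireg_setI_ne (by omega), hx]; omega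
  refine (Runs.forLoop (c := 6) (N := d) I (by omega) ?_ ?_ ?_).mono le_rfl
    fun s' h => ⟨h.2.2.1, h.2.2.2.1, h.2.2.2.2⟩
  · refine ⟨State.ireg_setI, ?_, ?_, rfl, ?_⟩
    · simp (disch := omega) only [State.ireg_setI, State.ireg_setI_ne, State.ireg_setR, hx]
      omega
    · repeat'
        first
        | exact Agree.refl 30 s
        | refine Agree.setI ?_ (by norm_num)
        | refine Agree.setR ?_ (by norm_num)
    · simp [State.rreg_setI, State.rreg_setR]
  · rintro j s' ⟨h1, -, h2, -⟩
    exact ⟨h1, by rw [(h2 0 (by norm_num)).1, h0], by rw [(h2 3 (by norm_num)).1, h3]⟩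
  · rintro j hj s' ⟨h1, h6, h2, h4, h5⟩
    have eR : s'.ireg R = t := by rw [(h2 R hR).1, ht]
    have eY : s'.ireg Y = y := by rw [(h2 Y hY).1, hy]
    have e3 : s'.ireg 3 = 1 := by rw [(h2 3 (by norm_num)).1, h3]
    have hjt : j * t + t ≤ d * t := by rw [← Nat.succ_mul]; exact Nat.mul_le_mul_right t hj
    refine BlockRuns.runs (l := [_, _, _, _, _, _]) ?_
    refine .load ?_ (.iadd ?_ (.load ?_ (.rmul (.radd (.iadd ?_ ?_)))))
    all_goals simp (disch := omega) only [State.ireg_setI, State.ireg_setI_ne, State.ireg_setR,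
      State.mem_setI, State.mem_setR, State.rreg_setR, State.rreg_setR_ne, State.rreg_setI, eR, eY,
      h1, h6]
    · omega
    · omega
    · omega
    · omega
    · refine ⟨?_, ?_, ?_, ?_, ?_, ?_, ?_⟩
      · simp (disch := omega) only [State.ireg_setI_ne, State.ireg_setR, h1]
      · simp (disch := omega) only [State.ireg_setI_ne, State.ireg_setR, e3]
      · exact State.ireg_setI
      · rw [State.ireg_setI_ne (by omega), State.ireg_setI, Nat.succ_mul]; ring
      · repeat'
          first
          | exact h2
          | refine Agree.setI ?_ (by norm_num)
          | refine Agree.setR ?_ (by norm_num)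
      · exact h4
      · simp only [State.rreg_setI, State.rreg_setR, h4, h5]
        rw [Finset.sum_range_succ]

/-- `mem[Y + i] := ∑ j < d, mem[M + i * t + j * t'] * mem[X + j]` for `i < d`, where `t` and `t'`
are the contents of the integer registers `R` and `R'`. -/
def stridedMatVec (M R R' X Y : ℕ) : Prog :=
  .seq (.block [.iconst 21 0, .iadd 21 M 21])
    (.forLoop 20 0 (.seq (stridedDot 21 R' X) (.block [.iadd 22 Y 20, .store 22 30,
      .iadd 21 21 R])))

lemma runs_stridedMatVec {s : State} {M R R' X Y m t t' x y : ℕ} (hM : M < 20) (hR : R < 20)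
    (hR' : R' < 20) (hX : X < 20) (hY : Y < 20) (h0 : s.ireg 0 = d) (h3 : s.ireg 3 = 1)
    (hm : s.ireg M = m) (ht : s.ireg R = t) (ht' : s.ireg R' = t') (hx : s.ireg X = x)
    (hy : s.ireg Y = y) (ht0 : 0 < t) (ht0' : 0 < t') (hmS : m + d * t + d * t' ≤ S)
    (hxS : x + d ≤ S) (hyS : y + d ≤ S) (hxy : x + d ≤ y ∨ y + d ≤ x)
    (hmy : ∀ i < d, ∀ j < d, m + i * t + j * t' < y ∨ y + d ≤ m + i * t + j * t') :
    Runs S z (stridedMatVec M R R' X Y) s (d * (d * 8 + 10) + 4) fun s' => Agree 20 s s' ∧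
      (∀ i < d, s'.mem (y + i) =
        ∑ j ∈ Finset.range d, s.mem (m + i * t + j * t') * s.mem (x + j)) ∧
      ∀ a, a < y ∨ y + d ≤ a → s'.mem a = s.mem a := by
  let I : ℕ → State → Prop := fun i s' => s'.ireg 20 = i ∧ s'.ireg 21 = m + i * t ∧
    Agree 20 s s' ∧ (∀ k < i, s'.mem (y + k) =
        ∑ j ∈ Finset.range d, s.mem (m + k * t + j * t') * s.mem (x + j)) ∧
      ∀ a, a < y ∨ y + i ≤ a → s'.mem a = s.mem a
  refine (Runs.seq (c := 2) (c' := d * ((d * 8 + 5 + 3) + 2) + 2) ?_).mono (by nlinarith)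
    fun s' h => h
  refine BlockRuns.runs (l := [_, _]) (.iconst (by omega) (.iadd ?_ ?_))
  · rw [State.ireg_setI, State.ireg_setI_ne (by omega), hm]; omega
  refine (Runs.forLoop (c := d * 8 + 5 + 3) (N := d) I (by omega) ?_ ?_ ?_).mono le_rfl
    fun s' h => h.2.2
  · refine ⟨State.ireg_setI, ?_, ?_, fun k hk => by omega, fun a _ => rfl⟩
    · simp (disch := omega) only [State.ireg_setI, State.ireg_setI_ne, hm]
      omega
    · repeat' first | exact Agree.refl 20 s | refine Agree.setI ?_ (by norm_num)
  · rintro j s' ⟨h1, -, h2, -⟩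
    exact ⟨h1, by rw [(h2 0 (by norm_num)).1, h0], by rw [(h2 3 (by norm_num)).1, h3]⟩
  · rintro i hi s' ⟨h1, h6, h2, h4, h5⟩
    have hit : i * t + t ≤ d * t := by rw [← Nat.succ_mul]; exact Nat.mul_le_mul_right t hi
    have e0 : s'.ireg 0 = d := by rw [(h2 0 (by norm_num)).1, h0]
    have e3 : s'.ireg 3 = 1 := by rw [(h2 3 (by norm_num)).1, h3]
    refine Runs.seq ((runs_stridedDot (by norm_num) (by omega) (by omega) e0 e3 h6
      (by rw [(h2 R' hR').1, ht']) (by rw [(h2 X hX).1, hx]) ht0' (by omega) hxS).mono le_rfl ?_)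
    rintro s'' ⟨g1, g2, g3⟩
    have f20 : s''.ireg 20 = i := by rw [(g1 20 (by norm_num)).1, h1]
    have f21 : s''.ireg 21 = m + i * t := by rw [(g1 21 (by norm_num)).1, h6]
    have fY : s''.ireg Y = y := by rw [(g1 Y (by omega)).1, (h2 Y hY).1, hy]
    have fR : s''.ireg R = t := by rw [(g1 R (by omega)).1, (h2 R hR).1, ht]
    have f3 : s''.ireg 3 = 1 := by rw [(g1 3 (by norm_num)).1, e3]
    refine BlockRuns.runs (l := [_, _, _]) ?_
    refine .iadd ?_ (.store ?_ (.iadd ?_ ?_))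
    all_goals simp (disch := omega) only [State.ireg_setI, State.ireg_setI_ne, State.ireg_setMem,
      State.rreg_setI, fY, f20, f21, fR]
    · omega
    · omega
    · omega
    · refine ⟨?_, ?_, ?_, ?_, ?_, ?_, ?_⟩
      · simp (disch := omega) only [State.ireg_setI_ne, State.ireg_setMem, f20]
      · simp (disch := omega) only [State.ireg_setI_ne, State.ireg_setMem, f3]
      · exact State.ireg_setI
      · rw [State.ireg_setI_ne (by omega), State.ireg_setI, Nat.succ_mul]; ring
      · refine Agree.setI (Agree.setI (Agree.setMem (Agree.setI ?_ ?_)) ?_) ?_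
        · exact h2.trans g1 (by norm_num)
        all_goals norm_num
      · intro k hk
        rw [State.mem_setI, State.mem_setI]
        rcases Nat.lt_succ_iff_lt_or_eq.1 hk with h | rfl
        · rw [State.mem_setMem_ne (by omega), State.mem_setI, g2]
          exact h4 k h
        · rw [State.mem_setMem, g3]
          refine Finset.sum_congr rfl fun j hj => ?_
          have hj' := Finset.mem_range.1 hj
          have := hmy k hi j hj'
          rw [h5 (x + j) (by omega), h5 _ (by omega)]
      · intro a ha
        rw [State.mem_setI, State.mem_setI, State.mem_setMem_ne (by omega), State.mem_setI, g2]
        exact h5 a (by omega)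

/-- `mem[M + d * i + j] := rreg[p] * mem[M + d * i + j] + rreg[q] * mem[X + i] * mem[Y + j]` for
`i, j < d`. -/
def rankOne (M X Y p q : ℕ) : Prog :=
  .seq (.block [.iconst 21 0, .iadd 21 M 21])
    (.forLoop 20 0 (.seq (.block [.iadd 22 X 20, .load 20 22, .rmul 20 q 20])
      (.seq (axpby 21 Y p 20) (.block [.iadd 21 21 0]))))

lemma runs_rankOne {s : State} {M X Y p q m x y : ℕ} (hM : M < 20) (hX : X < 20) (hY : Y < 20)
    (hp : p < 20) (hq : q < 20) (h0 : s.ireg 0 = d) (h3 : s.ireg 3 = 1)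
    (hm : s.ireg M = m) (hx : s.ireg X = x) (hy : s.ireg Y = y) (hmS : m + d * d ≤ S)
    (hxS : x + d ≤ S) (hyS : y + d ≤ S) (hmx : m + d * d ≤ x ∨ x + d ≤ m)
    (hmy : m + d * d ≤ y ∨ y + d ≤ m) :
    Runs S z (rankOne M X Y p q) s (d * (d * 10 + 8) + 4) fun s' => Agree 20 s s' ∧
      (∀ i < d, ∀ j < d, s'.mem (m + d * i + j) =
        s.rreg p * s.mem (m + d * i + j) + s.rreg q * s.mem (x + i) * s.mem (y + j)) ∧
      ∀ a, a < m ∨ m + d * d ≤ a → s'.mem a = s.mem a := by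
  have hrow : ∀ i < d, d * i + d ≤ d * d := fun i hi => by
    rw [← Nat.mul_succ]; exact Nat.mul_le_mul_left d hi
  let I : ℕ → State → Prop := fun i s' => s'.ireg 20 = i ∧ s'.ireg 21 = m + d * i ∧
    Agree 20 s s' ∧ (∀ k < i, ∀ j < d, s'.mem (m + d * k + j) =
        s.rreg p * s.mem (m + d * k + j) + s.rreg q * s.mem (x + k) * s.mem (y + j)) ∧
      ∀ a, a < m ∨ m + d * i ≤ a → s'.mem a = s.mem a
  refine (Runs.seq (c := 2) (c' := d * ((3 + ((d * 10 + 2) + 1)) + 2) + 2) ?_).mono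
    (by nlinarith) fun s' h => h
  refine BlockRuns.runs (l := [_, _]) (.iconst (by omega) (.iadd ?_ ?_))
  · rw [State.ireg_setI, State.ireg_setI_ne (by omega), hm]; omega
  refine (Runs.forLoop (c := 3 + ((d * 10 + 2) + 1)) (N := d) I (by omega) ?_ ?_ ?_).mono le_rfl
    fun s' h => h.2.2
  · refine ⟨State.ireg_setI, ?_, ?_, fun k hk => by omega, fun a _ => rfl⟩
    · simp (disch := omega) only [State.ireg_setI, State.ireg_setI_ne, hm]
      omega
    · repeat' first | exact Agree.refl 20 s | refine Agree.setI ?_ (by norm_num)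
  · rintro j s' ⟨h1, -, h2, -⟩
    exact ⟨h1, by rw [(h2 0 (by norm_num)).1, h0], by rw [(h2 3 (by norm_num)).1, h3]⟩
  · rintro i hi s' ⟨h1, h6, h2, h4, h5⟩
    have hrow' := hrow i hi
    have e0 : s'.ireg 0 = d := by rw [(h2 0 (by norm_num)).1, h0]
    have e3 : s'.ireg 3 = 1 := by rw [(h2 3 (by norm_num)).1, h3]
    have eX : s'.ireg X = x := by rw [(h2 X hX).1, hx]
    have eY : s'.ireg Y = y := by rw [(h2 Y hY).1, hy]
    have ep : s'.rreg p = s.rreg p := (h2 p hp).2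
    have eq : s'.rreg q = s.rreg q := (h2 q hq).2
    refine Runs.seq (BlockRuns.runs (l := [_, _, _]) (.iadd ?_ (.load ?_ (.rmul ?_))))
    · rw [eX, h1]; omega
    · rw [State.ireg_setI, eX, h1]; omega
    refine Runs.seq ((runs_axpby (x := m + d * i) (y := y) (by norm_num) (by omega) (by omega)
      (by norm_num) ?_ ?_ ?_ ?_ (by omega) hyS (by omega)).mono le_rfl ?_)
    · simp (disch := omega) only [State.ireg_setI_ne, State.ireg_setR, e0]
    · simp (disch := omega) only [State.ireg_setI_ne, State.ireg_setR, e3]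
    · simp (disch := omega) only [State.ireg_setI_ne, State.ireg_setR, h6]
    · simp (disch := omega) only [State.ireg_setI_ne, State.ireg_setR, eY]
    intro s'' hs''
    simp (disch := omega) only [State.ireg_setI,
      State.mem_setI, State.mem_setR, State.rreg_setR, State.rreg_setR_ne, State.rreg_setI, eX,
      h1, ep, eq] at hs''
    obtain ⟨g1, g2, g3⟩ := hs''
    have f0 : s''.ireg 0 = d := by
      rw [(g1 0 (by norm_num)).1]
      simp (disch := omega) only [State.ireg_setI_ne, State.ireg_setR, e0]
    have f3 : s''.ireg 3 = 1 := by
      rw [(g1 3 (by norm_num)).1]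
      simp (disch := omega) only [State.ireg_setI_ne, State.ireg_setR, e3]
    have f20 : s''.ireg 20 = i := by
      rw [(g1 20 (by norm_num)).1]
      simp (disch := omega) only [State.ireg_setI_ne, State.ireg_setR, h1]
    have f21 : s''.ireg 21 = m + d * i := by
      rw [(g1 21 (by norm_num)).1]
      simp (disch := omega) only [State.ireg_setI_ne, State.ireg_setR, h6]
    refine BlockRuns.runs (l := [_]) (.iadd ?_ ?_)
    · rw [f21, f0]; omega
    rw [f21, f0]
    refine ⟨?_, ?_, ?_, ?_, ?_, ?_, ?_⟩
    · rw [State.ireg_setI_ne (by omega), f20]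
    · rw [State.ireg_setI_ne (by omega), f3]
    · exact State.ireg_setI
    · rw [State.ireg_setI_ne (by omega), State.ireg_setI, Nat.mul_succ]; ring
    · refine Agree.setI (Agree.setI (Agree.trans ?_ g1 (by norm_num)) ?_) ?_
      · repeat'
          first
          | exact h2
          | refine Agree.setI ?_ (by norm_num)
          | refine Agree.setR ?_ (by norm_num)
      all_goals norm_num
    · intro k hk j hj
      rw [State.mem_setI, State.mem_setI]
      rcases Nat.lt_succ_iff_lt_or_eq.1 hk with h | rfl
      · have : d * k + d ≤ d * i := by rw [← Nat.mul_succ]; exact Nat.mul_le_mul_left d h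
        rw [g3 _ (by omega)]
        exact h4 k h j hj
      · rw [g2 j hj, h5 (x + k) (by omega), h5 (y + j) (by omega), h5 _ (by omega)]
    · intro a ha
      rw [Nat.mul_succ] at ha
      rw [State.mem_setI, State.mem_setI, g3 a (by omega)]
      exact h5 a (by omega)

/-- `mem[X + j] :=` the coordinate `j` of the current point, for `j < d`. -/
def readPoint (X : ℕ) : Prog :=
  .forLoop 30 0 (.block [.input 30 30, .iadd 31 X 30, .store 31 30])

lemma runs_readPoint {s : State} {X x : ℕ} (hX : X < 30) (h0 : s.ireg 0 = d) (h3 : s.ireg 3 = 1)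
    (hx : s.ireg X = x) (hxS : x + d ≤ S) :
    Runs S z (readPoint X) s (d * 5 + 2) fun s' => Agree 30 s s' ∧
      (∀ j : Fin d, s'.mem (x + j) = z j) ∧
      ∀ a, a < x ∨ x + d ≤ a → s'.mem a = s.mem a := by
  let I : ℕ → State → Prop := fun j s' => s'.ireg 30 = j ∧ Agree 30 s s' ∧
    (∀ i : Fin d, (i : ℕ) < j → s'.mem (x + i) = z i) ∧
      ∀ a, a < x ∨ x + j ≤ a → s'.mem a = s.mem a
  refine (Runs.forLoop (c := 3) (N := d) I (by omega) ?_ ?_ ?_).mono le_rfl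
    fun s' h => ⟨h.2.1, fun j => h.2.2.1 j j.2, h.2.2.2⟩
  · refine ⟨State.ireg_setI, (Agree.refl 30 s).setI le_rfl, fun i hi => by omega, fun a _ => rfl⟩
  · intro j s' h
    exact ⟨h.1, by rw [(h.2.1 0 (by norm_num)).1, h0], by rw [(h.2.1 3 (by norm_num)).1, h3]⟩
  · rintro j hj s' ⟨h1, h2, h4, h5⟩
    have eX : s'.ireg X = x := by rw [(h2 X hX).1, hx]
    have e3 : s'.ireg 3 = 1 := by rw [(h2 3 (by norm_num)).1, h3]
    refine BlockRuns.runs (l := [_, _, _]) ?_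
    refine .input (by rw [h1]; exact hj) (.iadd ?_ (.store ?_ ?_))
    all_goals simp (disch := omega) only [State.ireg_setI, State.ireg_setR,
      State.rreg_setI, State.rreg_setR, eX, h1]
    · omega
    · omega
    · refine ⟨?_, ?_, ?_, ?_, ?_, ?_⟩
      · simp (disch := omega) only [State.ireg_setI_ne, State.ireg_setR, State.ireg_setMem, h1]
      · simp (disch := omega) only [State.ireg_setI_ne, State.ireg_setR, State.ireg_setMem, e3]
      · exact State.ireg_setI
      · refine Agree.setI (Agree.setMem ?_) le_rfl
        repeat'
          first
          | exact h2
          | refine Agree.setI ?_ (by norm_num)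
          | refine Agree.setR ?_ (by norm_num)
      · intro i hi
        rw [State.mem_setI]
        rcases Nat.lt_succ_iff_lt_or_eq.1 hi with h | h
        · rw [State.mem_setMem_ne (by omega)]
          exact h4 i h
        · subst h
          rw [State.mem_setMem]
      · intro a ha
        rw [State.mem_setI, State.mem_setMem_ne (by omega)]
        exact h5 a (by omega)

end Programs

section Store

open Matrix

variable {d : ℕ} {S : ℕ} {z : EuclideanSpace ℝ (Fin d)}

/-! ## Evaluation of real expressions -/

/-- Real expressions in the contents of the real registers. -/
inductive RExpr where
  | reg (x : ℕ)
  | const (k : ℤ)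
  | add (e f : RExpr)
  | sub (e f : RExpr)
  | mul (e f : RExpr)
  | div (e f : RExpr)
  | sqrt (e : RExpr)

namespace RExpr

/-- The value of an expression. -/
noncomputable def eval (v : ℕ → ℝ) : RExpr → ℝ
  | reg x => v x
  | const k => k
  | add e f => e.eval v + f.eval v
  | sub e f => e.eval v - f.eval v
  | mul e f => e.eval v * f.eval v
  | div e f => e.eval v / f.eval v
  | sqrt e => Real.sqrt (e.eval v)

/-- All registers that occur have index less than `n`. -/
def Below (n : ℕ) : RExpr → Prop
  | reg x => x < n
  | const _ => True
  | add e f | sub e f | mul e f | div e f => e.Below n ∧ f.Below n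
  | sqrt e => e.Below n

/-- The expression can be evaluated. -/
def Defined (v : ℕ → ℝ) : RExpr → Prop
  | reg _ => True
  | const _ => True
  | add e f | sub e f | mul e f => e.Defined v ∧ f.Defined v
  | div e f => e.Defined v ∧ f.Defined v ∧ f.eval v ≠ 0
  | sqrt e => e.Defined v ∧ 0 ≤ e.eval v

/-- Code that evaluates an expression into the register `n`, with larger registers for
intermediate results. -/
def code : RExpr → ℕ → List Instr
  | reg x, n => [.rconst n 0, .radd n x n]
  | const k, n => [.rconst n k]
  | add e f, n => e.code n ++ (f.code (n + 1) ++ [.radd n n (n + 1)])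
  | sub e f, n => e.code n ++ (f.code (n + 1) ++ [.rsub n n (n + 1)])
  | mul e f, n => e.code n ++ (f.code (n + 1) ++ [.rmul n n (n + 1)])
  | div e f, n => e.code n ++ (f.code (n + 1) ++ [.rdiv n n (n + 1)])
  | sqrt e, n => e.code n ++ [.rsqrt n n]

lemma Below.mono {e : RExpr} {n n' : ℕ} (h : e.Below n) (hn : n ≤ n') : e.Below n' := by
  induction e with
  | reg x => exact lt_of_lt_of_le h hn
  | const k => trivial
  | sqrt e ih => exact ih h
  | _ e f ihe ihf => exact ⟨ihe h.1, ihf h.2⟩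

lemma eval_congr {e : RExpr} {n : ℕ} {v w : ℕ → ℝ} (h : e.Below n) (hvw : ∀ x < n, v x = w x) :
    e.eval v = e.eval w := by
  induction e with
  | reg x => exact hvw x h
  | const k => rfl
  | sqrt e ih => simp only [eval, ih h]
  | _ e f ihe ihf => simp only [eval, ihe h.1, ihf h.2]

lemma Defined.congr {e : RExpr} {n : ℕ} {v w : ℕ → ℝ} (hd : e.Defined v) (h : e.Below n)
    (hvw : ∀ x < n, v x = w x) : e.Defined w := by
  induction e with
  | reg x => trivial
  | const k => trivial
  | sqrt e ih => exact ⟨ih hd.1 h, (eval_congr (e := e) h hvw) ▸ hd.2⟩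
  | div e f ihe ihf =>
    exact ⟨ihe hd.1 h.1, ihf hd.2.1 h.2, (eval_congr (e := f) h.2 hvw) ▸ hd.2.2⟩
  | _ e f ihe ihf => exact ⟨ihe hd.1 h.1, ihf hd.2 h.2⟩

/-- The states that differ from `s` only in real registers with index at least `n`, apart from
the value `y` of the register `n`. -/
def Result (s : State) (n : ℕ) (y : ℝ) (s' : State) : Prop :=
  s'.rreg n = y ∧ (∀ x < n, s'.rreg x = s.rreg x) ∧ s'.ireg = s.ireg ∧ s'.mem = s.mem

lemma Result.binary {s s' s'' : State} {n : ℕ} {y y' : ℝ} (h : Result s n y s')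
    (h' : Result s' (n + 1) y' s'') : s''.rreg n = y ∧ s''.rreg (n + 1) = y' ∧
      ∀ v, Result s n v (s''.setR n v) := by
  obtain ⟨h1, h2, h3, h4⟩ := h
  obtain ⟨g1, g2, g3, g4⟩ := h'
  refine ⟨by rw [g2 n (by omega), h1], g1, fun v => ⟨State.rreg_setR, fun x hx => ?_, ?_, ?_⟩⟩
  · rw [State.rreg_setR_ne (by omega), g2 x (by omega), h2 x hx]
  · rw [State.ireg_setR, g3, h3]
  · rw [State.mem_setR, g4, h4]

/-- Operands are evaluated in stack order: the code for the right operand starts at register `n +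
1`, so it preserves the left value in `n` and all registers below, on which the expression depends.
-/
lemma blockRuns_code {e : RExpr} {n : ℕ} {s : State} {l : List Instr} {Φ : State → Prop}
    (hb : e.Below n) (hd : e.Defined s.rreg)
    (h : ∀ s', Result s n (e.eval s.rreg) s' → BlockRuns S z l s' Φ) :
    BlockRuns S z (e.code n ++ l) s Φ := by
  have bin : ∀ {e f : RExpr} {i : Instr} {n : ℕ} {s : State} {l : List Instr} {y : ℝ},
      (∀ {n : ℕ} {s : State} {l : List Instr}, e.Below n → e.Defined s.rreg →
        (∀ s', Result s n (e.eval s.rreg) s' → BlockRuns S z l s' Φ) →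
          BlockRuns S z (e.code n ++ l) s Φ) →
      (∀ {n : ℕ} {s : State} {l : List Instr}, f.Below n → f.Defined s.rreg →
        (∀ s', Result s n (f.eval s.rreg) s' → BlockRuns S z l s' Φ) →
          BlockRuns S z (f.code n ++ l) s Φ) →
      e.Below n → f.Below n → e.Defined s.rreg → f.Defined s.rreg →
      (∀ s' : State, s'.rreg n = e.eval s.rreg → s'.rreg (n + 1) = f.eval s.rreg →
        i.exec S z s' = some (s'.setR n y)) →
      (∀ s', Result s n y s' → BlockRuns S z l s' Φ) →
      BlockRuns S z ((e.code n ++ (f.code (n + 1) ++ [i])) ++ l) s Φ := by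
    intro e f i n s l y ihe ihf hbe hbf hde hdf hi h
    simp only [List.append_assoc, List.cons_append, List.nil_append]
    refine ihe hbe hde fun s' h' => ?_
    have hlt : ∀ x < n, s.rreg x = s'.rreg x := fun x hx => (h'.2.1 x hx).symm
    refine ihf (hbf.mono (by omega)) (hdf.congr hbf hlt) fun s'' h'' => ?_
    obtain ⟨h1, h2, h3⟩ := h'.binary h''
    rw [← eval_congr hbf hlt] at h2
    exact ⟨_, hi s'' h1 h2, h _ (h3 y)⟩
  induction e generalizing n s l with
  | reg x =>
    refine .rconst (.radd (h _ ⟨?_, ?_, rfl, rfl⟩))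
    · have : x < n := hb
      rw [State.rreg_setR, State.rreg_setR, State.rreg_setR_ne (by omega)]
      simp [eval]
    · intro x hx
      rw [State.rreg_setR_ne (by omega), State.rreg_setR_ne (by omega)]
  | const k =>
    exact .rconst (h _ ⟨State.rreg_setR, fun x hx => State.rreg_setR_ne (by omega), rfl, rfl⟩)
  | sqrt e ih =>
    simp only [code, List.append_assoc, List.cons_append, List.nil_append]
    refine ih hb hd.1 fun s' h' =>
      ⟨s'.setR n (Real.sqrt (e.eval s.rreg)), ?_, h _ ⟨?_, ?_, ?_, ?_⟩⟩
    · simp only [Instr.exec, h'.1]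
      rw [if_pos hd.2]
    · exact State.rreg_setR
    · intro x hx
      rw [State.rreg_setR_ne (by omega), h'.2.1 x hx]
    · exact h'.2.2.1
    · exact h'.2.2.2
  | add e f ihe ihf =>
    exact bin ihe ihf hb.1 hb.2 hd.1 hd.2
      (fun s' h1 h2 => by simp only [Instr.exec, h1, h2, eval]) h
  | sub e f ihe ihf =>
    exact bin ihe ihf hb.1 hb.2 hd.1 hd.2
      (fun s' h1 h2 => by simp only [Instr.exec, h1, h2, eval]) h
  | mul e f ihe ihf =>
    exact bin ihe ihf hb.1 hb.2 hd.1 hd.2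
      (fun s' h1 h2 => by simp only [Instr.exec, h1, h2, eval]) h
  | div e f ihe ihf =>
    exact bin ihe ihf hb.1 hb.2 hd.1 hd.2.1 (fun s' h1 h2 => by
      simp only [Instr.exec, h1, h2, eval]; rw [if_pos hd.2.2]) h

/-- Evaluate the expressions of a list into the registers `n, n + 1, …`, in this order. -/
def assign : List RExpr → ℕ → List Instr
  | [], _ => []
  | e :: es, n => e.code n ++ assign es (n + 1)

/-- The expressions of a list, evaluated one after the other into the registers `n, n + 1, …`, are
defined and have the values `ys`. -/
def Evaluates : List RExpr → ℕ → (ℕ → ℝ) → List ℝ → Prop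
  | [], _, _, ys => ys = []
  | _ :: _, _, _, [] => False
  | e :: es, n, v, y :: ys =>
    e.Below n ∧ e.Defined v ∧ e.eval v = y ∧ Evaluates es (n + 1) (Function.update v n y) ys

lemma blockRuns_assign {es : List RExpr} {n : ℕ} {s : State} {v : ℕ → ℝ} {ys : List ℝ}
    {Φ : State → Prop} (hv : ∀ x < n, s.rreg x = v x) (hd : Evaluates es n v ys)
    (h : ∀ s', s'.ireg = s.ireg → s'.mem = s.mem → (∀ x < n, s'.rreg x = v x) →
      (∀ (i : ℕ) (hi : i < ys.length), s'.rreg (n + i) = ys[i]) → Φ s') :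
    BlockRuns S z (assign es n) s Φ := by
  induction es generalizing n s v ys with
  | nil =>
    obtain rfl : ys = [] := hd
    exact h s rfl rfl hv fun i hi => absurd hi (by simp)
  | cons e es ih =>
    cases ys with
    | nil => exact hd.elim
    | cons y ys =>
      obtain ⟨h1, h2, rfl, h3⟩ := hd
      have hv' : ∀ x < n, v x = s.rreg x := fun x hx => (hv x hx).symm
      refine blockRuns_code h1 (h2.congr h1 hv') fun s' h' => ?_
      refine ih (fun x hx => ?_) h3 fun s'' h4 h5 h6 h7 => ?_
      · rcases Nat.lt_succ_iff_lt_or_eq.1 hx with hlt | rfl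
        · rw [h'.2.1 x hlt, Function.update_of_ne (by omega), hv x hlt]
        · rw [h'.1, Function.update_self, eval_congr h1 hv']
      · refine h s'' (h4.trans h'.2.2.1) (h5.trans h'.2.2.2) (fun x hx => ?_) fun i hi => ?_
        · rw [h6 x (by omega), Function.update_of_ne (by omega)]
        · cases i with
          | zero => rw [add_zero, h6 n (by omega), Function.update_self]; rfl
          | succ i =>
            have := h7 i (by simpa using hi)
            rw [show n + (i + 1) = n + 1 + i by omega, this]; rfl

end RExpr

/-! ## The layout of the memory -/

/-- The vectors kept in memory: the center, the offset of the current point, its coordinates, its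
residual, and an auxiliary vector. -/
inductive VSlot where
  | center | offset | coord | residual | aux
  deriving DecidableEq

/-- The matrices kept in memory. -/
inductive MSlot where
  | shape | inverse
  deriving DecidableEq

/-- The address of a vector. -/
def VSlot.base (d : ℕ) : VSlot → ℕ
  | center => 1
  | offset => 1 + d + 2 * (d * d)
  | coord => 1 + 2 * d + 2 * (d * d)
  | residual => 1 + 3 * d + 2 * (d * d)
  | aux => 1 + 4 * d + 2 * (d * d)

/-- The integer register that holds the address of a vector. -/
def VSlot.ptr : VSlot → ℕ
  | center => 4
  | offset => 7
  | coord => 8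
  | residual => 9
  | aux => 10

/-- The address of a matrix. -/
def MSlot.base (d : ℕ) : MSlot → ℕ
  | shape => 1 + d
  | inverse => 1 + d + d * d

/-- The integer register that holds the address of a matrix. -/
def MSlot.ptr : MSlot → ℕ
  | shape => 5
  | inverse => 6

lemma VSlot.ptr_lt (t : VSlot) : t.ptr < 20 := by cases t <;> simp [ptr]

lemma MSlot.ptr_lt (t : MSlot) : t.ptr < 20 := by cases t <;> simp [ptr]

lemma VSlot.disjoint {t t' : VSlot} (h : t ≠ t') :
    t.base d + d ≤ t'.base d ∨ t'.base d + d ≤ t.base d := by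
  cases t <;> cases t' <;> first | exact absurd rfl h | (simp only [base]; omega)

lemma VSlot.disjoint_mat (t : VSlot) (t' : MSlot) :
    t.base d + d ≤ t'.base d ∨ t'.base d + d * d ≤ t.base d := by
  cases t <;> cases t' <;> simp only [base, MSlot.base] <;> omega

lemma MSlot.disjoint {t t' : MSlot} (h : t ≠ t') :
    t.base d + d * d ≤ t'.base d ∨ t'.base d + d * d ≤ t.base d := by
  cases t <;> cases t' <;> first | exact absurd rfl h | (simp only [base]; omega)

lemma VSlot.base_pos (t : VSlot) : 1 ≤ t.base d := by cases t <;> simp only [base] <;> omega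

lemma MSlot.base_pos (t : MSlot) : 1 ≤ t.base d := by cases t <;> simp only [base] <;> omega

/-- The last vector ends at `1 + 5 * d + 2 * d ^ 2`, which equals `8 * d ^ 2` for `d = 1`. -/
lemma VSlot.base_le (hd : 1 ≤ d) (t : VSlot) : t.base d + d ≤ 8 * (d * d) := by
  have : d ≤ d * d := Nat.le_mul_self d
  cases t <;> simp only [base] <;> omega

/-- The additional `d` is the room that `runs_stridedMatVec` asks for beyond the end of the matrix.
-/
lemma MSlot.base_le (hd : 1 ≤ d) (t : MSlot) : t.base d + d * d + d ≤ 8 * (d * d) := by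
  have : d ≤ d * d := Nat.le_mul_self d
  cases t <;> simp only [base] <;> omega

lemma row_le {i : ℕ} (hi : i < d) : d * i + d ≤ d * d := by
  rw [← Nat.mul_succ]; exact Nat.mul_le_mul_left d hi

/-- The contents of the memory. -/
structure Store (d : ℕ) where
  scale : ℝ
  vec : VSlot → Fin d → ℝ
  mat : MSlot → Matrix (Fin d) (Fin d) ℝ

namespace Store

/-- Replace a vector. -/
def setVec (m : Store d) (t : VSlot) (x : Fin d → ℝ) : Store d :=
  { m with vec := Function.update m.vec t x }

/-- Replace a matrix. -/
def setMat (m : Store d) (t : MSlot) (x : Matrix (Fin d) (Fin d) ℝ) : Store d :=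
  { m with mat := Function.update m.mat t x }

/-- The memory of the state `s` has the contents `m`, and the integer registers hold the dimension,
the constants and the addresses. -/
structure Holds (m : Store d) (s : State) : Prop where
  dim : s.ireg 0 = d
  one : s.ireg 3 = 1
  zero : s.ireg 11 = 0
  vptr : ∀ t : VSlot, s.ireg t.ptr = t.base d
  mptr : ∀ t : MSlot, s.ireg t.ptr = t.base d
  scale_eq : s.mem 0 = m.scale
  vec_eq : ∀ (t : VSlot) (i : Fin d), s.mem (t.base d + i) = m.vec t i
  mat_eq : ∀ (t : MSlot) (i j : Fin d), s.mem (t.base d + d * i + j) = m.mat t i j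

variable {m : Store d} {s s' : State}

lemma Holds.of_agree (h : m.Holds s) (ha : Agree 20 s s') (hm : s'.mem = s.mem) : m.Holds s' where
  dim := by rw [(ha 0 (by norm_num)).1, h.dim]
  one := by rw [(ha 3 (by norm_num)).1, h.one]
  zero := by rw [(ha 11 (by norm_num)).1, h.zero]
  vptr t := by rw [(ha _ t.ptr_lt).1, h.vptr]
  mptr t := by rw [(ha _ t.ptr_lt).1, h.mptr]
  scale_eq := by rw [hm, h.scale_eq]
  vec_eq t i := by rw [hm, h.vec_eq]
  mat_eq t i j := by rw [hm, h.mat_eq]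

lemma Holds.of_ireg (h : m.Holds s) (ha : s'.ireg = s.ireg) (hm : s'.mem = s.mem) :
    m.Holds s' where
  dim := by rw [ha, h.dim]
  one := by rw [ha, h.one]
  zero := by rw [ha, h.zero]
  vptr t := by rw [ha, h.vptr]
  mptr t := by rw [ha, h.mptr]
  scale_eq := by rw [hm, h.scale_eq]
  vec_eq t i := by rw [hm, h.vec_eq]
  mat_eq t i j := by rw [hm, h.mat_eq]

lemma Holds.setVec (h : m.Holds s) (ha : Agree 20 s s') (t : VSlot) {x : Fin d → ℝ}
    (hx : ∀ i : Fin d, s'.mem (t.base d + i) = x i)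
    (hm : ∀ a, a < t.base d ∨ t.base d + d ≤ a → s'.mem a = s.mem a) : (m.setVec t x).Holds s' where
  dim := by rw [(ha 0 (by norm_num)).1, h.dim]
  one := by rw [(ha 3 (by norm_num)).1, h.one]
  zero := by rw [(ha 11 (by norm_num)).1, h.zero]
  vptr t := by rw [(ha _ t.ptr_lt).1, h.vptr]
  mptr t := by rw [(ha _ t.ptr_lt).1, h.mptr]
  scale_eq := by
    have := t.base_pos (d := d)
    rw [hm _ (by omega)]; exact h.scale_eq
  vec_eq t' i := by
    by_cases ht : t' = t
    · subst ht; rw [hx]; simp [Store.setVec]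
    · have := VSlot.disjoint (d := d) ht
      have := i.2
      rw [hm _ (by omega), h.vec_eq]
      simp [Store.setVec, Function.update_of_ne ht]
  mat_eq t' i j := by
    have := t.disjoint_mat t' (d := d)
    have := row_le i.2
    have := j.2
    rw [hm _ (by omega), h.mat_eq]
    rfl

lemma Holds.setMat (h : m.Holds s) (ha : Agree 20 s s') (t : MSlot) {x : Matrix (Fin d) (Fin d) ℝ}
    (hx : ∀ i j : Fin d, s'.mem (t.base d + d * i + j) = x i j)
    (hm : ∀ a, a < t.base d ∨ t.base d + d * d ≤ a → s'.mem a = s.mem a) :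
    (m.setMat t x).Holds s' where
  dim := by rw [(ha 0 (by norm_num)).1, h.dim]
  one := by rw [(ha 3 (by norm_num)).1, h.one]
  zero := by rw [(ha 11 (by norm_num)).1, h.zero]
  vptr t := by rw [(ha _ t.ptr_lt).1, h.vptr]
  mptr t := by rw [(ha _ t.ptr_lt).1, h.mptr]
  scale_eq := by
    have := t.base_pos (d := d)
    rw [hm _ (by omega)]; exact h.scale_eq
  vec_eq t' i := by
    have := t'.disjoint_mat t (d := d)
    have := i.2
    rw [hm _ (by omega), h.vec_eq]
    rfl
  mat_eq t' i j := by
    by_cases ht : t' = t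
    · subst ht; rw [hx]; simp [Store.setMat]
    · have := MSlot.disjoint (d := d) ht
      have := row_le i.2
      have := j.2
      rw [hm _ (by omega), h.mat_eq]
      simp [Store.setMat, Function.update_of_ne ht]

/-- The registers `1` (the rank) and `2` (the mark that a first point has been seen) are not
constrained by `Holds`. -/
lemma Holds.setI (h : m.Holds s) {r k : ℕ} (hr : r = 1 ∨ r = 2) : m.Holds (s.setI r k) where
  dim := by rw [State.ireg_setI_ne (by omega), h.dim]
  one := by rw [State.ireg_setI_ne (by omega), h.one]
  zero := by rw [State.ireg_setI_ne (by omega), h.zero]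
  vptr t := by
    rw [State.ireg_setI_ne, h.vptr]
    cases t <;> simp only [VSlot.ptr] <;> omega
  mptr t := by
    rw [State.ireg_setI_ne, h.mptr]
    cases t <;> simp only [MSlot.ptr] <;> omega
  scale_eq := h.scale_eq
  vec_eq := h.vec_eq
  mat_eq := h.mat_eq

lemma Holds.setScale (h : m.Holds s) (v : ℝ) :
    ({ m with scale := v } : Store d).Holds (s.setMem 0 v) where
  dim := h.dim
  one := h.one
  zero := h.zero
  vptr := h.vptr
  mptr := h.mptr
  scale_eq := State.mem_setMem
  vec_eq t i := by
    have := t.base_pos (d := d)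
    rw [State.mem_setMem_ne (by omega), h.vec_eq]
  mat_eq t i j := by
    have := t.base_pos (d := d)
    rw [State.mem_setMem_ne (by omega), h.mat_eq]

end Store

/-! ### The subroutines as operations on the stored vectors and matrices -/

section Subroutines

variable {m : Store d} {s : State}

lemma runs_axpby_slot (hd : 1 ≤ d) (hS : 8 * (d * d) ≤ S) (h : m.Holds s) {X Y : VSlot}
    (hXY : X ≠ Y) {p q : ℕ} (hp : p < 20) (hq : q < 20) :
    Runs S z (axpby X.ptr Y.ptr p q) s (200 * (d * d)) fun s' => Agree 20 s s' ∧
      (m.setVec X (s.rreg p • m.vec X + s.rreg q • m.vec Y)).Holds s' := by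
  have hX := X.ptr_lt
  have hY := Y.ptr_lt
  have hXS := X.base_le hd
  have hYS := Y.base_le hd
  refine (runs_axpby (by omega) (by omega) (by omega) (by omega) h.dim h.one (h.vptr X) (h.vptr Y)
    (by omega) (by omega) (VSlot.disjoint hXY)).mono (by nlinarith) fun s' h' => ?_
  have ha : Agree 20 s s' := fun r hr => h'.1 r (by omega)
  refine ⟨ha, h.setVec ha X (fun i => ?_) h'.2.2⟩
  rw [h'.2.1 i i.2, h.vec_eq, h.vec_eq]
  rfl

lemma runs_dot_slot (hd : 1 ≤ d) (hS : 8 * (d * d) ≤ S) (h : m.Holds s) (X Y : VSlot) :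
    Runs S z (stridedDot X.ptr 3 Y.ptr) s (200 * (d * d)) fun s' => Agree 30 s s' ∧ m.Holds s' ∧
      s'.rreg 30 = m.vec X ⬝ᵥ m.vec Y := by
  have hX := X.ptr_lt
  have hY := Y.ptr_lt
  have hXS := X.base_le hd
  have hYS := Y.base_le hd
  refine (runs_stridedDot (by omega) (by omega) (by omega) h.dim h.one (h.vptr X) h.one (h.vptr Y)
    (by omega) (by omega) (by omega)).mono (by nlinarith) fun s' h' => ?_
  refine ⟨h'.1, h.of_agree (fun r hr => h'.1 r (by omega)) h'.2.1, ?_⟩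
  rw [h'.2.2, Finset.sum_range, dotProduct]
  refine Finset.sum_congr rfl fun i _ => ?_
  rw [mul_one, h.vec_eq, h.vec_eq]

lemma runs_mulVec_slot (hd : 1 ≤ d) (hS : 8 * (d * d) ≤ S) (h : m.Holds s) (M : MSlot)
    {X Y : VSlot} (hXY : X ≠ Y) :
    Runs S z (stridedMatVec M.ptr 0 3 X.ptr Y.ptr) s (200 * (d * d)) fun s' =>
      Agree 20 s s' ∧ (m.setVec Y (m.mat M *ᵥ m.vec X)).Holds s' := by
  have hMS := M.base_le hd
  have hXS := X.base_le hd
  have hYS := Y.base_le hd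
  refine (runs_stridedMatVec M.ptr_lt (by omega) (by omega) X.ptr_lt Y.ptr_lt h.dim h.one
    (h.mptr M) h.dim h.one (h.vptr X) (h.vptr Y) (by omega) (by omega) (by omega) (by omega)
    (by omega) (VSlot.disjoint hXY) fun i hi j hj => ?_).mono (by nlinarith) fun s' h' => ?_
  · have := Y.disjoint_mat M (d := d)
    have := row_le hi
    rw [mul_comm i d]
    omega
  refine ⟨h'.1, h.setVec h'.1 Y (fun i => ?_) h'.2.2⟩
  rw [h'.2.1 i i.2, Finset.sum_range, mulVec, dotProduct]
  refine Finset.sum_congr rfl fun j _ => ?_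
  rw [mul_one, mul_comm (i : ℕ) d, h.vec_eq, h.mat_eq]

/-- Exchanging the two strides makes the same code multiply by the transpose. -/
lemma runs_vecMul_slot (hd : 1 ≤ d) (hS : 8 * (d * d) ≤ S) (h : m.Holds s) (M : MSlot)
    {X Y : VSlot} (hXY : X ≠ Y) :
    Runs S z (stridedMatVec M.ptr 3 0 X.ptr Y.ptr) s (200 * (d * d)) fun s' =>
      Agree 20 s s' ∧ (m.setVec Y (m.vec X ᵥ* m.mat M)).Holds s' := by
  have hMS := M.base_le hd
  have hXS := X.base_le hd
  have hYS := Y.base_le hd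
  refine (runs_stridedMatVec M.ptr_lt (by omega) (by omega) X.ptr_lt Y.ptr_lt h.dim h.one
    (h.mptr M) h.one h.dim (h.vptr X) (h.vptr Y) (by omega) (by omega) (by omega) (by omega)
    (by omega) (VSlot.disjoint hXY) fun i hi j hj => ?_).mono (by nlinarith) fun s' h' => ?_
  · have := Y.disjoint_mat M (d := d)
    have := row_le hj
    rw [mul_comm j d]
    omega
  refine ⟨h'.1, h.setVec h'.1 Y (fun i => ?_) h'.2.2⟩
  rw [h'.2.1 i i.2, Finset.sum_range, vecMul, dotProduct]
  refine Finset.sum_congr rfl fun j _ => ?_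
  rw [mul_one, mul_comm (j : ℕ) d, add_right_comm, h.vec_eq, h.mat_eq, mul_comm]

lemma runs_rankOne_slot (hd : 1 ≤ d) (hS : 8 * (d * d) ≤ S) (h : m.Holds s) (M : MSlot)
    (X Y : VSlot) {p q : ℕ} (hp : p < 20) (hq : q < 20) :
    Runs S z (rankOne M.ptr X.ptr Y.ptr p q) s (200 * (d * d)) fun s' =>
      Agree 20 s s' ∧
      (m.setMat M (s.rreg p • m.mat M + s.rreg q • vecMulVec (m.vec X) (m.vec Y))).Holds s' := by
  have hMS := M.base_le hd
  have hXS := X.base_le hd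
  have hYS := Y.base_le hd
  refine (runs_rankOne M.ptr_lt X.ptr_lt Y.ptr_lt hp hq h.dim h.one (h.mptr M) (h.vptr X)
    (h.vptr Y) (by omega) (by omega) (by omega) (X.disjoint_mat M).symm
    (Y.disjoint_mat M).symm).mono (by nlinarith) fun s' h' => ?_
  refine ⟨h'.1, h.setMat h'.1 M (fun i j => ?_) h'.2.2⟩
  rw [h'.2.1 i i.2 j j.2, h.vec_eq, h.vec_eq, h.mat_eq]
  simp only [Matrix.add_apply, Matrix.smul_apply, vecMulVec_apply, smul_eq_mul]
  ring

lemma runs_readPoint_slot (hd : 1 ≤ d) (hS : 8 * (d * d) ≤ S) (h : m.Holds s) (X : VSlot) :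
    Runs S z (readPoint X.ptr) s (200 * (d * d)) fun s' =>
      Agree 20 s s' ∧ (m.setVec X z.ofLp).Holds s' := by
  have hX := X.ptr_lt
  have hXS := X.base_le hd
  refine (runs_readPoint (by omega) h.dim h.one (h.vptr X) (by omega)).mono (by nlinarith)
    fun s' h' => ?_
  have ha : Agree 20 s s' := fun r hr => h'.1 r (by omega)
  exact ⟨ha, h.setVec ha X h'.2.1 h'.2.2⟩

end Subroutines

end Store

/-! ## The program -/

section Program

open Matrix

variable {d : ℕ} {S : ℕ} {z : EuclideanSpace ℝ (Fin d)}

/-- Run programs one after the other. -/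
def Prog.list : List Prog → Prog
  | [] => .skip
  | p :: l => .seq p (list l)

lemma Runs.nil {s : State} {B : ℕ} {Φ : State → Prop} (h : Φ s) :
    Runs S z (.list []) s (([] : List Prog).length * B) Φ :=
  (Runs.skip h).mono (Nat.zero_le _) fun _ h => h

lemma Runs.cons {p : Prog} {l : List Prog} {s : State} {B : ℕ} {Ψ Φ : State → Prop}
    (h : Runs S z p s B Ψ) (h' : ∀ s', Ψ s' → Runs S z (.list l) s' (l.length * B) Φ) :
    Runs S z (.list (p :: l)) s ((p :: l).length * B) Φ := by
  refine (Runs.seq (h.mono le_rfl h')).mono ?_ fun _ h => h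
  rw [List.length_cons, Nat.succ_mul, add_comm]

lemma BlockRuns.runs_of_length_le {l : List Instr} {s : State} {Φ : State → Prop} (hd : 1 ≤ d)
    (hl : l.length ≤ 200) (h : BlockRuns S z l s Φ) : Runs S z (.block l) s (200 * (d * d)) Φ :=
  h.runs.mono (by nlinarith) fun _ h => h

/-- Compute the addresses of the vectors and matrices. -/
def setup : List Prog :=
  [.block [.iconst 3 1, .iadd 4 3 11, .iadd 5 3 0, .iadd 6 5 11],
    .forLoop 30 0 (.block [.iadd 6 6 0]),
    .block [.iadd 7 6 6, .isub 7 7 5, .iadd 8 7 0, .iadd 9 8 0, .iadd 10 9 0]]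

/-- Process the first point. -/
def processFirst : List Prog :=
  [readPoint VSlot.center.ptr, .block [.rconst 1 1, .store 11 1, .iadd 2 0 11]]

open RExpr in
/-- Compute the offset, the coordinates and the residual of a point. -/
def prepare : List Prog :=
  [readPoint VSlot.offset.ptr,
    .block (assign [const 0, const 1, const (-1)] 0),
    axpby VSlot.offset.ptr VSlot.center.ptr 1 2,
    stridedMatVec MSlot.inverse.ptr 0 3 VSlot.offset.ptr VSlot.coord.ptr,
    stridedMatVec MSlot.shape.ptr 0 3 VSlot.coord.ptr VSlot.residual.ptr,
    axpby VSlot.residual.ptr VSlot.offset.ptr 2 1,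
    stridedDot VSlot.residual.ptr 3 VSlot.residual.ptr,
    .block [.radd 3 30 0, .load 4 11],
    stridedDot VSlot.coord.ptr 3 VSlot.coord.ptr,
    .block [.radd 5 30 0]]

open RExpr in
/-- The scalars of an irregular update. -/
def irregularExprs : List RExpr :=
  [sqrt (add (const 1) (mul (const 2) (reg 4))),
    div (add (const 1) (reg 4)) (reg 6),
    div (reg 7) (reg 6),
    div (const 1) (reg 7),
    div (const 1) (mul (reg 7) (reg 3)),
    div (reg 4) (add (const 1) (mul (const 2) (reg 4))),
    div (reg 4) (add (const 1) (reg 4))]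

/-- The irregular update. -/
def irregularUpdate : List Prog :=
  [.block (RExpr.assign irregularExprs 6),
    axpby VSlot.aux.ptr VSlot.offset.ptr 0 0,
    .block [.iadd 29 10 1, .store 29 1],
    rankOne MSlot.shape.ptr VSlot.offset.ptr VSlot.aux.ptr 7 8,
    axpby VSlot.aux.ptr VSlot.coord.ptr 6 2,
    rankOne MSlot.inverse.ptr VSlot.aux.ptr VSlot.residual.ptr 9 10,
    axpby VSlot.center.ptr VSlot.offset.ptr 1 11,
    .block [.store 11 12, .iadd 1 1 3]]

open RExpr in
/-- The scalars of a regular update. -/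
def regularExprs : List RExpr :=
  [sqrt (reg 5),
    div (const 1) (reg 4),
    add (reg 7) (div (mul (const 2) (sub (reg 6) (const 1))) (add (reg 6) (const 1))),
    mul (reg 7) (reg 6),
    div (mul (reg 8) (add (reg 9) (const 1))) (mul (reg 7) (add (reg 8) (const 1))),
    sqrt (div (mul (mul (mul (reg 8) (reg 8)) (sub (reg 8) (const 1))) (add (reg 9) (const 1)))
      (mul (mul (mul (reg 7) (reg 7)) (add (reg 8) (const 1))) (sub (reg 9) (const 1)))),
    div (sub (reg 10) (reg 11)) (reg 5),
    div (const 1) (reg 11),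
    div (sub (div (const 1) (reg 10)) (reg 13)) (reg 5),
    div (div (sub (reg 9) (reg 8)) (mul (reg 7) (add (reg 8) (const 1)))) (reg 6),
    div (const 1) (reg 8)]

/-- The regular update. -/
def regularUpdate : List Prog :=
  [.block (RExpr.assign regularExprs 6),
    rankOne MSlot.shape.ptr VSlot.offset.ptr VSlot.coord.ptr 11 12,
    stridedMatVec MSlot.inverse.ptr 3 0 VSlot.coord.ptr VSlot.aux.ptr,
    rankOne MSlot.inverse.ptr VSlot.coord.ptr VSlot.aux.ptr 13 14,
    axpby VSlot.center.ptr VSlot.offset.ptr 1 15,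
    .block [.store 11 16]]

/-- The streaming program. -/
def program : Prog :=
  .ite (.ilt 2 0) (.seq (.list setup) (.list processFirst))
    (.seq (.list prepare)
      (.ite (.rlt 0 3) (.list irregularUpdate) (.ite (.rlt 1 5) (.list regularUpdate) .skip)))

/-- The memory of the state `s`, with the contents `m`, holds the data `τ`. -/
structure Represents (τ : Tracker d) (m : Store d) (s : State) : Prop where
  holds : m.Holds s
  rank : s.ireg 1 = τ.k
  started : s.ireg 2 = d
  scale : m.scale = τ.α
  shape : m.mat .shape = τ.Q
  inverse : m.mat .inverse = τ.W
  center : m.vec .center = τ.c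

lemma Represents.ofState {τ : Tracker d} {m : Store d} {s : State} (h : Represents τ m s) :
    Rounding.ofState d s = τ.rounding := by
  obtain ⟨h, -, -, h1, h2, -, h3⟩ := h
  simp only [Rounding.ofState, Tracker.rounding, Rounding.mk.injEq]
  refine ⟨?_, ?_, ?_⟩
  · ext i j
    rw [← h2, ← h.mat_eq]
    rfl
  · rw [← h3]
    congr 1
    ext i
    exact h.vec_eq .center i
  · rw [← h1, ← h.scale_eq]

/-- The state after the offset, the coordinates and the residual of `z` have been computed. -/
structure Prepared (τ : Tracker d) (z : EuclideanSpace ℝ (Fin d)) (m : Store d) (s : State) : Prop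
    extends Represents τ m s where
  offset : m.vec .offset = τ.offset z
  coord : m.vec .coord = τ.coord z
  residual : m.vec .residual = τ.residual z
  reg_zero : s.rreg 0 = 0
  reg_one : s.rreg 1 = 1
  reg_two : s.rreg 2 = -1
  reg_three : s.rreg 3 = τ.residual z ⬝ᵥ τ.residual z
  reg_four : s.rreg 4 = τ.α
  reg_five : s.rreg 5 = τ.coord z ⬝ᵥ τ.coord z

lemma runs_setup (hd : 1 ≤ d) (hS : 8 * (d * d) ≤ S) :
    Runs S z (.list setup) (.initial d) (setup.length * (200 * (d * d))) fun s =>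
      s.ireg 1 = 0 ∧ (⟨0, 0, 0⟩ : Store d).Holds s := by
  have hdd : d ≤ d * d := Nat.le_mul_self d
  have h0 : (State.initial d).ireg 0 = d := rfl
  have h11 : ∀ r, r ≠ 0 → (State.initial d).ireg r = 0 := fun r hr => if_neg hr
  have hm : (State.initial d).mem = fun _ => 0 := rfl
  generalize State.initial d = s0 at h0 h11 hm ⊢
  refine .cons (Ψ := fun s => s.ireg 0 = d ∧ s.ireg 1 = 0 ∧ s.ireg 3 = 1 ∧ s.ireg 4 = 1 ∧
    s.ireg 5 = 1 + d ∧ s.ireg 6 = 1 + d ∧ s.ireg 11 = 0 ∧ s.mem = fun _ => 0)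
    (BlockRuns.runs_of_length_le hd (by simp) (.iconst (by omega) (.iadd ?_ (.iadd ?_
      (.iadd ?_ ?_))))) ?_
  all_goals try simp (disch := omega) only [State.ireg_setI, State.ireg_setI_ne, h0, h11]
  · omega
  · omega
  · omega
  · refine ⟨?_, ?_, ?_, ?_, ?_, ?_, ?_, ?_⟩
    all_goals simp (disch := omega) only [State.ireg_setI, State.ireg_setI_ne, h0, h11,
      State.mem_setI, hm, add_zero]
  rintro s ⟨a0, a1, a3, a4, a5, a6, a11, am⟩
  -- Integer registers cannot be multiplied, so `d * d` is produced by adding `d` repeatedly.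
  refine .cons (Ψ := fun s => s.ireg 0 = d ∧ s.ireg 1 = 0 ∧ s.ireg 3 = 1 ∧ s.ireg 4 = 1 ∧
    s.ireg 5 = 1 + d ∧ s.ireg 6 = 1 + d + d * d ∧ s.ireg 11 = 0 ∧ s.mem = fun _ => 0)
    ((Runs.forLoop (c := 1) (N := d) (fun j s => s.ireg 30 = j ∧ s.ireg 0 = d ∧ s.ireg 1 = 0 ∧
      s.ireg 3 = 1 ∧ s.ireg 4 = 1 ∧ s.ireg 5 = 1 + d ∧ s.ireg 6 = 1 + d + j * d ∧ s.ireg 11 = 0 ∧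
      s.mem = fun _ => 0) (by omega) ?_ ?_ ?_).mono (by nlinarith) fun s h => h.2) ?_
  · simp (disch := omega) only [State.ireg_setI, State.ireg_setI_ne, a0, a1, a3, a4, a5, a6, a11,
      State.mem_setI, am, and_self, zero_mul, add_zero]
  · exact fun j s h => ⟨h.1, h.2.1, h.2.2.2.1⟩
  · rintro j hj s ⟨b30, b0, b1, b3, b4, b5, b6, b11, bm⟩
    have : j * d + d ≤ d * d := by rw [← Nat.succ_mul]; exact Nat.mul_le_mul_right d hj
    refine BlockRuns.runs (l := [_]) (.iadd (by omega) ?_)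
    refine ⟨?_, ?_, ?_, ?_, ?_, ?_, ?_, ?_, ?_, ?_, ?_⟩
    all_goals simp (disch := omega) only [State.ireg_setI, State.ireg_setI_ne, b0, b1, b3, b4, b5,
      b6, b11, b30, State.mem_setI, bm, Nat.succ_mul, add_assoc]
  rintro s ⟨b0, b1, b3, b4, b5, b6, b11, bm⟩
  refine .cons (BlockRuns.runs_of_length_le hd (by simp) (.iadd ?_ (.isub (.iadd ?_ (.iadd ?_
    (.iadd ?_ ?_)))))) fun s h => .nil h
  all_goals simp (disch := omega) only [State.ireg_setI, State.ireg_setI_ne, b0, b5, b6]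
  · omega
  · omega
  · omega
  · omega
  have e : 1 + d + d * d + (1 + d + d * d) - (1 + d) = 1 + d + 2 * (d * d) := by omega
  rw [e]
  refine ⟨?_, ?_, ?_, ?_, fun t => ?_, fun t => ?_, ?_, fun t i => ?_, fun t i j => ?_⟩
  · simp (disch := omega) only [State.ireg_setI_ne, b1]
  · simp (disch := omega) only [State.ireg_setI_ne, b0]
  · simp (disch := omega) only [State.ireg_setI_ne, b3]
  · simp (disch := omega) only [State.ireg_setI_ne, b11]
  · cases t <;> simp (disch := omega) only [VSlot.ptr, VSlot.base, State.ireg_setI,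
      State.ireg_setI_ne, b4] <;> ring
  · cases t <;> simp (disch := omega) only [MSlot.ptr, MSlot.base, State.ireg_setI_ne, b5, b6]
  · simp only [State.mem_setI, bm]
  · simp only [State.mem_setI, bm, Pi.zero_apply]
  · simp only [State.mem_setI, bm, Pi.zero_apply, Matrix.zero_apply]

/-- Both matrices are zero because the memory starts at zero; only the center and the scale are
written. Register `2` becomes `d`, so the test `ireg 2 < ireg 0` fails from now on. -/
lemma runs_processFirst (hd : 1 ≤ d) (hS : 8 * (d * d) ≤ S) {s : State} (h1 : s.ireg 1 = 0)
    (h : (⟨0, 0, 0⟩ : Store d).Holds s) :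
    Runs S z (.list processFirst) s (processFirst.length * (200 * (d * d))) fun s' =>
      ∃ m, Represents (.start z) m s' := by
  have hdd : d ≤ d * d := Nat.le_mul_self d
  refine .cons (runs_readPoint_slot hd hS h .center) ?_
  rintro s1 ⟨a1, b1⟩
  have e1 : s1.ireg 1 = 0 := by rw [(a1 1 (by norm_num)).1, h1]
  refine .cons (BlockRuns.runs_of_length_le hd (by simp) (.rconst (.store ?_ (.iadd ?_ ?_))))
    fun s h => .nil h
  · rw [State.ireg_setR, b1.zero]; omega
  · simp only [State.ireg_setMem, State.ireg_setR, b1.zero, b1.dim]; omega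
  simp only [State.ireg_setMem, State.ireg_setR, b1.zero, b1.dim, State.rreg_setR, Int.cast_one]
  refine ⟨_, (((b1.of_ireg (s' := s1.setR 1 1) rfl rfl).setScale 1).setI (r := 2) (.inr rfl)),
    ?_, ?_, ?_, ?_, ?_, ?_⟩
  · rw [State.ireg_setI_ne (by omega)]
    exact e1
  · rw [State.ireg_setI, add_zero]
  all_goals simp [Store.setVec, Tracker.start]

open RExpr in
lemma runs_prepare (hd : 1 ≤ d) (hS : 8 * (d * d) ≤ S) {τ : Tracker d} {m : Store d} {s : State}
    (h : Represents τ m s) :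
    Runs S z (.list prepare) s (prepare.length * (200 * (d * d))) fun s' =>
      ∃ m, Prepared τ z m s' := by
  have hdd : d ≤ d * d := Nat.le_mul_self d
  obtain ⟨h, hk, hf, hα, hQ, hW, hc⟩ := h
  refine .cons (runs_readPoint_slot hd hS h .offset) ?_
  rintro s1 ⟨a1, b1⟩
  refine .cons (Ψ := fun s' => s'.ireg = s1.ireg ∧ s'.mem = s1.mem ∧ s'.rreg 0 = 0 ∧
    s'.rreg 1 = 1 ∧ s'.rreg 2 = -1) (BlockRuns.runs_of_length_le hd (by decide)
    (blockRuns_assign (v := s1.rreg) (ys := [0, 1, -1]) (fun _ _ => rfl) ?_ ?_)) ?_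
  · simp [Evaluates, Below, Defined, eval]
  · intro s' e1 e2 _ e4
    exact ⟨e1, e2, e4 0 (by simp), e4 1 (by simp), e4 2 (by simp)⟩
  rintro s2 ⟨a2, b2, r0, r1, r2⟩
  replace b2 := b1.of_ireg a2 b2
  refine .cons (runs_axpby_slot hd hS b2 (X := .offset) (Y := .center) (by decide) (p := 1)
    (q := 2) (by norm_num) (by norm_num)) ?_
  rintro s3 ⟨a3, b3⟩
  refine .cons (runs_mulVec_slot hd hS b3 .inverse (X := .offset) (Y := .coord) (by decide)) ?_
  rintro s4 ⟨a4, b4⟩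
  refine .cons (runs_mulVec_slot hd hS b4 .shape (X := .coord) (Y := .residual) (by decide)) ?_
  rintro s5 ⟨a5, b5⟩
  refine .cons (runs_axpby_slot hd hS b5 (X := .residual) (Y := .offset) (by decide) (p := 2)
    (q := 1) (by norm_num) (by norm_num)) ?_
  rintro s6 ⟨a6, b6⟩
  have a25 : Agree 20 s2 s5 := (a3.trans a4 le_rfl).trans a5 le_rfl
  have a26 : Agree 20 s2 s6 := a25.trans a6 le_rfl
  rw [r1, r2] at b3 b4 b5 b6
  rw [(a25 2 (by norm_num)).2, (a25 1 (by norm_num)).2, r1, r2] at b6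
  set m6 := Store.setVec _ VSlot.residual _ with hm6
  have c1 : m6.scale = τ.α := hα
  have c2 : m6.mat .shape = τ.Q := hQ
  have c3 : m6.mat .inverse = τ.W := hW
  have c4 : m6.vec .center = τ.c := hc
  have c5 : m6.vec .offset = τ.offset z := by
    simp [hm6, Store.setVec, Tracker.offset, hc, sub_eq_add_neg]
  have c6 : m6.vec .coord = τ.coord z := by
    simp [hm6, Store.setVec, Tracker.coord, Tracker.offset, hc, hW, sub_eq_add_neg]
  have c7 : m6.vec .residual = τ.residual z := by
    simp [hm6, Store.setVec, Tracker.residual, Tracker.coord, Tracker.offset, hc, hW, hQ,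
      sub_eq_add_neg, add_comm]
  clear_value m6
  refine .cons (runs_dot_slot hd hS b6 .residual .residual) ?_
  rintro s7 ⟨a7, b7, r7⟩
  have a27 : Agree 20 s2 s7 := a26.trans a7 (by norm_num)
  rw [c7] at r7
  refine .cons (Ψ := fun s' => s'.ireg = s7.ireg ∧ s'.mem = s7.mem ∧ s'.rreg 0 = 0 ∧
    s'.rreg 1 = 1 ∧ s'.rreg 2 = -1 ∧ s'.rreg 3 = τ.residual z ⬝ᵥ τ.residual z ∧ s'.rreg 4 = τ.α)
    (BlockRuns.runs_of_length_le hd (by simp) (.radd (.load ?_ ?_))) ?_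
  · rw [State.ireg_setR, b7.zero]; omega
  · refine ⟨rfl, rfl, ?_, ?_, ?_, ?_, ?_⟩
    · rw [State.rreg_setR_ne (by omega), State.rreg_setR_ne (by omega),
        (a27 0 (by norm_num)).2, r0]
    · rw [State.rreg_setR_ne (by omega), State.rreg_setR_ne (by omega),
        (a27 1 (by norm_num)).2, r1]
    · rw [State.rreg_setR_ne (by omega), State.rreg_setR_ne (by omega),
        (a27 2 (by norm_num)).2, r2]
    · rw [State.rreg_setR_ne (by omega), State.rreg_setR, r7, (a27 0 (by norm_num)).2, r0,
        add_zero]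
    · rw [State.rreg_setR, State.ireg_setR, State.mem_setR, b7.zero, b7.scale_eq, c1]
  rintro s8 ⟨a8, b8, q0, q1, q2, q3, q4⟩
  replace b8 := b7.of_ireg a8 b8
  refine .cons (runs_dot_slot hd hS b8 .coord .coord) ?_
  rintro s9 ⟨a9, b9, r9⟩
  rw [c6] at r9
  refine .cons (BlockRuns.runs_of_length_le hd (by simp) (.radd ?_)) fun s h => .nil h
  have key : ∀ r < 20, (s9.setR 5 (s9.rreg 30 + s9.rreg 0)).ireg r = s.ireg r := by
    intro r hr
    rw [State.ireg_setR, (a9 r (by omega)).1, a8, (a27 r hr).1, a2, (a1 r hr).1]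
  have key' : ∀ r < 5, (s9.setR 5 (s9.rreg 30 + s9.rreg 0)).rreg r = s8.rreg r := by
    intro r hr
    rw [State.rreg_setR_ne (by omega), (a9 r (by omega)).2]
  exact ⟨m6, ⟨b9.of_ireg rfl rfl, by rw [key 1 (by norm_num), hk],
    by rw [key 2 (by norm_num), hf], c1, c2, c3, c4⟩, c5, c6, c7, by rw [key' 0 (by norm_num), q0],
    by rw [key' 1 (by norm_num), q1], by rw [key' 2 (by norm_num), q2],
    by rw [key' 3 (by norm_num), q3], by rw [key' 4 (by norm_num), q4],
    by rw [State.rreg_setR, r9, (a9 0 (by norm_num)).2, q0, add_zero]⟩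

open RExpr in
lemma runs_irregularUpdate (hd : 1 ≤ d) (hS : 8 * (d * d) ≤ S) {τ : Tracker d} {m : Store d}
    {s : State} (h : Prepared τ z m s) (hα : 0 < τ.α) (hk : τ.k < d)
    (hν : 0 < τ.residual z ⬝ᵥ τ.residual z) :
    Runs S z (.list irregularUpdate) s (irregularUpdate.length * (200 * (d * d))) fun s' =>
      ∃ m, Represents (τ.irregular z) m s' := by
  have hdd : d ≤ d * d := Nat.le_mul_self d
  obtain ⟨⟨h, hk', hf, eα, hQ, hW, hc⟩, ho, hco, hr, r0, r1, r2, r3, r4, r5⟩ := h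
  obtain ⟨g1, g2, g3, -⟩ := Tracker.irregular_scalars hα
  -- The scalars become opaque names, so that simplification cannot rewrite them inside the
  -- expressions to be evaluated.
  obtain ⟨hh, hhdef⟩ : ∃ x, x = √(1 + 2 * τ.α) := ⟨_, rfl⟩
  rw [← hhdef] at g1 g3
  obtain ⟨ρ, hρ⟩ : ∃ x, x = (1 + τ.α) / hh := ⟨_, rfl⟩
  rw [← hρ] at g3
  obtain ⟨ν, hνdef⟩ : ∃ x, x = τ.residual z ⬝ᵥ τ.residual z := ⟨_, rfl⟩
  rw [← hνdef] at hν r3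
  refine .cons (Ψ := fun s' => s'.ireg = s.ireg ∧ s'.mem = s.mem ∧ s'.rreg 0 = 0 ∧
    s'.rreg 1 = 1 ∧ s'.rreg 2 = -1 ∧ s'.rreg 6 = hh ∧ s'.rreg 7 = ρ ∧ s'.rreg 8 = ρ / hh ∧
    s'.rreg 9 = 1 / ρ ∧ s'.rreg 10 = 1 / (ρ * ν) ∧ s'.rreg 11 = τ.α / (1 + 2 * τ.α) ∧
    s'.rreg 12 = τ.α / (1 + τ.α)) (BlockRuns.runs_of_length_le hd (by decide)
    (blockRuns_assign (v := s.rreg) (ys := [hh, ρ, ρ / hh, 1 / ρ, 1 / (ρ * ν),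
      τ.α / (1 + 2 * τ.α), τ.α / (1 + τ.α)]) (fun _ _ => rfl) ?_ ?_)) ?_
  · have n1 : 1 + 2 * τ.α ≠ 0 := by positivity
    have n2 : 1 + τ.α ≠ 0 := by positivity
    have n3 : 0 ≤ 1 + 2 * τ.α := by positivity
    simp [irregularExprs, Evaluates, Below, Defined, eval, r3, r4, ← hhdef, ← hρ, g1.ne', g3.ne',
      hν.ne', n1, n2, n3]
  · intro s' e1 e2 e3 e4
    exact ⟨e1, e2, by rw [e3 0 (by norm_num), r0], by rw [e3 1 (by norm_num), r1],
      by rw [e3 2 (by norm_num), r2], e4 0 (by simp), e4 1 (by simp), e4 2 (by simp),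
      e4 3 (by simp), e4 4 (by simp), e4 5 (by simp), e4 6 (by simp)⟩
  rintro s1 ⟨a1, b1, q0, q1, q2, q6, q7, q8, q9, q10, q11, q12⟩
  replace b1 := h.of_ireg a1 b1
  refine .cons (runs_axpby_slot hd hS b1 (X := .aux) (Y := .offset) (by decide) (p := 0)
    (q := 0) (by norm_num) (by norm_num)) ?_
  rintro s2 ⟨a2, b2⟩
  -- Both coefficients are `0`, which clears the auxiliary vector; a single `1` is then stored in
  -- position `k` to form the basis vector.
  rw [q0, zero_smul, zero_smul, add_zero] at b2
  have e10 : s2.ireg 10 = VSlot.aux.base d := b2.vptr .aux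
  have e1 : s2.ireg 1 = τ.k := by rw [(a2 1 (by norm_num)).1, a1, hk']
  have hb := VSlot.aux.base_le hd
  refine .cons (Ψ := fun s' => Agree 20 s2 s' ∧
      ((m.setVec .aux 0).setVec .aux (basisVec d τ.k)).Holds s')
    (BlockRuns.runs_of_length_le hd (by simp) (.iadd ?_ (.store ?_ ?_))) ?_
  · rw [e10, e1]; omega
  · rw [State.ireg_setI, e10, e1]; omega
  · have ha : Agree 20 s2 (((s2.setI 29 (s2.ireg 10 + s2.ireg 1)).setMem
        ((s2.setI 29 (s2.ireg 10 + s2.ireg 1)).ireg 29)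
        ((s2.setI 29 (s2.ireg 10 + s2.ireg 1)).rreg 1))) :=
      ((Agree.refl 20 s2).setI (by norm_num)).setMem
    refine ⟨ha, b2.setVec ha .aux (fun i => ?_) fun a ha => ?_⟩
    · rw [State.ireg_setI, State.rreg_setI, e10, e1, (a2 1 (by norm_num)).2, q1, basisVec]
      split_ifs with hi
      · rw [hi, State.mem_setMem]
      · rw [State.mem_setMem_ne (by omega), State.mem_setI, b2.vec_eq]
        simp [Store.setVec]
    · rw [State.ireg_setI, e10, e1, State.mem_setMem_ne (by omega), State.mem_setI]
  rintro s3 ⟨a3, b3⟩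
  refine .cons (runs_rankOne_slot hd hS b3 .shape .offset .aux (p := 7) (q := 8) (by norm_num)
    (by norm_num)) ?_
  rintro s4 ⟨a4, b4⟩
  refine .cons (runs_axpby_slot hd hS b4 (X := .aux) (Y := .coord) (by decide) (p := 6)
    (q := 2) (by norm_num) (by norm_num)) ?_
  rintro s5 ⟨a5, b5⟩
  refine .cons (runs_rankOne_slot hd hS b5 .inverse .aux .residual (p := 9) (q := 10) (by norm_num)
    (by norm_num)) ?_
  rintro s6 ⟨a6, b6⟩
  refine .cons (runs_axpby_slot hd hS b6 (X := .center) (Y := .offset) (by decide) (p := 1)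
    (q := 11) (by norm_num) (by norm_num)) ?_
  rintro s7 ⟨a7, b7⟩
  have a13 := a2.trans a3 le_rfl
  have a14 := a13.trans a4 le_rfl
  have a15 := a14.trans a5 le_rfl
  have a16 := a15.trans a6 le_rfl
  have a17 := a16.trans a7 le_rfl
  have e17 : s7.ireg 1 = τ.k := by rw [(a17 1 (by norm_num)).1, a1, hk']
  have e27 : s7.ireg 2 = d := by rw [(a17 2 (by norm_num)).1, a1, hf]
  rw [(a13 7 (by norm_num)).2, (a13 8 (by norm_num)).2, (a14 6 (by norm_num)).2,
    (a14 2 (by norm_num)).2, (a15 9 (by norm_num)).2, (a15 10 (by norm_num)).2,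
    (a16 1 (by norm_num)).2, (a16 11 (by norm_num)).2, q1, q2, q6, q7, q8, q9, q10, q11] at b7
  refine .cons (BlockRuns.runs_of_length_le hd (by simp) (.store ?_ (.iadd ?_ ?_)))
    fun s h => .nil h
  · rw [b7.zero]; omega
  · simp only [State.ireg_setMem, b7.one, e17]; omega
  simp only [State.ireg_setMem, b7.zero, b7.one, e17, (a17 12 (by norm_num)).2, q12]
  refine ⟨_, (b7.setScale (τ.α / (1 + τ.α))).setI (r := 1) (.inl rfl), ?_, ?_, rfl, ?_, ?_, ?_⟩
  · rw [State.ireg_setI]; rfl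
  · rw [State.ireg_setI_ne (by omega)]
    exact e27
  · simp [Store.setVec, Store.setMat, Tracker.irregular, ho, hQ, hρ, hhdef]
  · simp [Store.setVec, Store.setMat, Tracker.irregular, hco, hr, hW, hρ, hhdef, hνdef,
      sub_eq_add_neg]
  · simp [Store.setVec, Store.setMat, Tracker.irregular, ho, hc]

-- The values are those of `Tracker.regular`. No division by zero or root of a negative number
-- occurs, by the bounds `1 < x`, `1 < B` and `1 < a` that `update_scalars` and `update_admissible`
-- supply.
open RExpr in
lemma evaluates_regularExprs {v : ℕ → ℝ} {ν α D A A' x a b : ℝ} (hν : v 5 = ν) (hα : v 4 = α)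
    (h0 : 0 < α) (hA1 : 1 ≤ A) (hD1 : 1 < D) (h1 : 0 < ν) (hD : D = √ν) (hA : A = 1 / α)
    (hA' : A' = A + growth D) (hx : x = A * D) (ha : a = axisLong A A' x)
    (hb : b = √(axisShortSq A A' x)) :
    Evaluates regularExprs 6 v [D, A, A', x, a, b, (a - b) / ν, 1 / b, (1 / a - 1 / b) / ν,
      centerShift A A' x / D, 1 / A'] := by
  obtain ⟨f1, f2, f3, -⟩ := update_scalars hA1 hD1
  obtain ⟨-, -, -, f4, f5, -⟩ := update_admissible hA1 hD1
  rw [← hA', ← hx] at f2 f4 f5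
  rw [← hA'] at f1
  rw [← hx] at f3
  rw [← ha] at f4
  have n0 : α ≠ 0 := h0.ne'
  have n1 : D + 1 ≠ 0 := by positivity
  have n2 : A ≠ 0 := by positivity
  have n3 : A' + 1 ≠ 0 := by linarith
  have n4 : A' ≠ 0 := by linarith
  have n5 : x - 1 ≠ 0 := by linarith
  have n6 : D ≠ 0 := by positivity
  have n7 : a ≠ 0 := by linarith
  have n8 : ν ≠ 0 := h1.ne'
  have n9 : b ≠ 0 := by rw [hb]; exact (Real.sqrt_pos.2 (by linarith)).ne'
  have f6 := zero_le_one.trans f5.le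
  rw [one_div] at hA
  simp only [growth] at hA'
  simp only [axisLong] at ha
  simp only [axisShortSq, pow_two] at hb f6
  simp only [centerShift]
  simp only [regularExprs, Evaluates, Below, Defined, eval, Function.update_apply]
  norm_num [hν, hα, n0, n2, n4, n6, n7, n8, n9, n1, n3, n5, ← hD, ← hb, h1.le, f6]
  norm_num [← hA, ← hA', ← hx, ← ha, ← hb, f6, n0, n2, n4, n6, n7, n8, n9, n1, n3, n5]

lemma runs_regularUpdate (hd : 1 ≤ d) (hS : 8 * (d * d) ≤ S) {τ : Tracker d} {m : Store d}
    {s : State} (h : Prepared τ z m s) (hτ : τ.Valid) (hν : 1 < τ.coord z ⬝ᵥ τ.coord z) :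
    Runs S z (.list regularUpdate) s (regularUpdate.length * (200 * (d * d))) fun s' =>
      ∃ m, Represents (τ.regular z) m s' := by
  have hdd : d ≤ d * d := Nat.le_mul_self d
  obtain ⟨⟨h, hk', hf, eα, hQ, hW, hc⟩, ho, hco, hr, r0, r1, r2, r3, r4, r5⟩ := h
  obtain ⟨hA1, hD1⟩ := Tracker.regular_scalars hτ hν
  obtain ⟨ν, hνdef⟩ : ∃ y, y = τ.coord z ⬝ᵥ τ.coord z := ⟨_, rfl⟩
  rw [← hνdef] at hν r5 hD1
  obtain ⟨D, hD⟩ : ∃ y, y = √ν := ⟨_, rfl⟩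
  obtain ⟨A, hA⟩ : ∃ y, y = 1 / τ.α := ⟨_, rfl⟩
  obtain ⟨A', hA'⟩ : ∃ y, y = A + growth D := ⟨_, rfl⟩
  obtain ⟨x, hx⟩ : ∃ y, y = A * D := ⟨_, rfl⟩
  obtain ⟨a, ha⟩ : ∃ y, y = axisLong A A' x := ⟨_, rfl⟩
  obtain ⟨b, hb⟩ : ∃ y, y = √(axisShortSq A A' x) := ⟨_, rfl⟩
  have hev := evaluates_regularExprs r5 r4 hτ.scale_pos (hA ▸ hA1) (hD ▸ hD1) (by linarith) hD hA
    hA' hx ha hb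
  refine .cons (Ψ := fun s' => s'.ireg = s.ireg ∧ s'.mem = s.mem ∧ s'.rreg 1 = 1 ∧
    s'.rreg 11 = b ∧ s'.rreg 12 = (a - b) / ν ∧ s'.rreg 13 = 1 / b ∧
    s'.rreg 14 = (1 / a - 1 / b) / ν ∧ s'.rreg 15 = centerShift A A' x / D ∧
    s'.rreg 16 = 1 / A') (BlockRuns.runs_of_length_le hd (by decide)
    (RExpr.blockRuns_assign (v := s.rreg) (fun _ _ => rfl) hev ?_)) ?_
  · intro s' e1 e2 e3 e4
    exact ⟨e1, e2, by rw [e3 1 (by norm_num), r1], e4 5 (by simp), e4 6 (by simp), e4 7 (by simp),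
      e4 8 (by simp), e4 9 (by simp), e4 10 (by simp)⟩
  rintro s1 ⟨a1, b1, q1, q11, q12, q13, q14, q15, q16⟩
  replace b1 := h.of_ireg a1 b1
  refine .cons (runs_rankOne_slot hd hS b1 .shape .offset .coord (p := 11) (q := 12) (by norm_num)
    (by norm_num)) ?_
  rintro s2 ⟨a2, b2⟩
  refine .cons (runs_vecMul_slot hd hS b2 .inverse (X := .coord) (Y := .aux) (by decide)) ?_
  rintro s3 ⟨a3, b3⟩
  refine .cons (runs_rankOne_slot hd hS b3 .inverse .coord .aux (p := 13) (q := 14) (by norm_num)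
    (by norm_num)) ?_
  rintro s4 ⟨a4, b4⟩
  refine .cons (runs_axpby_slot hd hS b4 (X := .center) (Y := .offset) (by decide) (p := 1)
    (q := 15) (by norm_num) (by norm_num)) ?_
  rintro s5 ⟨a5, b5⟩
  have a13 := a2.trans a3 le_rfl
  have a14 := a13.trans a4 le_rfl
  have a15 := a14.trans a5 le_rfl
  rw [q11, q12, (a13 13 (by norm_num)).2, (a13 14 (by norm_num)).2, (a14 1 (by norm_num)).2,
    (a14 15 (by norm_num)).2, q1, q13, q14, q15] at b5
  refine .cons (BlockRuns.runs_of_length_le hd (by simp) (.store ?_ ?_)) fun s h => .nil h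
  · rw [b5.zero]; omega
  rw [b5.zero, (a15 16 (by norm_num)).2, q16]
  refine ⟨_, b5.setScale (1 / A'), ?_, ?_, ?_, ?_, ?_, ?_⟩
  · rw [State.ireg_setMem, (a15 1 (by norm_num)).1, a1, hk']; rfl
  · rw [State.ireg_setMem, (a15 2 (by norm_num)).1, a1, hf]
  · simp only [Tracker.regular, ← hνdef, ← hD, ← hA, ← hA']
  · simp [Store.setVec, Store.setMat, Tracker.regular, ho, hco, hQ, hνdef, hD, hA, hA', hx, ha, hb]
  · simp [Store.setVec, Store.setMat, Tracker.regular, hco, hW, hνdef, hD, hA, hA', hx, ha, hb]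
  · simp [Store.setVec, Store.setMat, Tracker.regular, ho, hc, hνdef, hD, hA, hA', hx]

/-- The program processes a later point. -/
lemma runs_program_step (hd : 1 ≤ d) (hS : 8 * (d * d) ≤ S) {τ : Tracker d} {m : Store d}
    {s : State} (h : Represents τ m s) (hτ : τ.Valid)
    (hk : 0 < τ.residual z ⬝ᵥ τ.residual z → τ.k < d) :
    Runs S z program s (4000 * (d * d)) fun s' => ∃ m, Represents (τ.step z) m s' := by
  -- Ten blocks of preparation and at most eight blocks of update, each within `200 * d ^ 2` steps,
  -- and three tests.
  refine (Runs.ite (c := 10 * (200 * (d * d)) + ((8 * (200 * (d * d)) + 1) + 1)) (fun hb => ?_)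
    fun _ => ?_).mono (by nlinarith) fun _ h => h
  · have := h.started
    have := h.holds.dim
    simp only [Test.Holds] at hb
    omega
  refine Runs.seq ((runs_prepare hd hS h).mono le_rfl ?_)
  rintro s1 ⟨m1, h1⟩
  refine Runs.ite (fun hb => ?_) fun hb => Runs.ite (fun hb' => ?_) fun hb' => ?_
  all_goals simp only [Test.Holds, h1.reg_zero, h1.reg_one, h1.reg_three, h1.reg_five] at *
  · rw [Tracker.step, if_pos hb]
    exact (runs_irregularUpdate hd hS h1 hτ.scale_pos (hk hb) hb).mono
      (by simp only [irregularUpdate, List.length_cons, List.length_nil]; omega) fun _ h => h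
  · rw [Tracker.step, if_neg hb, if_pos hb']
    exact (runs_regularUpdate hd hS h1 hτ hb').mono
      (by simp only [regularUpdate, List.length_cons, List.length_nil]; omega) fun _ h => h
  · rw [Tracker.step, if_neg hb, if_neg hb']
    exact (Runs.skip ⟨m1, h1.toRepresents⟩).mono (Nat.zero_le _) fun _ h => h

/-- The program processes the first point. -/
lemma runs_program_start (hd : 1 ≤ d) (hS : 8 * (d * d) ≤ S) :
    Runs S z program (.initial d) (4000 * (d * d)) fun s' =>
      ∃ m, Represents (Tracker.start z) m s' := by
  refine (Runs.ite (c := 3 * (200 * (d * d)) + 2 * (200 * (d * d))) (fun _ => ?_)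
    fun hb => ?_).mono (by nlinarith) fun _ h => h
  · refine Runs.seq ((runs_setup hd hS).mono le_rfl ?_)
    rintro s ⟨h1, h⟩
    exact runs_processFirst hd hS h1 h
  · simp only [Test.Holds, State.initial] at hb
    simp at hb
    omega

end Program

/-! ### Composing the runs on the single points -/

section Main

variable {d : ℕ}

/-- The run of the program. -/
lemma exists_run (hd : 1 ≤ d) {S : ℕ} (hS : 8 * (d * d) ≤ S)
    (z : ℕ → EuclideanSpace ℝ (Fin d)) :
    ∃ (σ : ℕ → State) (T : ℕ → ℕ), σ 0 = State.initial d ∧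
      (∀ t, Exec S (z t) program (σ t) (T t) (σ (t + 1))) ∧ (∀ t, T t ≤ 4000 * (d * d)) ∧
      ∀ n, Rounding.ofState d (σ (n + 1)) = (run z n).rounding := by
  let Φ : ℕ → State → Prop := fun n s =>
    match n with
    | 0 => s = State.initial d
    | n + 1 => ∃ m, Represents (run z n) m s
  have key : ∀ n s, Φ n s → Runs S (z n) program s (4000 * (d * d)) (Φ (n + 1)) := by
    intro n s h
    cases n with
    | zero =>
      obtain rfl : s = _ := h
      exact runs_program_start hd hS
    | succ n =>
      obtain ⟨m, h⟩ := h
      exact runs_program_step hd hS h (runInvariant z n).valid (runInvariant z n).dim_lt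
  -- A successor state is chosen for each admissible state, and the sequence of states is then
  -- defined by recursion.
  choose! T f h1 h2 h3 using key
  let σ : ℕ → State := fun n => Nat.rec (State.initial d) f n
  have hσ : ∀ n, Φ n (σ n) := by
    intro n
    induction n with
    | zero => exact rfl
    | succ n ih => exact h3 n _ ih
  refine ⟨σ, fun n => T n (σ n), rfl, fun n => h1 n _ (hσ n), fun n => h2 n _ (hσ n), fun n => ?_⟩
  obtain ⟨m, h⟩ := hσ (n + 1)
  exact h.ofState

end Main

end StreamRounding

theorem theorem2 :
    ∃ (P : StreamRounding.Prog) (C k : ℕ),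
      ∀ d : ℕ, 1 ≤ d → ∀ z : ℕ → EuclideanSpace ℝ (Fin d),
        ∃ (σ : ℕ → StreamRounding.State) (T : ℕ → ℕ) (ρ : ℕ → StreamRounding.Rounding d),
          -- the algorithm processes the points one at a time, with `C * d ^ 2` memory cells
          σ 0 = StreamRounding.State.initial d ∧
          (∀ t, StreamRounding.Exec (C * d ^ 2) (z t) P (σ t) (T t) (σ (t + 1))) ∧
          -- its running time on the first `n` points
          (∀ n : ℕ, 1 ≤ n →
            ((∑ t ∈ Finset.range n, T t : ℕ) : ℝ) ≤
              C * n * d ^ 2 * (1 + Real.log (n * d)) ^ k) ∧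
          -- the maintained center, ellipsoid and scale
          (∀ t, ρ t = StreamRounding.Rounding.ofState d (σ t)) ∧
          StreamRounding.Rounding.IsFullyOnlineRun z ρ ∧
          ∀ t : ℕ, 1 ≤ t →
            0 < (ρ t).scale ∧ (ρ t).scale ≤ 1 ∧
            (ρ t).inner ⊆ StreamRounding.hull z t ∧
            StreamRounding.hull z t ⊆ (ρ t).outer ∧
            -- the approximation factor
            (2 ≤ StreamRounding.affDim z t →
              1 / (ρ t).scale ≤ C * (StreamRounding.affDim z t *
                Real.log (StreamRounding.affDim z t * StreamRounding.aspect z t))) ∧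
            (StreamRounding.affDim z t = 1 →
              1 / (ρ t).scale ≤ C * (1 + Real.log (StreamRounding.aspect z t))) ∧
            (StreamRounding.affDim z t = 0 → (ρ t).scale = 1) := by
  -- `4000` is the cost per point divided by `d ^ 2`, and it dominates the constants `8` for the
  -- memory and `14` and `8` for the factor. The exponent is `0`: no logarithm is lost in the
  -- running time.
  refine ⟨StreamRounding.program, 4000, 0, fun d hd z => ?_⟩
  obtain ⟨σ, T, h0, h1, h2, h3⟩ := StreamRounding.exists_run hd (S := 4000 * d ^ 2)
    (by nlinarith) z
  refine ⟨σ, T, fun t => StreamRounding.Rounding.ofState d (σ t), h0, h1, fun n _ => ?_,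
    fun _ => rfl, StreamRounding.isFullyOnlineRun_of_run z h3, fun t ht => ?_⟩
  · have h : ∑ t ∈ Finset.range n, T t ≤ 4000 * n * d ^ 2 := by
      refine (Finset.sum_le_card_nsmul _ _ _ fun t _ => h2 t).trans ?_
      rw [Finset.card_range, smul_eq_mul]
      exact le_of_eq (by ring)
    rw [pow_zero, mul_one]
    exact_mod_cast h
  · obtain ⟨n, rfl⟩ : ∃ n, t = n + 1 := ⟨t - 1, by omega⟩
    have hn := StreamRounding.runInvariant z n
    have hA : 1 ≤ 1 / (StreamRounding.run z n).α :=
      (one_le_div hn.valid.scale_pos).2 hn.valid.scale_le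
    simp only [h3]
    refine ⟨hn.valid.scale_pos, hn.valid.scale_le, hn.inner_subset, hn.subset_outer, fun h => ?_,
      fun h => ?_, fun h => StreamRounding.scale_eq_one z n (hn.affDim_eq ▸ h)⟩
    · have := StreamRounding.inv_scale_le_of_two_le z n h
      push_cast
      change 1 / (StreamRounding.run z n).α ≤ _
      linarith
    · have := StreamRounding.inv_scale_le_of_eq_one z n h
      push_cast
      change 1 / (StreamRounding.run z n).α ≤ _
      linarith
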